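/- Let $G$ be a connected (finite or infinite) cubic graph, that is, a connected simple graph in which every vertex has valence 3. The distinguishing number $D(G)$ is the least number of colors in a vertex coloring of $G$ for which the identity is the only color-preserving automorphism. A vertex $v$ of $G$ is of type 2 if its stabilizer $\mathrm{Aut}_v(G)$ fixes one of the three edges incident to $v$ and interchanges the other two; it is of type 3 if $\mathrm{Aut}_v(G)$ fixes none of these edges, but does not induce the full symmetric group $S_3$ on them. For $n\ge 2$ let $T_n$ be the tree in which every vertex has valence 1 or 3 and the vertices of valence 1 (the leaves) are exactly those at distance $n$ from a fixed root vertex. Two leaves form a sibling pair if they have a common neighbor. The graph $R^2_n$ arises from $T_n$ by adding, for every sibling pair of leaves $u,v$, two new vertices $x,y$ and the edges of the 4-cycle $uxvy$ together with the edge $xy$. The graph $R^3_n$ arises from $T_n$ by adding, for every sibling pair of leaves $u,v$, four new vertices $x,y,z,w$ and the edges of the hexagon $uxzvyw$ together with the edges $xy$ and $zw$. **Theorem.** (i) If $G$ has a vertex of type 2, then $D(G)=2$, or $G$ is isomorphic to $R^2_n$ or to $R^3_n$ for some $n\ge 2$. (ii) If $G$ has a vertex of type 3, then $D(G)=2$.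 -/

import Mathlib

universe u

namespace CubicGraph

section Distinguishing

variable {V : Type u} (G : SimpleGraph V)

/-- A vertex coloring is distinguishing if the only automorphism of `G` that preserves all the
colors is the identity. -/
def IsDistinguishing {C : Type*} (c : V → C) : Prop :=
  ∀ φ : G ≃g G, (∀ v, c (φ v) = c v) → ∀ v, φ v = v

/-- The distinguishing number `D(G)`: the least number of colors in a distinguishing coloring
of the vertices (`⊤` if finitely many colors never suffice). -/
noncomputable def distinguishingNumber : ℕ∞ :=
  ⨅ (k : ℕ) (_ : ∃ c : V → Fin k, IsDistinguishing G c), (k : ℕ∞)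

/-- The permutation group that the stabilizer of `v` in `Aut(G)` induces on the neighbors of `v`
(equivalently, on the edges incident to `v`). -/
def localAction (v : V) : Subgroup (Equiv.Perm (G.neighborSet v)) where
  carrier := {σ | ∃ φ : G ≃g G, φ v = v ∧ ∀ a : G.neighborSet v, (σ a : V) = φ a}
  one_mem' := ⟨RelIso.refl _, rfl, fun _ => rfl⟩
  mul_mem' := by
    rintro σ τ ⟨φ, hφ, h⟩ ⟨ψ, hψ, h'⟩
    refine ⟨ψ.trans φ, by simp [hψ, hφ], fun a => ?_⟩
    rw [Equiv.Perm.mul_apply, h, h']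
    rfl
  inv_mem' := by
    rintro σ ⟨φ, hφ, h⟩
    refine ⟨φ.symm, by rw [RelIso.symm_apply_eq, hφ], fun a => ?_⟩
    rw [eq_comm, RelIso.symm_apply_eq, ← h]
    exact congrArg Subtype.val (σ.apply_symm_apply a).symm

/-- A vertex of valence 3 is of type 2 if its stabilizer fixes one incident edge and interchanges
the other two. -/
def IsTypeTwo (v : V) : Prop :=
  (G.neighborSet v).ncard = 3 ∧
    ∃ a b c : G.neighborSet v, a ≠ b ∧ a ≠ c ∧ b ≠ c ∧
      (∀ σ ∈ localAction G v, σ a = a) ∧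
      ∃ σ ∈ localAction G v, σ b = c ∧ σ c = b

/-- A vertex of valence 3 is of type 3 if its stabilizer leaves no incident edge fixed, but does
not induce the full symmetric group on the incident edges. -/
def IsTypeThree (v : V) : Prop :=
  (G.neighborSet v).ncard = 3 ∧
    (¬ ∃ a : G.neighborSet v, ∀ σ ∈ localAction G v, σ a = a) ∧
    localAction G v ≠ ⊤

end Distinguishing

section Families

/-- Vertices of the infinite rooted tree in which the root has three children and every other
vertex has two. The children of the root are `node i []`, and the children of `node i l` are
`node i (false :: l)` and `node i (true :: l)`. -/
inductive TreeNode : Type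
  | root : TreeNode
  | node (i : Fin 3) (l : List Bool) : TreeNode

namespace TreeNode

/-- The distance from the root. -/
def depth : TreeNode → ℕ
  | root => 0
  | node _ l => l.length + 1

/-- `IsChild s t` means that `t` is a child of `s`. -/
inductive IsChild : TreeNode → TreeNode → Prop
  | root (i : Fin 3) : IsChild root (node i [])
  | node (i : Fin 3) (l : List Bool) (b : Bool) : IsChild (node i l) (node i (b :: l))

end TreeNode

/-- The vertices of `T_n`. -/
abbrev TVertex (n : ℕ) : Type := {t : TreeNode // t.depth ≤ n}

/-- The tree `T_n`: all vertices have valence 1 or 3, and the vertices of valence 1 are those at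
distance `n` from the root. -/
def treeT (n : ℕ) : SimpleGraph (TVertex n) :=
  SimpleGraph.fromRel fun s t => TreeNode.IsChild s.1 t.1

/-- The sibling pairs of leaves of `T_n`, for `n ≥ 2`. The pair given by `(i, l)` consists of the
two children of the vertex `node i l`, which has depth `n - 1`. -/
abbrev LeafPair (n : ℕ) : Type := Fin 3 × {l : List Bool // l.length + 2 = n}

/-- The first leaf (`u`) of a sibling pair. -/
def LeafPair.u {n : ℕ} (p : LeafPair n) : TVertex n :=
  ⟨.node p.1 (false :: p.2.1), by have := p.2.2; simp [TreeNode.depth]; omega⟩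

/-- The second leaf (`v`) of a sibling pair. -/
def LeafPair.v {n : ℕ} (p : LeafPair n) : TVertex n :=
  ⟨.node p.1 (true :: p.2.1), by have := p.2.2; simp [TreeNode.depth]; omega⟩

/-- Add to `T_n` one copy of a gadget between the leaves `u`, `v` of every sibling pair of leaves.
The gadget is given by the graph `H` on its vertices other than `u` and `v`, by the set `Nu` of
those that are joined to `u` and the set `Nv` of those that are joined to `v`. -/
def addGadgets (n : ℕ) {I : Type} (H : SimpleGraph I) (Nu Nv : Set I) :
    SimpleGraph (TVertex n ⊕ (LeafPair n × I)) :=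
  SimpleGraph.fromRel fun s t =>
    match s, t with
    | .inl s, .inl t => (treeT n).Adj s t
    | .inl s, .inr (p, a) => (s = p.u ∧ a ∈ Nu) ∨ (s = p.v ∧ a ∈ Nv)
    | .inr (p, a), .inr (q, b) => p = q ∧ H.Adj a b
    | .inr _, .inl _ => False

/-- The vertices of a gadget of type 2 other than `u`, `v`. -/
inductive GadgetTwo : Type
  | x | y

/-- The vertices of a gadget of type 3 other than `u`, `v`. -/
inductive GadgetThree : Type
  | x | y | z | w

/-- The graph `R^2_n`: the gadgets are 4-cycles `u x v y` with the edge `xy`. -/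
def graphRTwo (n : ℕ) : SimpleGraph (TVertex n ⊕ (LeafPair n × GadgetTwo)) :=
  addGadgets n (SimpleGraph.fromEdgeSet {s(.x, .y)}) {.x, .y} {.x, .y}

/-- The graph `R^3_n`: the gadgets are hexagons `u x z v y w` with the edges `xy` and `zw`. -/
def graphRThree (n : ℕ) : SimpleGraph (TVertex n ⊕ (LeafPair n × GadgetThree)) :=
  addGadgets n (SimpleGraph.fromEdgeSet {s(.x, .z), s(.y, .w), s(.x, .y), s(.z, .w)})
    {.x, .w} {.z, .y}

end Families

end CubicGraph

/-!
Color the vertices one after another, starting from some initial coloring, and paint a new vertex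
black only to break a symmetry that fixes everything colored so far. The result is distinguishing
once the initial coloring can be recognized, and this is often possible because the black vertices
leave a trace: every finite set of them that is not contained in the initial one has a member that
is moved to a white vertex by an automorphism fixing the others. In a cubic graph this rules out,
with few exceptions, a further black vertex all of whose neighbors are black.

If `G` has no distinguishing 2-coloring and is neither `K₄` nor `K_{3,3}`, this applied to small
initial patterns shows that the twins and triangles of `G` lie in pieces, copies of `K₄` or
`K_{3,3}` minus an edge whose ends have a common outer neighbor, the root of the piece.
From a vertex `v` of type 2 or 3, walk along a path as long as the stabilizer of the part behind
interchanges the two possible continuations. If the path never enters a piece, its closed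
neighborhood is essentially a recognizable initial pattern, so `G` has a distinguishing 2-coloring
after all. Otherwise, reading the path backwards, each swap doubles the part of the graph
behind it, and `v` is adjacent to the root of a complete binary tree with pieces at its leaves, a
branch. A branch of maximal height leads to a vertex with three branches of the same height at it,
so `G` is covered by `R^2_n` or `R^3_n` with a singleton fiber over this vertex, and the covering is
an isomorphism. At a vertex of type 3 the three branches would be isomorphic and could be
interchanged independently, which contradicts the type.
-/

namespace CubicGraph

variable {V : Type u} {G : SimpleGraph V}

theorem forall_of_forall_adj (hconn : G.Connected) {p : V → Prop} {v : V} (hv : p v)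
    (hadj : ∀ x y, p x → G.Adj x y → p y) (z : V) : p z := by
  have hvz := (SimpleGraph.reachable_iff_reflTransGen v z).1 (hconn.preconnected v z)
  induction hvz with
  | refl => exact hv
  | tail _ h ih => exact hadj _ _ ih h

/-- `HasNbrs G p a b c` means that the neighborhood of `p` consists of the three distinct vertices
`a`, `b`, `c`. -/
structure HasNbrs (G : SimpleGraph V) (p a b c : V) : Prop where
  ne₁₂ : a ≠ b
  ne₁₃ : a ≠ c
  ne₂₃ : b ≠ c
  adj_iff : ∀ x, G.Adj p x ↔ x = a ∨ x = b ∨ x = c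

namespace HasNbrs

variable {p a b c : V}

theorem adj₁ (h : HasNbrs G p a b c) : G.Adj p a := (h.adj_iff a).2 (.inl rfl)

theorem adj₂ (h : HasNbrs G p a b c) : G.Adj p b := (h.adj_iff b).2 (.inr (.inl rfl))

theorem adj₃ (h : HasNbrs G p a b c) : G.Adj p c := (h.adj_iff c).2 (.inr (.inr rfl))

theorem eq_or_eq_or_eq (h : HasNbrs G p a b c) {x : V} (hx : G.Adj p x) :
    x = a ∨ x = b ∨ x = c :=
  (h.adj_iff x).1 hx

theorem eq_third (h : HasNbrs G p a b c) {x : V} (hx : G.Adj p x) (ha : x ≠ a) (hb : x ≠ b) :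
    x = c :=
  ((h.eq_or_eq_or_eq hx).resolve_left ha).resolve_left hb

theorem rotate (h : HasNbrs G p a b c) : HasNbrs G p b c a :=
  ⟨h.ne₂₃, h.ne₁₂.symm, h.ne₁₃.symm, fun x => by rw [h.adj_iff]; tauto⟩

theorem swap₁₂ (h : HasNbrs G p a b c) : HasNbrs G p b a c :=
  ⟨h.ne₁₂.symm, h.ne₂₃, h.ne₁₃, fun x => by rw [h.adj_iff]; tauto⟩

theorem swap₂₃ (h : HasNbrs G p a b c) : HasNbrs G p a c b :=
  ⟨h.ne₁₃, h.ne₁₂, h.ne₂₃.symm, fun x => by rw [h.adj_iff]; tauto⟩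

theorem map (h : HasNbrs G p a b c) (φ : G ≃g G) : HasNbrs G (φ p) (φ a) (φ b) (φ c) := by
  refine ⟨φ.injective.ne h.ne₁₂, φ.injective.ne h.ne₁₃, φ.injective.ne h.ne₂₃, fun x => ?_⟩
  obtain ⟨y, rfl⟩ := φ.surjective x
  rw [φ.map_adj_iff, h.adj_iff]
  simp only [φ.injective.eq_iff]

theorem third_unique (h : HasNbrs G p a b c) {d : V} (h' : HasNbrs G p a b d) : d = c :=
  h.eq_third h'.adj₃ h'.ne₁₃.symm h'.ne₂₃.symm

theorem third_fixed (h : HasNbrs G p a b c) {φ : G ≃g G} (hp : φ p = p) (ha : φ a = a)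
    (hb : φ b = b) : φ c = c :=
  h.third_unique (by simpa only [hp, ha, hb] using h.map φ)

end HasNbrs

/-- Every vertex has exactly three neighbors; unlike `SimpleGraph.IsRegularOfDegree` this needs no
local finiteness instance, and it names the neighbors. -/
def IsCubic (G : SimpleGraph V) : Prop := ∀ p, ∃ a b c, HasNbrs G p a b c

namespace IsCubic

variable {p a b : V}

theorem exists_hasNbrs₂ (hc : IsCubic G) (h : G.Adj p a) : ∃ b c, HasNbrs G p a b c := by
  obtain ⟨x, y, z, hp⟩ := hc p
  obtain rfl | rfl | rfl := hp.eq_or_eq_or_eq h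
  exacts [⟨_, _, hp⟩, ⟨_, _, hp.rotate⟩, ⟨_, _, hp.rotate.rotate⟩]

theorem exists_hasNbrs₁ (hc : IsCubic G) (ha : G.Adj p a) (hb : G.Adj p b) (hab : a ≠ b) :
    ∃ c, HasNbrs G p a b c := by
  obtain ⟨x, y, hp⟩ := hc.exists_hasNbrs₂ ha
  obtain rfl | rfl | rfl := hp.eq_or_eq_or_eq hb
  exacts [absurd rfl hab, ⟨_, hp⟩, ⟨_, hp.swap₂₃⟩]

theorem of_isRegularOfDegree [G.LocallyFinite] (h : G.IsRegularOfDegree 3) : IsCubic G := by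
  classical
  intro p
  obtain ⟨a, b, c, hab, hac, hbc, hset⟩ := Finset.card_eq_three.1 (h p)
  refine ⟨a, b, c, hab, hac, hbc, fun x => ?_⟩
  rw [← SimpleGraph.mem_neighborFinset, hset]
  simp only [Finset.mem_insert, Finset.mem_singleton]

end IsCubic

/-! ### Tracing black vertices -/

/-- `G` has a distinguishing coloring with two colors, encoded by the set `Q` of black vertices. -/
def IsTwoDistinguishable (G : SimpleGraph V) : Prop :=
  ∃ Q : Set V, ∀ φ : G ≃g G, (∀ v, φ v ∈ Q ↔ v ∈ Q) → ∀ v, φ v = v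

theorem IsTwoDistinguishable.distinguishingNumber_eq_two (h : IsTwoDistinguishable G)
    {φ : G ≃g G} {v : V} (hφ : φ v ≠ v) : distinguishingNumber G = 2 := by
  classical
  obtain ⟨Q, hQ⟩ := h
  refine le_antisymm (iInf₂_le_of_le 2 ⟨fun v => if v ∈ Q then 1 else 0, fun ψ hψ => ?_⟩ le_rfl)
    (le_iInf₂ fun k ⟨c, hc⟩ => ?_)
  · refine hQ ψ fun v => ?_
    have hv := hψ v
    by_cases h₁ : ψ v ∈ Q <;> by_cases h₂ : v ∈ Q <;> simp [h₁, h₂] at hv ⊢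
  · by_contra hk
    have : Subsingleton (Fin k) :=
      Fin.subsingleton_iff_le_one.2 (Nat.lt_succ_iff.1 (by exact_mod_cast not_le.1 hk))
    exact hφ (hc φ (fun _ => Subsingleton.elim _ _) v)

/-- Black vertices outside `Q₀` arise only by breaking symmetries: in every finite set of black
vertices not contained in `Q₀`, some vertex is moved into the set `W` of white vertices by an
automorphism that fixes the others. -/
def IsTraced (G : SimpleGraph V) (Q₀ Q W : Set V) : Prop :=
  ∀ A : Set V, A.Finite → A ⊆ Q → ¬ A ⊆ Q₀ →
    ∃ x ∈ A, ∃ φ : G ≃g G, (∀ z ∈ A, z ≠ x → φ z = z) ∧ φ x ∈ W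

/-- A partial coloring of `G` that extends the coloring of `F₀` with black set `Q₀`, is
distinguishing relative to `F₀`, and colors a new vertex black only to break a symmetry. -/
structure PartialColoring (G : SimpleGraph V) (F₀ Q₀ : Set V) where
  domain : Set V
  black : Set V
  base_subset : F₀ ⊆ domain
  black_subset : black ⊆ domain
  mem_black_iff : ∀ v ∈ F₀, v ∈ black ↔ v ∈ Q₀
  exists_adj : ∀ u ∈ domain, ∃ w ∈ domain, G.Adj u w
  rigid : ∀ φ : G ≃g G, (∀ z ∈ F₀, φ z = z) →
    (∀ z ∈ domain, φ z ∈ domain → (φ z ∈ black ↔ z ∈ black)) → ∀ z ∈ domain, φ z = z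
  isTraced : IsTraced G Q₀ black (domain \ black)

namespace PartialColoring

variable {F₀ Q₀ : Set V}

instance : Preorder (PartialColoring G F₀ Q₀) where
  le p q := p.domain ⊆ q.domain ∧ ∀ z ∈ p.domain, z ∈ q.black ↔ z ∈ p.black
  le_refl _ := ⟨subset_rfl, fun _ _ => Iff.rfl⟩
  le_trans _ _ _ h h' :=
    ⟨h.1.trans h'.1, fun z hz => (h'.2 z (h.1 hz)).trans (h.2 z hz)⟩

theorem black_mono {p q : PartialColoring G F₀ Q₀} (h : p ≤ q) : p.black ⊆ q.black :=
  fun z hz => (h.2 z (p.black_subset hz)).2 hz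

/-- The coloring of `F₀` itself. -/
def initial (hsub : Q₀ ⊆ F₀) (hadj : ∀ u ∈ F₀, ∃ w ∈ F₀, G.Adj u w) :
    PartialColoring G F₀ Q₀ where
  domain := F₀
  black := Q₀
  base_subset := subset_rfl
  black_subset := hsub
  mem_black_iff _ _ := Iff.rfl
  exists_adj := hadj
  rigid _ h _ := h
  isTraced _ _ h h' := absurd h h'

theorem mem_iUnion_black_iff {c : Set (PartialColoring G F₀ Q₀)} (hc : IsChain (· ≤ ·) c)
    {p : PartialColoring G F₀ Q₀} (hp : p ∈ c) {z : V} (hz : z ∈ p.domain) :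
    z ∈ ⋃ q ∈ c, q.black ↔ z ∈ p.black := by
  refine ⟨fun h => ?_, fun h => Set.mem_biUnion hp h⟩
  obtain ⟨q, hq, hzq⟩ := Set.mem_iUnion₂.1 h
  obtain hpq | hqp := hc.total hp hq
  · exact (hpq.2 z hz).1 hzq
  · exact black_mono hqp hzq

/-- The union of a nonempty chain of partial colorings. -/
def ofChain (c : Set (PartialColoring G F₀ Q₀)) (hc : IsChain (· ≤ ·) c) (hne : c.Nonempty) :
    PartialColoring G F₀ Q₀ where
  domain := ⋃ p ∈ c, p.domain
  black := ⋃ p ∈ c, p.black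
  base_subset z hz := Set.mem_biUnion hne.some_mem (hne.some.base_subset hz)
  black_subset := Set.iUnion₂_mono fun p _ => p.black_subset
  mem_black_iff v hv := by
    rw [mem_iUnion_black_iff hc hne.some_mem (hne.some.base_subset hv), hne.some.mem_black_iff v hv]
  exists_adj u hu := by
    obtain ⟨p, hp, hup⟩ := Set.mem_iUnion₂.1 hu
    obtain ⟨w, hw, huw⟩ := p.exists_adj u hup
    exact ⟨w, Set.mem_biUnion hp hw, huw⟩
  rigid φ hφ₀ hφ z hz := by
    obtain ⟨p, hp, hzp⟩ := Set.mem_iUnion₂.1 hz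
    refine p.rigid φ hφ₀ (fun y hy hy' => ?_) z hzp
    rw [← mem_iUnion_black_iff hc hp hy, ← mem_iUnion_black_iff hc hp hy']
    exact hφ y (Set.mem_biUnion hp hy) (Set.mem_biUnion hp hy')
  isTraced A hA hAQ hAQ₀ := by
    lift A to Finset V using hA
    have hdir : DirectedOn (fun p q : PartialColoring G F₀ Q₀ => p.black ⊆ q.black) c :=
      fun p hp q hq =>
        let ⟨r, hr, hpr, hqr⟩ := hc.directedOn p hp q hq
        ⟨r, hr, black_mono hpr, black_mono hqr⟩
    obtain ⟨p, hp, hAp⟩ := hdir.exists_mem_subset_of_finset_subset_biUnion hne hAQ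
    obtain ⟨x, hx, φ, hφ, hφF, hφQ⟩ := p.isTraced A A.finite_toSet hAp hAQ₀
    exact ⟨x, hx, φ, hφ, Set.mem_biUnion hp hφF,
      fun h => hφQ ((mem_iUnion_black_iff hc hp hφF).1 h)⟩

theorem exists_isMax (hsub : Q₀ ⊆ F₀) (hadj : ∀ u ∈ F₀, ∃ w ∈ F₀, G.Adj u w) :
    ∃ p : PartialColoring G F₀ Q₀, IsMax p := by
  have : Nonempty (PartialColoring G F₀ Q₀) := ⟨initial hsub hadj⟩
  refine zorn_le_nonempty fun c hc hne => ⟨ofChain c hc hne, fun p hp => ?_⟩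
  exact ⟨Set.subset_biUnion_of_mem (u := domain) hp, fun z hz => mem_iUnion_black_iff hc hp hz⟩

theorem exists_extend_of_fixed (p : PartialColoring G F₀ Q₀) {u x : V} (hu : u ∈ p.domain)
    (hux : G.Adj u x) (hx : x ∉ p.domain)
    (hfix : ∀ φ : G ≃g G, (∀ z ∈ p.domain, φ z = z) → φ x = x) :
    ∃ q, p ≤ q ∧ x ∈ q.domain := by
  refine ⟨⟨insert x p.domain, p.black, p.base_subset.trans (Set.subset_insert _ _),
      p.black_subset.trans (Set.subset_insert _ _), p.mem_black_iff, ?_, ?_, ?_⟩,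
      ⟨Set.subset_insert _ _, fun _ _ => Iff.rfl⟩, Set.mem_insert _ _⟩
  · rintro w (rfl | hw)
    · exact ⟨u, .inr hu, hux.symm⟩
    · obtain ⟨y, hy, hwy⟩ := p.exists_adj w hw
      exact ⟨y, .inr hy, hwy⟩
  · intro φ hφ₀ hφ
    have hF := p.rigid φ hφ₀ fun z hz hz' => hφ z (.inr hz) (.inr hz')
    rintro z (rfl | hz)
    exacts [hfix φ hF, hF z hz]
  · intro A hA hAQ hAQ₀
    obtain ⟨y, hy, φ, hφ, hφF, hφQ⟩ := p.isTraced A hA hAQ hAQ₀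
    exact ⟨y, hy, φ, hφ, .inr hφF, hφQ⟩

/-- `φ` fixes the domain, so `u`, which has a neighbor `w` there, has only the neighbors `x` and
`φ x` outside; coloring `x` black and `φ x` white breaks the symmetry between them. -/
theorem exists_extend_of_moved (p : PartialColoring G F₀ Q₀) {u w x : V} (hu : u ∈ p.domain)
    (hw : w ∈ p.domain) (hx : x ∉ p.domain) {φ : G ≃g G} (hφ : ∀ z ∈ p.domain, φ z = z)
    (hn : HasNbrs G u w x (φ x)) : ∃ q, p ≤ q ∧ x ∈ q.domain := by
  have hφx : φ x ∉ p.domain := fun h => hn.ne₂₃ (φ.injective (hφ _ h)).symm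
  have ne_x : ∀ z ∈ p.domain, z ≠ x := fun z hz h => hx (h ▸ hz)
  refine ⟨⟨insert x (insert (φ x) p.domain), insert x p.black, ?_, ?_, ?_, ?_, ?_, ?_⟩,
    ⟨?_, ?_⟩, Set.mem_insert _ _⟩
  · exact p.base_subset.trans ((Set.subset_insert _ _).trans (Set.subset_insert _ _))
  · exact Set.insert_subset_insert (p.black_subset.trans (Set.subset_insert _ _))
  · intro v hv
    simp only [Set.mem_insert_iff, ne_x v (p.base_subset hv), false_or, p.mem_black_iff v hv]
  · rintro z (rfl | rfl | hz)
    · exact ⟨u, .inr (.inr hu), hn.adj₂.symm⟩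
    · exact ⟨u, .inr (.inr hu), hn.adj₃.symm⟩
    · obtain ⟨y, hy, hzy⟩ := p.exists_adj z hz
      exact ⟨y, .inr (.inr hy), hzy⟩
  · intro ψ hψ₀ hψ
    have hF := p.rigid ψ hψ₀ fun z hz hz' => by
      simpa only [Set.mem_insert_iff, ne_x z hz, ne_x _ hz', false_or] using
        hψ z (.inr (.inr hz)) (.inr (.inr hz'))
    have hψn : HasNbrs G u w (ψ x) (ψ (φ x)) := by simpa only [hF u hu, hF w hw] using hn.map ψ
    have hψx : ψ x = x := by
      obtain h | h | h := hn.eq_or_eq_or_eq hψn.adj₂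
      · exact absurd h.symm hψn.ne₁₂
      · exact h
      · have hblack := (hψ x (.inl rfl) (.inr (.inl h))).2 (.inl rfl)
        rw [h] at hblack
        exact absurd hblack (not_or.2 ⟨hn.ne₂₃.symm, fun h => hφx (p.black_subset h)⟩)
    rintro z (rfl | rfl | hz)
    exacts [hψx, hn.third_fixed (hF u hu) (hF w hw) hψx, hF z hz]
  · intro A hA hAQ hAQ₀
    by_cases hxA : x ∈ A
    · refine ⟨x, hxA, φ, fun z hz hzx => hφ z (p.black_subset ((hAQ hz).resolve_left hzx)),
        .inr (.inl rfl), ?_⟩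
      exact not_or.2 ⟨hn.ne₂₃.symm, fun h => hφx (p.black_subset h)⟩
    · have hAp : A ⊆ p.black := fun z hz => (hAQ hz).resolve_left fun h => hxA (h ▸ hz)
      obtain ⟨z, hz, ψ, hψ, hψF, hψQ⟩ := p.isTraced A hA hAp hAQ₀
      exact ⟨z, hz, ψ, hψ, .inr (.inr hψF), not_or.2 ⟨ne_x _ hψF, hψQ⟩⟩
  · exact (Set.subset_insert _ _).trans (Set.subset_insert _ _)
  · exact fun z hz => or_iff_right (ne_x z hz)

theorem exists_extend (hc : IsCubic G) (p : PartialColoring G F₀ Q₀) {u x : V}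
    (hu : u ∈ p.domain) (hux : G.Adj u x) (hx : x ∉ p.domain) :
    ∃ q, p ≤ q ∧ x ∈ q.domain := by
  by_cases hfix : ∀ φ : G ≃g G, (∀ z ∈ p.domain, φ z = z) → φ x = x
  · exact p.exists_extend_of_fixed hu hux hx hfix
  push Not at hfix
  obtain ⟨φ, hφ, hφx⟩ := hfix
  obtain ⟨w, hw, huw⟩ := p.exists_adj u hu
  have hwx : w ≠ x := fun h => hx (h ▸ hw)
  obtain ⟨y, hn⟩ := hc.exists_hasNbrs₁ huw hux hwx
  have hφn : HasNbrs G u w (φ x) (φ y) := by simpa only [hφ u hu, hφ w hw] using hn.map φ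
  have hy : φ x = y :=
    (hn.eq_or_eq_or_eq hφn.adj₂).resolve_left hφn.ne₁₂.symm |>.resolve_left hφx
  exact p.exists_extend_of_moved hu hw hx hφ (hy ▸ hn)

end PartialColoring

theorem exists_isTraced_extension (hconn : G.Connected) (hc : IsCubic G) {F₀ Q₀ : Set V}
    (hne : F₀.Nonempty) (hsub : Q₀ ⊆ F₀) (hadj : ∀ u ∈ F₀, ∃ w ∈ F₀, G.Adj u w) :
    ∃ Q : Set V, (∀ v ∈ F₀, v ∈ Q ↔ v ∈ Q₀) ∧ IsTraced G Q₀ Q Qᶜ ∧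
      ∀ φ : G ≃g G, (∀ z ∈ F₀, φ z = z) → (∀ z, φ z ∈ Q ↔ z ∈ Q) → ∀ z, φ z = z := by
  obtain ⟨p, hp⟩ := PartialColoring.exists_isMax (G := G) hsub hadj
  obtain ⟨v, hv⟩ := hne
  have hdomain : ∀ z, z ∈ p.domain := by
    refine forall_of_forall_adj hconn (p.base_subset hv) fun u x hu hux => ?_
    by_contra hx
    obtain ⟨q, hpq, hxq⟩ := p.exists_extend hc hu hux hx
    exact hx ((hp hpq).1 hxq)
  refine ⟨p.black, p.mem_black_iff, fun A hA hAQ hAQ₀ => ?_,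
    fun φ h₀ h z => p.rigid φ h₀ (fun z _ _ => h z) z (hdomain z)⟩
  obtain ⟨x, hx, φ, hφ, hφW⟩ := p.isTraced A hA hAQ hAQ₀
  exact ⟨x, hx, φ, hφ, hφW.2⟩

theorem IsTwoDistinguishable.of_initial_coloring (hconn : G.Connected) (hc : IsCubic G)
    (F₀ Q₀ : Set V) (hne : F₀.Nonempty) (hsub : Q₀ ⊆ F₀)
    (hadj : ∀ u ∈ F₀, ∃ w ∈ F₀, G.Adj u w)
    (hfix : ∀ Q : Set V, (∀ v ∈ F₀, v ∈ Q ↔ v ∈ Q₀) → IsTraced G Q₀ Q Qᶜ →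
      ∀ φ : G ≃g G, (∀ z, φ z ∈ Q ↔ z ∈ Q) → ∀ z ∈ F₀, φ z = z) :
    IsTwoDistinguishable G := by
  obtain ⟨Q, hQ, htraced, hrigid⟩ := exists_isTraced_extension hconn hc hne hsub hadj
  exact ⟨Q, fun φ hφ => hrigid φ (hfix Q hQ htraced φ hφ) hφ⟩

/-! ### Twins, pairs and triples -/

theorem exists_swap_of_twins {p q : V} (h : ∀ x, x ≠ p → x ≠ q → (G.Adj p x ↔ G.Adj q x)) :
    ∃ φ : G ≃g G, φ p = q ∧ φ q = p ∧ ∀ x, x ≠ p → x ≠ q → φ x = x := by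
  classical
  refine ⟨⟨Equiv.swap p q, fun {x y} => ?_⟩, Equiv.swap_apply_left p q,
    Equiv.swap_apply_right p q, fun x => Equiv.swap_apply_of_ne_of_ne⟩
  change G.Adj (Equiv.swap p q x) (Equiv.swap p q y) ↔ G.Adj x y
  simp only [Equiv.swap_apply_def]
  split_ifs <;> grind [SimpleGraph.adj_comm, SimpleGraph.irrefl]

namespace HasNbrs

variable {p a b c a' b' d : V}

theorem forall_mem (h : HasNbrs G p a b c) (h' : HasNbrs G p a' b' d) :
    (a' = a ∨ a' = b ∨ a' = c) ∧ (b' = a ∨ b' = b ∨ b' = c) ∧ (d = a ∨ d = b ∨ d = c) :=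
  ⟨h.eq_or_eq_or_eq h'.adj₁, h.eq_or_eq_or_eq h'.adj₂, h.eq_or_eq_or_eq h'.adj₃⟩

theorem eq_or_swap (h : HasNbrs G p a b c) (h' : HasNbrs G p a' b' c) :
    (a' = a ∧ b' = b) ∨ (a' = b ∧ b' = a) := by
  obtain ⟨ha', hb', -⟩ := h.forall_mem h'
  have := h'.ne₁₂
  have := h'.ne₁₃
  have := h'.ne₂₃
  grind

theorem map_eq_or_swap (h : HasNbrs G p a b c) {φ : G ≃g G} (hp : φ p = p) (hc : φ c = c) :
    (φ a = a ∧ φ b = b) ∨ (φ a = b ∧ φ b = a) :=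
  h.eq_or_swap (by simpa only [hp, hc] using h.map φ)

theorem third_eq_of_rel {R : V → V → Prop} (hsymm : ∀ {x y}, R x y → R y x)
    (h : HasNbrs G p a b c) (h' : HasNbrs G p a' b' d) (hR : R a' b') (ha : ¬ R a c)
    (hb : ¬ R b c) : d = c := by
  obtain ⟨ha', hb', hd⟩ := h.forall_mem h'
  have := h'.ne₁₂
  have := h'.ne₁₃
  have := h'.ne₂₃
  have := hsymm hR
  grind

theorem adj_map_of_twins (hc : IsCubic G) {w w' : V} (hw : HasNbrs G w a b c)
    (hw' : HasNbrs G w' a b c) (hne : w ≠ w') {φ : G ≃g G} (hb : φ b = b) : G.Adj w (φ a) := by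
  have hφ : ∀ x, G.Adj b x → G.Adj b (φ x) := fun x hx => hb ▸ φ.map_adj_iff.2 hx
  obtain ⟨r, hr⟩ := hc.exists_hasNbrs₁ hw.adj₂.symm hw'.adj₂.symm hne
  -- `b` has only one neighbor besides `w` and `w'`, so `φ` does not move both of them away.
  have hmeet : ∃ v, (v = w ∨ v = w') ∧ (φ v = w ∨ φ v = w') := by
    by_contra! hcon
    have hwr := (hr.eq_or_eq_or_eq (hφ w hr.adj₁)).resolve_left (hcon w (.inl rfl)).1
    have hwr' := (hr.eq_or_eq_or_eq (hφ w' hr.adj₂)).resolve_left (hcon w' (.inr rfl)).1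
    exact hne (φ.injective ((hwr.resolve_left (hcon w (.inl rfl)).2).trans
      (hwr'.resolve_left (hcon w' (.inr rfl)).2).symm))
  obtain ⟨v, hv, hφv⟩ := hmeet
  have hadj : G.Adj (φ v) (φ a) := by
    rw [φ.map_adj_iff]
    obtain rfl | rfl := hv
    exacts [hw.adj₁, hw'.adj₁]
  obtain h | h := hφv <;> rw [h] at hadj
  · exact hadj
  · rwa [hw.adj_iff, ← hw'.adj_iff]

end HasNbrs

namespace IsTraced

variable {Q₀ Q : Set V} {w a b c : V}

theorem nbrs_mem_base_of_twins (hc : IsCubic G) (hQ : IsTraced G Q₀ Q Qᶜ)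
    (hn : HasNbrs G w a b c) {w' : V} (hn' : HasNbrs G w' a b c) (hne : w ≠ w')
    (ha : a ∈ Q) (hb : b ∈ Q) (hcQ : c ∈ Q) : a ∈ Q₀ ∧ b ∈ Q₀ ∧ c ∈ Q₀ := by
  by_contra hcon
  obtain ⟨x, hx, φ, hφ, hφx⟩ := hQ {a, b, c} (by simp)
    (by rintro z (rfl | rfl | rfl) <;> assumption)
    (fun hs => hcon ⟨hs (by simp), hs (by simp), hs (by simp)⟩)
  have hwQ : ∀ y, G.Adj w y → y ∈ Q := fun y hy => by
    obtain rfl | rfl | rfl := hn.eq_or_eq_or_eq hy <;> assumption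
  refine hφx (hwQ _ ?_)
  obtain rfl | rfl | rfl := hx
  · exact hn.adj_map_of_twins hc hn' hne (hφ b (by simp) hn.ne₁₂.symm)
  · exact hn.rotate.adj_map_of_twins hc hn'.rotate hne (hφ c (by simp) hn.ne₂₃.symm)
  · exact hn.rotate.rotate.adj_map_of_twins hc hn'.rotate.rotate hne (hφ a (by simp) hn.ne₁₃)

theorem nbrs_mem_base (hc : IsCubic G) (hQ : IsTraced G Q₀ Q Qᶜ) (hn : HasNbrs G w a b c)
    (hw : w ∈ Q) (ha : a ∈ Q) (hb : b ∈ Q) (hcQ : c ∈ Q) :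
    (a ∈ Q₀ ∧ b ∈ Q₀ ∧ c ∈ Q₀) ∧ (w ∈ Q₀ ∨ ∃ w', w' ≠ w ∧ HasNbrs G w' a b c) := by
  by_cases hs : w ∈ Q₀ ∧ a ∈ Q₀ ∧ b ∈ Q₀ ∧ c ∈ Q₀
  · exact ⟨hs.2, .inl hs.1⟩
  obtain ⟨x, hx, φ, hφ, hφx⟩ := hQ {w, a, b, c} (by simp)
    (by rintro z (rfl | rfl | rfl | rfl) <;> assumption)
    (fun h => hs ⟨h (by simp), h (by simp), h (by simp), h (by simp)⟩)
  have hwx : w = x := by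
    by_contra hwx
    have hadj : G.Adj w x := (hn.adj_iff x).2 (hx.resolve_left (Ne.symm hwx))
    have hφadj : G.Adj w (φ x) := hφ w (by simp) hwx ▸ φ.map_adj_iff.2 hadj
    obtain h | h | h := hn.eq_or_eq_or_eq hφadj <;> exact hφx (by rw [h]; assumption)
  subst hwx
  have hφn := hn.map φ
  rw [hφ a (by simp) hn.adj₁.ne', hφ b (by simp) hn.adj₂.ne', hφ c (by simp) hn.adj₃.ne'] at hφn
  have hne : φ w ≠ w := fun h => hφx (h.symm ▸ hw)
  exact ⟨nbrs_mem_base_of_twins hc hQ hn hφn hne.symm ha hb hcQ, .inr ⟨_, hne, hφn⟩⟩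

end IsTraced

/-- An automorphism-invariant system of disjoint pairs of vertices `{u, u'}`, in which `u` is
joined to an outer vertex `a` and `u'` to another outer vertex `t`. -/
structure IsPairSystem (G : SimpleGraph V) (P : V → V → V → V → Prop) : Prop where
  map : ∀ (φ : G ≃g G) {u u' a t}, P u u' a t → P (φ u) (φ u') (φ a) (φ t)
  symm : ∀ {u u' a t}, P u u' a t → P u' u t a
  unique : ∀ {u u' a t x y z}, P u u' a t → P u x y z → x = u' ∧ y = a ∧ z = t
  ne : ∀ {u u' a t}, P u u' a t → u ≠ u'
  adj : ∀ {u u' a t}, P u u' a t → G.Adj u a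
  outer_ne : ∀ {u u' a t}, P u u' a t → a ≠ u'
  outer_ne_outer : ∀ {u u' a t}, P u u' a t → a ≠ t

namespace IsPairSystem

variable {P : V → V → V → V → Prop} {u u' a t : V}

theorem eq_or_swap_of_subset (hP : IsPairSystem G P) {v v' b s : V} (h : P u u' a t)
    (h' : P v v' b s) (hsub : ({v, v'} : Set V) ⊆ {u, u', a}) :
    (v = u ∧ v' = u' ∧ b = a ∧ s = t) ∨ (v = u' ∧ b = t) := by
  obtain rfl | rfl | rfl : v = u ∨ v = u' ∨ v = a := hsub (by simp)
  · exact .inl ⟨rfl, hP.unique h h'⟩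
  · exact .inr ⟨rfl, (hP.unique (hP.symm h) h').2.1⟩
  · obtain rfl | rfl | rfl : v' = u ∨ v' = u' ∨ v' = v := hsub (by simp)
    · exact absurd (hP.unique h (hP.symm h')).1 (hP.outer_ne h)
    · exact absurd (hP.unique (hP.symm h) (hP.symm h')).1 (hP.adj h).ne'
    · exact absurd rfl (hP.ne h')

theorem subset_of_isTraced (hP : IsPairSystem G P) (h : P u u' a t) {Q₀ Q : Set V}
    (hQ : IsTraced G Q₀ Q Qᶜ) (hu : u ∈ Q) (hu' : u' ∈ Q) : ({u, u'} : Set V) ⊆ Q₀ := by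
  by_contra hcon
  obtain ⟨x, hx, ψ, hψ, hψx⟩ := hQ {u, u'} (by simp) (by rintro z (rfl | rfl) <;> assumption) hcon
  have hψP := hP.map ψ h
  obtain rfl | rfl := hx
  · rw [hψ u' (by simp) (hP.ne h).symm] at hψP
    have hfix := (hP.unique (hP.symm h) (hP.symm hψP)).1
    exact hψx (hfix.symm ▸ hu)
  · rw [hψ u (by simp) (hP.ne h)] at hψP
    have hfix := (hP.unique h hψP).1
    exact hψx (hfix.symm ▸ hu')

theorem isTwoDistinguishable (hP : IsPairSystem G P) (hconn : G.Connected) (hc : IsCubic G)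
    (h : P u u' a t) : IsTwoDistinguishable G := by
  have hua := hP.adj h
  have hut := hP.adj (hP.symm h)
  refine .of_initial_coloring hconn hc {u, u', a, t} {u, u', a} ⟨u, by simp⟩ ?_ ?_ ?_
  · rintro z (rfl | rfl | rfl) <;> simp
  · rintro z (rfl | rfl | rfl | rfl)
    exacts [⟨a, by simp, hua⟩, ⟨t, by simp, hut⟩, ⟨u, by simp, hua.symm⟩, ⟨u', by simp, hut.symm⟩]
  intro Q hblack hQ φ hφ
  have ht : t ∉ Q := fun htQ => by
    obtain rfl | rfl | rfl := (hblack t (by simp)).1 htQ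
    exacts [hP.outer_ne (hP.symm h) rfl, hut.ne rfl, hP.outer_ne_outer h rfl]
  have hφh := hP.map φ h
  have hsub := hP.subset_of_isTraced hφh hQ
    ((hφ u).2 ((hblack u (by simp)).2 (by simp))) ((hφ u').2 ((hblack u' (by simp)).2 (by simp)))
  obtain ⟨hu, hu', ha, ht'⟩ | ⟨-, ha⟩ := hP.eq_or_swap_of_subset h hφh hsub
  · rintro z (rfl | rfl | rfl | rfl) <;> assumption
  · exact absurd ((hφ a).2 ((hblack a (by simp)).2 (by simp))) (ha ▸ ht)

end IsPairSystem

/-- The ends `u`, `u'` of a piece have distinct neighbors `a`, `t` outside the piece. -/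
structure HasDistinctOuter (u u' a t : V) : Prop where
  outer_ne_outer : a ≠ t
  outer_ne_right : a ≠ u'
  outer_ne_left : t ≠ u

namespace HasDistinctOuter

variable {u u' a t : V}

theorem symm (h : HasDistinctOuter u u' a t) : HasDistinctOuter u' u t a :=
  ⟨h.outer_ne_outer.symm, h.outer_ne_left, h.outer_ne_right⟩

theorem map (h : HasDistinctOuter u u' a t) (φ : G ≃g G) :
    HasDistinctOuter (φ u) (φ u') (φ a) (φ t) :=
  ⟨φ.injective.ne h.outer_ne_outer, φ.injective.ne h.outer_ne_right,
    φ.injective.ne h.outer_ne_left⟩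

end HasDistinctOuter

/-- A diamond with ends `u`, `u'` and middle vertices `b`, `c`; the third neighbors of the ends are
`a`, `t`. -/
structure IsDiamond (G : SimpleGraph V) (u u' a t b c : V) : Prop where
  left : HasNbrs G u a b c
  right : HasNbrs G u' t b c
  middle₁ : HasNbrs G b c u u'
  middle₂ : HasNbrs G c b u u'

namespace IsDiamond

variable {u u' a t b c : V}

theorem symm (h : IsDiamond G u u' a t b c) : IsDiamond G u' u t a b c :=
  ⟨h.right, h.left, h.middle₁.swap₂₃, h.middle₂.swap₂₃⟩

theorem swap_middle (h : IsDiamond G u u' a t b c) : IsDiamond G u u' a t c b :=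
  ⟨h.left.swap₂₃, h.right.swap₂₃, h.middle₂, h.middle₁⟩

theorem map (h : IsDiamond G u u' a t b c) (φ : G ≃g G) :
    IsDiamond G (φ u) (φ u') (φ a) (φ t) (φ b) (φ c) :=
  ⟨h.left.map φ, h.right.map φ, h.middle₁.map φ, h.middle₂.map φ⟩

theorem not_adj_outer (h : IsDiamond G u u' a t b c) (hne : a ≠ u') : ¬ G.Adj b a := fun hba => by
  obtain rfl | rfl | rfl := h.middle₁.eq_or_eq_or_eq hba
  exacts [h.left.ne₁₃ rfl, h.left.adj₁.ne rfl, hne rfl]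

theorem unique (h : IsDiamond G u u' a t b c) (hne : a ≠ u') {x y z b' c' : V}
    (h' : IsDiamond G u x y z b' c') : x = u' ∧ y = a ∧ z = t := by
  obtain rfl : y = a := h.left.rotate.third_eq_of_rel (R := G.Adj) SimpleGraph.Adj.symm
    h'.left.rotate h'.middle₁.adj₁ (h.not_adj_outer hne) (h.swap_middle.not_adj_outer hne)
  wlog hbc : b' = b ∧ c' = c generalizing b c
  · exact this h.swap_middle ((h.left.rotate.eq_or_swap h'.left.rotate).resolve_left hbc)
  obtain ⟨rfl, rfl⟩ := hbc
  obtain rfl := h.middle₁.third_unique h'.middle₁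
  exact ⟨rfl, rfl, h.right.rotate.third_unique h'.right.rotate⟩

theorem isPairSystem : IsPairSystem G fun u u' a t =>
    HasDistinctOuter u u' a t ∧ ∃ b c, IsDiamond G u u' a t b c where
  map φ := fun ⟨hne, _, _, h⟩ => ⟨hne.map φ, _, _, h.map φ⟩
  symm := fun ⟨hne, _, _, h⟩ => ⟨hne.symm, _, _, h.symm⟩
  unique := fun ⟨hne, _, _, h⟩ ⟨_, _, _, h'⟩ => h.unique hne.outer_ne_right h'
  ne := fun ⟨_, _, _, h⟩ => h.middle₁.ne₂₃
  adj := fun ⟨_, _, _, h⟩ => h.left.adj₁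
  outer_ne := fun ⟨hne, _⟩ => hne.outer_ne_right
  outer_ne_outer := fun ⟨hne, _⟩ => hne.outer_ne_outer

end IsDiamond

/-- A copy of `K_{3,3}` minus the edge `uu'`, with sides `{u, z, y}` and `{u', x, w}`; the third
neighbors of `u`, `u'` are `a`, `t`. -/
structure IsBipartitePiece (G : SimpleGraph V) (u u' a t x w z y : V) : Prop where
  left : HasNbrs G u a x w
  right : HasNbrs G u' t z y
  nbrs_x : HasNbrs G x u z y
  nbrs_w : HasNbrs G w u z y
  nbrs_z : HasNbrs G z u' x w
  nbrs_y : HasNbrs G y u' x w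

namespace IsBipartitePiece

variable {u u' a t x w z y : V}

theorem symm (h : IsBipartitePiece G u u' a t x w z y) : IsBipartitePiece G u' u t a z y x w :=
  ⟨h.right, h.left, h.nbrs_z, h.nbrs_y, h.nbrs_x, h.nbrs_w⟩

theorem swap_left (h : IsBipartitePiece G u u' a t x w z y) :
    IsBipartitePiece G u u' a t w x z y :=
  ⟨h.left.swap₂₃, h.right, h.nbrs_w, h.nbrs_x, h.nbrs_z.swap₂₃, h.nbrs_y.swap₂₃⟩

theorem swap_right (h : IsBipartitePiece G u u' a t x w z y) :
    IsBipartitePiece G u u' a t x w y z :=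
  h.symm.swap_left.symm

theorem map (h : IsBipartitePiece G u u' a t x w z y) (φ : G ≃g G) :
    IsBipartitePiece G (φ u) (φ u') (φ a) (φ t) (φ x) (φ w) (φ z) (φ y) :=
  ⟨h.left.map φ, h.right.map φ, h.nbrs_x.map φ, h.nbrs_w.map φ, h.nbrs_z.map φ, h.nbrs_y.map φ⟩

theorem not_twins_outer (h : IsBipartitePiece G u u' a t x w z y) (hne : a ≠ u') :
    ¬ ∀ s, G.Adj x s ↔ G.Adj a s := fun htwins => by
  obtain rfl | rfl | rfl := h.nbrs_z.eq_or_eq_or_eq ((htwins z).1 h.nbrs_x.adj₂).symm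
  exacts [hne rfl, h.left.ne₁₂ rfl, h.left.ne₁₃ rfl]

theorem ne (h : IsBipartitePiece G u u' a t x w z y) : u ≠ u' := by
  rintro rfl
  obtain rfl | rfl | rfl := h.left.eq_or_eq_or_eq h.nbrs_z.adj₁.symm
  · obtain rfl | rfl | rfl := h.left.eq_or_eq_or_eq h.right.adj₃
    exacts [h.right.ne₂₃ rfl, h.nbrs_x.adj₃.ne rfl, h.nbrs_w.adj₃.ne rfl]
  · exact h.nbrs_x.adj₂.ne rfl
  · exact h.nbrs_w.adj₂.ne rfl

theorem unique (h : IsBipartitePiece G u u' a t x w z y) (hne : a ≠ u')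
    {v₁ v₂ v₃ x' w' z' y' : V} (h' : IsBipartitePiece G u v₁ v₂ v₃ x' w' z' y') :
    v₁ = u' ∧ v₂ = a ∧ v₃ = t := by
  obtain rfl : v₂ = a := h.left.rotate.third_eq_of_rel
    (R := fun p q => ∀ s, G.Adj p s ↔ G.Adj q s) (fun hpq s => (hpq s).symm) h'.left.rotate
    (fun s => by rw [h'.nbrs_x.adj_iff, h'.nbrs_w.adj_iff]) (h.not_twins_outer hne)
    (h.swap_left.not_twins_outer hne)
  wlog hxw : x' = x ∧ w' = w generalizing x w
  · exact this h.swap_left ((h.left.rotate.eq_or_swap h'.left.rotate).resolve_left hxw)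
  obtain ⟨rfl, rfl⟩ := hxw
  wlog hzy : z' = z ∧ y' = y generalizing z y
  · exact this h.swap_right
      ((h.nbrs_x.rotate.eq_or_swap h'.nbrs_x.rotate).resolve_left hzy)
  obtain ⟨rfl, rfl⟩ := hzy
  obtain rfl := h.nbrs_z.rotate.third_unique h'.nbrs_z.rotate
  exact ⟨rfl, rfl, h.right.rotate.third_unique h'.right.rotate⟩

theorem isPairSystem : IsPairSystem G fun u u' a t =>
    HasDistinctOuter u u' a t ∧ ∃ x w z y, IsBipartitePiece G u u' a t x w z y where
  map φ := fun ⟨hne, _, _, _, _, h⟩ => ⟨hne.map φ, _, _, _, _, h.map φ⟩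
  symm := fun ⟨hne, _, _, _, _, h⟩ => ⟨hne.symm, _, _, _, _, h.symm⟩
  unique := fun ⟨hne, _, _, _, _, h⟩ ⟨_, _, _, _, _, h'⟩ => h.unique hne.outer_ne_right h'
  ne := fun ⟨_, _, _, _, _, h⟩ => h.ne
  adj := fun ⟨_, _, _, _, _, h⟩ => h.left.adj₁
  outer_ne := fun ⟨hne, _⟩ => hne.outer_ne_right
  outer_ne_outer := fun ⟨hne, _⟩ => hne.outer_ne_outer

end IsBipartitePiece

/-- Three vertices `t i`, each joined to its own outer vertex `u i`. -/
structure IsMatchedTriple (G : SimpleGraph V) (t u : Fin 3 → V) : Prop where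
  injective : Function.Injective t
  outer_injective : Function.Injective u
  ne : ∀ i j, t i ≠ u j
  adj : ∀ i, G.Adj (t i) (u i)

namespace IsMatchedTriple

variable {t u : Fin 3 → V}

theorem map (h : IsMatchedTriple G t u) (φ : G ≃g G) : IsMatchedTriple G (φ ∘ t) (φ ∘ u) :=
  ⟨φ.injective.comp h.injective, φ.injective.comp h.outer_injective,
    fun i j => φ.injective.ne (h.ne i j), fun i => φ.map_adj_iff.2 (h.adj i)⟩

theorem comp_perm (h : IsMatchedTriple G t u) (π : Equiv.Perm (Fin 3)) :
    IsMatchedTriple G (t ∘ π) (u ∘ π) :=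
  ⟨h.injective.comp π.injective, h.outer_injective.comp π.injective, fun _ _ => h.ne _ _,
    fun _ => h.adj _⟩

theorem exists_adj (h : IsMatchedTriple G t u) :
    ∀ z ∈ Set.range t ∪ Set.range u, ∃ w ∈ Set.range t ∪ Set.range u, G.Adj z w := by
  rintro z (⟨i, rfl⟩ | ⟨i, rfl⟩)
  exacts [⟨u i, by simp, h.adj i⟩, ⟨t i, by simp, (h.adj i).symm⟩]

end IsMatchedTriple

/-- An automorphism-invariant system of matched triples, in which two triples with a common member
agree up to order. -/
structure IsTripleSystem (G : SimpleGraph V) (T : (Fin 3 → V) → (Fin 3 → V) → Prop) : Prop where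
  matched : ∀ {t u}, T t u → IsMatchedTriple G t u
  map : ∀ (φ : G ≃g G) {t u}, T t u → T (φ ∘ t) (φ ∘ u)
  comp_perm : ∀ (π : Equiv.Perm (Fin 3)) {t u}, T t u → T (t ∘ π) (u ∘ π)
  exists_perm : ∀ {t u s w}, T t u → T s w → ∀ {i j}, s j = t i →
    ∃ π : Equiv.Perm (Fin 3), s = t ∘ π ∧ w = u ∘ π
  eq_of_outer_eq : ∀ {t u s w}, T t u → T s w → ∀ {i j}, w j = t i → s j = u i
  exists_common_of_dual : ∀ {t u s w}, T t u → T u t → T s w → ∃ i j, s j = t i ∨ s j = u i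

theorem perm_fin_three_eq_one {π : Equiv.Perm (Fin 3)} {i j : Fin 3} (hij : i ≠ j) (hi : π i = i)
    (hj : π j = j) : π = 1 := by
  revert π i j
  decide

namespace IsTripleSystem

variable {T : (Fin 3 → V) → (Fin 3 → V) → Prop} {t u s w : Fin 3 → V}

theorem fixed_of_two_fixed (hT : IsTripleSystem G T) (h : T t u) {ψ : G ≃g G} {i j : Fin 3}
    (hij : i ≠ j) (hi : ψ (t i) = t i) (hj : ψ (t j) = t j ∨ ψ (u j) = u j) :
    (∀ k, ψ (t k) = t k) ∧ ∀ k, ψ (u k) = u k := by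
  obtain ⟨π, hπt, hπu⟩ := hT.exists_perm h (hT.map ψ h) hi
  replace hπt : ∀ k, ψ (t k) = t (π k) := congrFun hπt
  replace hπu : ∀ k, ψ (u k) = u (π k) := congrFun hπu
  have hπj : π j = j := hj.elim
    (fun hj => (hT.matched h).injective ((hπt j).symm.trans hj))
    (fun hj => (hT.matched h).outer_injective ((hπu j).symm.trans hj))
  obtain rfl := perm_fin_three_eq_one hij
    ((hT.matched h).injective ((hπt i).symm.trans hi)) hπj
  exact ⟨hπt, hπu⟩

theorem subset_of_isTraced (hT : IsTripleSystem G T) (h : T t u) {Q₀ Q : Set V}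
    (hQ : IsTraced G Q₀ Q Qᶜ) (hsub : ({t 0, u 0, t 1, u 2} : Set V) ⊆ Q) :
    ({t 0, u 0, t 1, u 2} : Set V) ⊆ Q₀ := by
  by_contra hcon
  obtain ⟨x, hx, ψ, hψ, hψx⟩ := hQ _ (by simp) hsub hcon
  have hm := hT.matched h
  have ht₀₁ : t 0 ≠ t 1 := hm.injective.ne (by decide)
  have hfix : (∀ k, ψ (t k) = t k) ∧ ∀ k, ψ (u k) = u k := by
    obtain rfl | rfl | rfl | rfl := id hx
    · exact hT.fixed_of_two_fixed h (i := 1) (j := 2) (by decide)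
        (hψ _ (by simp) ht₀₁.symm) (.inr (hψ _ (by simp) (hm.ne _ _).symm))
    · exact hT.fixed_of_two_fixed h (i := 0) (j := 1) (by decide)
        (hψ _ (by simp) (hm.ne _ _)) (.inl (hψ _ (by simp) (hm.ne _ _)))
    · exact hT.fixed_of_two_fixed h (i := 0) (j := 2) (by decide)
        (hψ _ (by simp) ht₀₁) (.inr (hψ _ (by simp) (hm.ne _ _).symm))
    · exact hT.fixed_of_two_fixed h (i := 0) (j := 1) (by decide)
        (hψ _ (by simp) (hm.ne _ _)) (.inl (hψ _ (by simp) (hm.ne _ _)))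
  refine hψx ?_
  rw [show ψ x = x by obtain rfl | rfl | rfl | rfl := hx <;> simp only [hfix]]
  exact hsub hx

theorem isTwoDistinguishable_of_dual (hT : IsTripleSystem G T) (hconn : G.Connected)
    (hc : IsCubic G) (h : T t u) (hdual : T u t) : IsTwoDistinguishable G := by
  have hm := hT.matched h
  refine .of_initial_coloring hconn hc (Set.range t ∪ Set.range u) {t 0, t 1, u 0}
    ⟨t 0, by simp⟩ (by rintro z (rfl | rfl | rfl) <;> simp) hm.exists_adj ?_
  intro Q hblack _ φ hφ
  have ht : ∀ i, t i ∈ Q ↔ i ≠ 2 := fun i => by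
    rw [hblack _ (by simp)]
    simp only [Set.mem_insert_iff, Set.mem_singleton_iff, hm.injective.eq_iff, hm.ne, or_false]
    revert i; decide
  have hu : ∀ i, u i ∈ Q ↔ i = 0 := fun i => by
    rw [hblack _ (by simp)]
    simp only [Set.mem_insert_iff, Set.mem_singleton_iff, hm.outer_injective.eq_iff,
      (hm.ne _ _).symm, false_or]
  obtain ⟨i, j, hij | hij⟩ := hT.exists_common_of_dual h hdual (hT.map φ h)
  · obtain ⟨π, hπt, hπu⟩ := hT.exists_perm h (hT.map φ h) hij
    replace hπt : ∀ k, φ (t k) = t (π k) := congrFun hπt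
    replace hπu : ∀ k, φ (u k) = u (π k) := congrFun hπu
    have hπ₂ : π 2 = 2 := by
      simpa only [hπt, ht, ne_eq, not_true, iff_false, not_not] using hφ (t 2)
    have hπ₀ : π 0 = 0 := by simpa only [hπu, hu, iff_true] using hφ (u 0)
    obtain rfl := perm_fin_three_eq_one (by decide) hπ₂ hπ₀
    rintro z (⟨i, rfl⟩ | ⟨i, rfl⟩)
    exacts [hπt i, hπu i]
  · obtain ⟨π, hπ, -⟩ := hT.exists_perm hdual (hT.map φ h) hij
    replace hπ : ∀ k, φ (t k) = u (π k) := congrFun hπ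
    have hπ₀ : ∀ k, k ≠ 2 → π k = 0 := fun k hk =>
      (hu _).1 (hπ k ▸ (hφ (t k)).2 ((ht k).2 hk))
    exact absurd (π.injective ((hπ₀ 0 (by decide)).trans (hπ₀ 1 (by decide)).symm)) (by decide)

theorem dual_of_disjoint_subset (hT : IsTripleSystem G T) (h : T t u) (h' : T s w)
    (hdisj : ∀ i j, s j ≠ t i) (hsub : ({s 0, w 0, s 1, w 2} : Set V) ⊆ {t 0, u 0, t 1, u 2}) :
    T u t := by
  have hm := hT.matched h
  have hm' := hT.matched h'
  have hs : ∀ j ∈ ({0, 1} : Set (Fin 3)), s j = u 0 ∨ s j = u 2 := fun j hj => by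
    have hsj : s j ∈ ({t 0, u 0, t 1, u 2} : Set V) := by
      obtain rfl | rfl := hj <;> exact hsub (by simp)
    simpa only [Set.mem_insert_iff, Set.mem_singleton_iff, hdisj, false_or] using hsj
  have hw₀ : w 0 ∈ ({t 0, u 0, t 1, u 2} : Set V) := hsub (by simp)
  have hw₂ : w 2 ∈ ({t 0, u 0, t 1, u 2} : Set V) := hsub (by simp)
  have hinj := hm'.injective
  have hs₀ := hs 0 (by simp)
  have hs₁ := hs 1 (by simp)
  have hout := fun i j => hT.eq_of_outer_eq h h' (i := i) (j := j)
  have hw_ne_s := fun i j => (hm'.ne i j).symm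
  simp only [Set.mem_insert_iff, Set.mem_singleton_iff] at hw₀ hw₂
  have hs_ne : s 0 ≠ s 1 := hm'.injective.ne (by decide)
  have hw_ne : w 0 ≠ w 2 := hm'.outer_injective.ne (by decide)
  have hu : ∀ i j, u i = u j → i = j := fun _ _ hij => hm.outer_injective hij
  obtain ⟨hs₀, hw₀⟩ : s 0 = u 0 ∧ w 0 = t 0 := by grind
  obtain ⟨hs₁, hw₂⟩ : s 1 = u 2 ∧ w 2 = t 1 := by grind
  have hs₂ : s 2 = u 1 := hout 1 2 hw₂
  have hw₁ : w 1 = t 2 := (hT.eq_of_outer_eq h' h hs₁.symm).symm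
  convert hT.comp_perm (Equiv.swap 1 2) h' using 1 <;> funext i <;> fin_cases i
  exacts [hs₀.symm, hs₂.symm, hs₁.symm, hw₀.symm, hw₂.symm, hw₁.symm]

theorem isTwoDistinguishable_of_not_dual (hT : IsTripleSystem G T) (hconn : G.Connected)
    (hc : IsCubic G) (h : T t u) (hdual : ¬ T u t) : IsTwoDistinguishable G := by
  have hm := hT.matched h
  refine .of_initial_coloring hconn hc (Set.range t ∪ Set.range u) {t 0, u 0, t 1, u 2}
    ⟨t 0, by simp⟩ (by rintro z (rfl | rfl | rfl | rfl) <;> simp) hm.exists_adj ?_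
  intro Q hblack hQ φ hφ
  have ht : ∀ i, t i ∈ Q ↔ i ≠ 2 := fun i => by
    rw [hblack _ (by simp)]
    simp only [Set.mem_insert_iff, Set.mem_singleton_iff, hm.injective.eq_iff, hm.ne, or_false,
      false_or]
    revert i; decide
  have hu : ∀ i, u i ∈ Q ↔ i ≠ 1 := fun i => by
    rw [hblack _ (by simp)]
    simp only [Set.mem_insert_iff, Set.mem_singleton_iff, hm.outer_injective.eq_iff,
      (hm.ne _ _).symm, false_or]
    revert i; decide
  have hφT := hT.map φ h
  have hsub := hT.subset_of_isTraced hφT hQ <| by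
    rintro z (rfl | rfl | rfl | rfl)
    all_goals simp only [Function.comp_apply, hφ, ht, hu]; decide
  obtain ⟨i, j, hij⟩ : ∃ i j, φ (t j) = t i := by
    by_contra! hdisj
    exact hdual (hT.dual_of_disjoint_subset h hφT hdisj hsub)
  obtain ⟨π, hπt, hπu⟩ := hT.exists_perm h hφT hij
  replace hπt : ∀ k, φ (t k) = t (π k) := congrFun hπt
  replace hπu : ∀ k, φ (u k) = u (π k) := congrFun hπu
  have hπ₂ : π 2 = 2 := by simpa only [hπt, ht, ne_eq, not_true, iff_false, not_not] using hφ (t 2)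
  have hπ₁ : π 1 = 1 := by simpa only [hπu, hu, ne_eq, not_true, iff_false, not_not] using hφ (u 1)
  obtain rfl := perm_fin_three_eq_one (by decide) hπ₂ hπ₁
  rintro z (⟨i, rfl⟩ | ⟨i, rfl⟩)
  exacts [hπt i, hπu i]

theorem isTwoDistinguishable (hT : IsTripleSystem G T) (hconn : G.Connected) (hc : IsCubic G)
    (h : T t u) : IsTwoDistinguishable G :=
  (em (T u t)).elim (hT.isTwoDistinguishable_of_dual hconn hc h)
    (hT.isTwoDistinguishable_of_not_dual hconn hc h)

end IsTripleSystem

theorem exists_perm_of_forall_mem_range {α : Type*} {s t : Fin 3 → α} (hs : Function.Injective s)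
    (h : ∀ i, s i ∈ Set.range t) : ∃ π : Equiv.Perm (Fin 3), s = t ∘ π := by
  choose f hf using h
  have hinj : Function.Injective f := fun i j hij => hs (by rw [← hf, ← hf, hij])
  exact ⟨Equiv.ofBijective f (Finite.injective_iff_bijective.1 hinj), funext fun i => (hf i).symm⟩

/-- The common neighbors `t i` of two twins `b` and `c`, matched with their third neighbors. -/
structure IsTwinTriple (G : SimpleGraph V) (b c : V) (t u : Fin 3 → V) : Prop
    extends IsMatchedTriple G t u where
  hasNbrs : ∀ i, HasNbrs G (t i) b c (u i)
  nbrs_left : G.neighborSet b = Set.range t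
  nbrs_right : G.neighborSet c = Set.range t

namespace IsTwinTriple

variable {b c p q : V} {t u s w : Fin 3 → V}

theorem map (h : IsTwinTriple G b c t u) (φ : G ≃g G) :
    IsTwinTriple G (φ b) (φ c) (φ ∘ t) (φ ∘ u) := by
  have hnbrs : ∀ v, G.neighborSet (φ v) = φ '' G.neighborSet v := fun v => by
    ext x
    obtain ⟨y, rfl⟩ := φ.surjective x
    rw [φ.injective.mem_set_image, G.mem_neighborSet, G.mem_neighborSet, φ.map_adj_iff]
  refine ⟨h.toIsMatchedTriple.map φ, fun i => (h.hasNbrs i).map φ, ?_, ?_⟩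
  · rw [hnbrs, h.nbrs_left, Set.range_comp]
  · rw [hnbrs, h.nbrs_right, Set.range_comp]

theorem comp_perm (h : IsTwinTriple G b c t u) (π : Equiv.Perm (Fin 3)) :
    IsTwinTriple G b c (t ∘ π) (u ∘ π) :=
  ⟨h.toIsMatchedTriple.comp_perm π, fun i => h.hasNbrs (π i),
    h.nbrs_left.trans (π.surjective.range_comp t).symm,
    h.nbrs_right.trans (π.surjective.range_comp t).symm⟩

theorem swap_hubs (h : IsTwinTriple G b c t u) : IsTwinTriple G c b t u :=
  ⟨h.toIsMatchedTriple, fun i => (h.hasNbrs i).swap₁₂, h.nbrs_right, h.nbrs_left⟩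

theorem adj_left_iff (h : IsTwinTriple G b c t u) {x : V} : G.Adj b x ↔ G.Adj c x := by
  rw [← G.mem_neighborSet, ← G.mem_neighborSet, h.nbrs_left, h.nbrs_right]

theorem ne_hub (hs : IsTwinTriple G p q s w) (ht : IsTwinTriple G b c t u) (j : Fin 3) :
    s j ≠ b := by
  rintro rfl
  have hnbr : ∀ {x}, G.Adj (s j) x → x ∈ Set.range t := fun hx => ht.nbrs_left ▸ hx
  obtain ⟨m, rfl⟩ := hnbr (hs.hasNbrs j).adj₁
  obtain ⟨n, rfl⟩ := hnbr (hs.hasNbrs j).adj₂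
  have hn := ht.hasNbrs n
  obtain h | h | h := hn.eq_or_eq_or_eq (hs.adj_left_iff.1 (ht.adj m))
  · exact (ht.hasNbrs m).ne₁₃ h.symm
  · exact (ht.hasNbrs m).ne₂₃ h.symm
  · exact (hs.hasNbrs j).ne₁₂ (congrArg t (ht.outer_injective h))

theorem not_twins_outer (h : IsTwinTriple G b c t u) (i : Fin 3) :
    ¬ ∀ x, G.Adj b x ↔ G.Adj (u i) x := fun htwins => by
  obtain ⟨k, hk⟩ := exists_ne i
  obtain hu | hu | hu :=
    (h.hasNbrs k).eq_or_eq_or_eq ((htwins (t k)).1 (h.hasNbrs k).adj₁.symm).symm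
  · exact (h.hasNbrs i).ne₁₃ hu.symm
  · exact (h.hasNbrs i).ne₂₃ hu.symm
  · exact hk (h.outer_injective hu.symm)

theorem exists_perm (ht : IsTwinTriple G b c t u) (hs : IsTwinTriple G p q s w) {i j : Fin 3}
    (hij : s j = t i) : ∃ π : Equiv.Perm (Fin 3), s = t ∘ π ∧ w = u ∘ π := by
  have hsj : HasNbrs G (t i) p q (w j) := hij ▸ hs.hasNbrs j
  have hw : w j = u i := (ht.hasNbrs i).third_eq_of_rel
    (R := fun p q => ∀ x, G.Adj p x ↔ G.Adj q x) (fun h x => (h x).symm) hsj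
    (fun _ => hs.adj_left_iff) (ht.not_twins_outer i) (ht.swap_hubs.not_twins_outer i)
  wlog hhubs : p = b ∧ q = c generalizing b c
  · exact this ht.swap_hubs (((ht.hasNbrs i).eq_or_swap (hw ▸ hsj)).resolve_left hhubs)
  obtain ⟨rfl, rfl⟩ := hhubs
  obtain ⟨π, rfl⟩ := exists_perm_of_forall_mem_range hs.injective fun k =>
    (ht.nbrs_left.symm.trans hs.nbrs_left).symm ▸ Set.mem_range_self k
  exact ⟨π, rfl, funext fun k => (ht.hasNbrs (π k)).third_unique (hs.hasNbrs k)⟩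

theorem eq_of_outer_eq (ht : IsTwinTriple G b c t u) (hs : IsTwinTriple G p q s w) {i j : Fin 3}
    (hij : w j = t i) : s j = u i :=
  ((ht.hasNbrs i).eq_or_eq_or_eq (hij ▸ (hs.adj j).symm)).resolve_left (hs.ne_hub ht j)
    |>.resolve_left (hs.ne_hub ht.swap_hubs j)

theorem exists_common_of_dual (hconn : G.Connected) (ht : IsTwinTriple G b c t u)
    (hu : IsTwinTriple G p q u t) {b' c' : V} (hs : IsTwinTriple G b' c' s w) :
    ∃ i j, s j = t i ∨ s j = u i := by
  have hall : ∀ x, x = b ∨ x = c ∨ x = p ∨ x = q ∨ x ∈ Set.range t ∨ x ∈ Set.range u := by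
    refine forall_of_forall_adj hconn (v := b) (.inl rfl) ?_
    rintro x y (rfl | rfl | rfl | rfl | ⟨i, rfl⟩ | ⟨i, rfl⟩) hxy
    · simp only [ht.nbrs_left ▸ (G.mem_neighborSet _ _).2 hxy, true_or, or_true]
    · simp only [ht.nbrs_right ▸ (G.mem_neighborSet _ _).2 hxy, true_or, or_true]
    · simp only [hu.nbrs_left ▸ (G.mem_neighborSet _ _).2 hxy, or_true]
    · simp only [hu.nbrs_right ▸ (G.mem_neighborSet _ _).2 hxy, or_true]
    · obtain rfl | rfl | rfl := (ht.hasNbrs i).eq_or_eq_or_eq hxy <;> simp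
    · obtain rfl | rfl | rfl := (hu.hasNbrs i).eq_or_eq_or_eq hxy <;> simp
  obtain h | h | h | h | ⟨i, h⟩ | ⟨i, h⟩ := hall (s 0)
  · exact absurd h (hs.ne_hub ht 0)
  · exact absurd h (hs.ne_hub ht.swap_hubs 0)
  · exact absurd h (hs.ne_hub hu 0)
  · exact absurd h (hs.ne_hub hu.swap_hubs 0)
  · exact ⟨i, 0, .inl h.symm⟩
  · exact ⟨i, 0, .inr h.symm⟩

theorem isTripleSystem (hconn : G.Connected) :
    IsTripleSystem G fun t u => ∃ b c, IsTwinTriple G b c t u where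
  matched := fun ⟨_, _, h⟩ => h.toIsMatchedTriple
  map φ := fun ⟨_, _, h⟩ => ⟨_, _, h.map φ⟩
  comp_perm π := fun ⟨_, _, h⟩ => ⟨_, _, h.comp_perm π⟩
  exists_perm := fun ⟨_, _, ht⟩ ⟨_, _, hs⟩ => ht.exists_perm hs
  eq_of_outer_eq := fun ⟨_, _, ht⟩ ⟨_, _, hs⟩ => ht.eq_of_outer_eq hs
  exists_common_of_dual := fun ⟨_, _, ht⟩ ⟨_, _, hu⟩ ⟨_, _, hs⟩ =>
    ht.exists_common_of_dual hconn hu hs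

end IsTwinTriple

/-- The vertices of a triangle, matched with their outer neighbors. -/
structure IsTriangleTriple (G : SimpleGraph V) (t u : Fin 3 → V) : Prop
    extends IsMatchedTriple G t u where
  hasNbrs : ∀ {i j k}, i ≠ j → i ≠ k → j ≠ k → HasNbrs G (t i) (t j) (t k) (u i)

namespace IsTriangleTriple

variable {t u s w : Fin 3 → V}

theorem exists_hasNbrs (h : IsTriangleTriple G t u) (i : Fin 3) :
    ∃ j k, (∀ m, m = i ∨ m = j ∨ m = k) ∧ j ≠ k ∧ HasNbrs G (t i) (t j) (t k) (u i) := by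
  obtain ⟨j, k, hm, hij, hik, hjk⟩ :
      ∃ j k, (∀ m, m = i ∨ m = j ∨ m = k) ∧ i ≠ j ∧ i ≠ k ∧ j ≠ k := by
    revert i; decide
  exact ⟨j, k, hm, hjk, h.hasNbrs hij hik hjk⟩

theorem not_adj_outer (h : IsTriangleTriple G t u) {i j : Fin 3} (hij : i ≠ j) :
    ¬ G.Adj (t i) (u j) := fun hadj => by
  obtain ⟨k, l, -, -, hn⟩ := h.exists_hasNbrs i
  obtain hu | hu | hu := hn.eq_or_eq_or_eq hadj
  exacts [h.ne _ _ hu.symm, h.ne _ _ hu.symm, hij (h.outer_injective hu.symm)]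

theorem exists_perm (ht : IsTriangleTriple G t u) (hs : IsTriangleTriple G s w) {i j : Fin 3}
    (hij : s j = t i) : ∃ π : Equiv.Perm (Fin 3), s = t ∘ π ∧ w = u ∘ π := by
  obtain ⟨i₁, i₂, -, -, hti⟩ := ht.exists_hasNbrs i
  obtain ⟨j₁, j₂, hj, hj₁₂, hsj⟩ := hs.exists_hasNbrs j
  rw [hij] at hsj
  have hadj : G.Adj (s j₁) (s j₂) := by
    obtain ⟨k₁, k₂, hk, -, hn⟩ := hs.exists_hasNbrs j₁
    obtain rfl | rfl | rfl := hk j₂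
    exacts [absurd rfl hj₁₂, hn.adj₁, hn.adj₂]
  have hw : w j = u i := hti.third_eq_of_rel (R := G.Adj) SimpleGraph.Adj.symm hsj hadj
    (ht.not_adj_outer fun h => hti.adj₁.ne (congrArg t h.symm))
    (ht.not_adj_outer fun h => hti.adj₂.ne (congrArg t h.symm))
  obtain ⟨π, rfl⟩ : ∃ π : Equiv.Perm (Fin 3), s = t ∘ π := by
    refine exists_perm_of_forall_mem_range hs.injective fun m => ?_
    obtain rfl | rfl | rfl := hj m
    · exact ⟨i, hij.symm⟩
    all_goals
      obtain ⟨h₁, h₂⟩ | ⟨h₁, h₂⟩ := hti.eq_or_swap (hw ▸ hsj)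
      all_goals simp only [h₁, h₂, Set.mem_range_self]
  refine ⟨π, rfl, funext fun m => ?_⟩
  obtain ⟨k, l, -, -, hn⟩ := ht.exists_hasNbrs (π m)
  have hne : ∀ k, w m ≠ t k := fun k => by simpa using (hs.ne (π.symm k) m).symm
  exact ((hn.eq_or_eq_or_eq (hs.adj m)).resolve_left (hne k)).resolve_left (hne l)

theorem eq_of_outer_eq (ht : IsTriangleTriple G t u) (hs : IsTriangleTriple G s w) {i j : Fin 3}
    (hij : w j = t i) : s j = u i := by
  have hne : ∀ k, s j ≠ t k := fun k hk => by
    obtain ⟨π, rfl, rfl⟩ := ht.exists_perm hs hk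
    exact ht.ne _ _ hij.symm
  obtain ⟨k, l, -, -, hn⟩ := ht.exists_hasNbrs i
  exact ((hn.eq_or_eq_or_eq (hij ▸ (hs.adj j).symm)).resolve_left (hne k)).resolve_left (hne l)

theorem exists_eq_of_dual (hconn : G.Connected) (ht : IsTriangleTriple G t u)
    (hu : IsTriangleTriple G u t) (x : V) : ∃ i, x = t i ∨ x = u i := by
  refine forall_of_forall_adj hconn (p := fun x => ∃ i, x = t i ∨ x = u i) (v := t 0)
    ⟨0, .inl rfl⟩ ?_ x
  rintro _ y ⟨i, rfl | rfl⟩ hxy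
  · obtain ⟨j, k, -, -, hn⟩ := ht.exists_hasNbrs i
    obtain h | h | h := hn.eq_or_eq_or_eq hxy
    exacts [⟨j, .inl h⟩, ⟨k, .inl h⟩, ⟨i, .inr h⟩]
  · obtain ⟨j, k, -, -, hn⟩ := hu.exists_hasNbrs i
    obtain h | h | h := hn.eq_or_eq_or_eq hxy
    exacts [⟨j, .inr h⟩, ⟨k, .inr h⟩, ⟨i, .inl h⟩]

theorem isTripleSystem (hconn : G.Connected) : IsTripleSystem G (IsTriangleTriple G) where
  matched h := h.toIsMatchedTriple
  map φ _ _ h := ⟨h.toIsMatchedTriple.map φ, fun hij hik hjk => (h.hasNbrs hij hik hjk).map φ⟩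
  comp_perm π _ _ h := ⟨h.toIsMatchedTriple.comp_perm π, fun hij hik hjk =>
    h.hasNbrs (π.injective.ne hij) (π.injective.ne hik) (π.injective.ne hjk)⟩
  exists_perm ht hs _ _ := ht.exists_perm hs
  eq_of_outer_eq ht hs _ _ := ht.eq_of_outer_eq hs
  exists_common_of_dual ht hu _ :=
    let ⟨i, hi⟩ := exists_eq_of_dual hconn ht hu _
    ⟨i, 0, hi⟩

end IsTriangleTriple

/-! ### Pendant pieces -/

/-- A diamond whose ends `e₁`, `e₂` have the same outer neighbor `l`, so that the piece is joined to
the rest of the graph by the single edge from its root `l` to `o`. -/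
structure IsPendantDiamond (G : SimpleGraph V) (l o e₁ e₂ b c : V) : Prop
    extends IsDiamond G e₁ e₂ l l b c where
  root : HasNbrs G l o e₁ e₂

namespace IsPendantDiamond

variable {l o e₁ e₂ b c : V}

theorem map (h : IsPendantDiamond G l o e₁ e₂ b c) (φ : G ≃g G) :
    IsPendantDiamond G (φ l) (φ o) (φ e₁) (φ e₂) (φ b) (φ c) :=
  ⟨h.toIsDiamond.map φ, h.root.map φ⟩

theorem symm (h : IsPendantDiamond G l o e₁ e₂ b c) : IsPendantDiamond G l o e₂ e₁ b c :=
  ⟨h.toIsDiamond.symm, h.root.swap₂₃⟩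

theorem swap_middle (h : IsPendantDiamond G l o e₁ e₂ b c) : IsPendantDiamond G l o e₁ e₂ c b :=
  ⟨h.toIsDiamond.swap_middle, h.root⟩

end IsPendantDiamond

/-- The analogue of `IsPendantDiamond` for `K_{3,3}` minus an edge. -/
structure IsPendantBipartite (G : SimpleGraph V) (l o e₁ e₂ x w z y : V) : Prop
    extends IsBipartitePiece G e₁ e₂ l l x w z y where
  root : HasNbrs G l o e₁ e₂

namespace IsPendantBipartite

variable {l o e₁ e₂ x w z y : V}

theorem map (h : IsPendantBipartite G l o e₁ e₂ x w z y) (φ : G ≃g G) :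
    IsPendantBipartite G (φ l) (φ o) (φ e₁) (φ e₂) (φ x) (φ w) (φ z) (φ y) :=
  ⟨h.toIsBipartitePiece.map φ, h.root.map φ⟩

theorem symm (h : IsPendantBipartite G l o e₁ e₂ x w z y) :
    IsPendantBipartite G l o e₂ e₁ z y x w :=
  ⟨h.toIsBipartitePiece.symm, h.root.swap₂₃⟩

theorem swap_left (h : IsPendantBipartite G l o e₁ e₂ x w z y) :
    IsPendantBipartite G l o e₁ e₂ w x z y :=
  ⟨h.toIsBipartitePiece.swap_left, h.root⟩

end IsPendantBipartite

/-- The two kinds of pendant pieces, which occur in `R^2_n` and in `R^3_n` respectively. -/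
inductive PieceKind : Type
  | diamond | bipartite

/-- The vertex `l` is the root of a pendant piece of the given kind, and is joined to the rest of
the graph through `o`. -/
def IsPieceRoot (G : SimpleGraph V) : PieceKind → V → V → Prop
  | .diamond, l, o => ∃ e₁ e₂ b c, IsPendantDiamond G l o e₁ e₂ b c
  | .bipartite, l, o => ∃ e₁ e₂ x w z y, IsPendantBipartite G l o e₁ e₂ x w z y

/-- The vertices of pendant pieces other than the roots; up to the symmetries of a piece, it
suffices to name two of them. -/
def IsInterior (G : SimpleGraph V) (v : V) : Prop :=
  (∃ l o e₁ e₂ b c, IsPendantDiamond G l o e₁ e₂ b c ∧ (v = e₁ ∨ v = b)) ∨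
    ∃ l o e₁ e₂ x w z y, IsPendantBipartite G l o e₁ e₂ x w z y ∧ (v = e₁ ∨ v = x)

namespace IsPendantDiamond

variable {l o e₁ e₂ b c : V}

theorem isInterior_left (h : IsPendantDiamond G l o e₁ e₂ b c) : IsInterior G e₁ :=
  .inl ⟨_, _, _, _, _, _, h, .inl rfl⟩

theorem isInterior_right (h : IsPendantDiamond G l o e₁ e₂ b c) : IsInterior G e₂ :=
  h.symm.isInterior_left

theorem isInterior_middle₁ (h : IsPendantDiamond G l o e₁ e₂ b c) : IsInterior G b :=
  .inl ⟨_, _, _, _, _, _, h, .inr rfl⟩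

theorem isInterior_middle₂ (h : IsPendantDiamond G l o e₁ e₂ b c) : IsInterior G c :=
  h.swap_middle.isInterior_middle₁

end IsPendantDiamond

namespace IsPendantBipartite

variable {l o e₁ e₂ x w z y : V}

theorem isInterior_left (h : IsPendantBipartite G l o e₁ e₂ x w z y) : IsInterior G e₁ :=
  .inr ⟨_, _, _, _, _, _, _, _, h, .inl rfl⟩

theorem isInterior_right (h : IsPendantBipartite G l o e₁ e₂ x w z y) : IsInterior G e₂ :=
  h.symm.isInterior_left

theorem isInterior_x (h : IsPendantBipartite G l o e₁ e₂ x w z y) : IsInterior G x :=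
  .inr ⟨_, _, _, _, _, _, _, _, h, .inr rfl⟩

theorem isInterior_w (h : IsPendantBipartite G l o e₁ e₂ x w z y) : IsInterior G w :=
  h.swap_left.isInterior_x

theorem isInterior_z (h : IsPendantBipartite G l o e₁ e₂ x w z y) : IsInterior G z :=
  h.symm.isInterior_x

theorem isInterior_y (h : IsPendantBipartite G l o e₁ e₂ x w z y) : IsInterior G y :=
  h.symm.isInterior_w

end IsPendantBipartite

namespace IsPieceRoot

variable {k : PieceKind} {l o : V}

theorem map (h : IsPieceRoot G k l o) (φ : G ≃g G) : IsPieceRoot G k (φ l) (φ o) := by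
  cases k
  · obtain ⟨e₁, e₂, b, c, h⟩ := h
    exact ⟨_, _, _, _, h.map φ⟩
  · obtain ⟨e₁, e₂, x, w, z, y, h⟩ := h
    exact ⟨_, _, _, _, _, _, h.map φ⟩

theorem exists_hasNbrs (h : IsPieceRoot G k l o) :
    ∃ e₁ e₂, HasNbrs G l o e₁ e₂ ∧ IsInterior G e₁ ∧ IsInterior G e₂ := by
  cases k
  · obtain ⟨e₁, e₂, b, c, h⟩ := h
    exact ⟨_, _, h.root, h.isInterior_left, h.isInterior_right⟩
  · obtain ⟨e₁, e₂, x, w, z, y, h⟩ := h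
    exact ⟨_, _, h.root, h.isInterior_left, h.isInterior_right⟩

theorem isInterior_of_adj (h : IsPieceRoot G k l o) {x : V} (hx : G.Adj l x) (hne : x ≠ o) :
    IsInterior G x := by
  obtain ⟨e₁, e₂, hn, h₁, h₂⟩ := h.exists_hasNbrs
  obtain rfl | rfl | rfl := hn.eq_or_eq_or_eq hx
  exacts [absurd rfl hne, h₁, h₂]

end IsPieceRoot

theorem exists_swap_of_hasNbrs {p q a b c : V} (hp : HasNbrs G p a b c) (hq : HasNbrs G q a b c) :
    ∃ φ : G ≃g G, φ p = q ∧ φ q = p ∧ ∀ x, x ≠ p → x ≠ q → φ x = x :=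
  exists_swap_of_twins fun x _ _ => by rw [hp.adj_iff, hq.adj_iff]

theorem exists_swap_of_hasNbrs_adj {p q a b : V} (hp : HasNbrs G p q a b)
    (hq : HasNbrs G q p a b) : ∃ φ : G ≃g G, φ p = q ∧ φ q = p ∧ ∀ x, x ≠ p → x ≠ q → φ x = x :=
  exists_swap_of_twins fun x hxp hxq => by
    simp only [hp.adj_iff, hq.adj_iff, hxp, hxq, false_or]

namespace IsInterior

variable {v : V}

theorem exists_two_interior_nbrs (h : IsInterior G v) :
    ∃ x y, x ≠ y ∧ G.Adj v x ∧ G.Adj v y ∧ IsInterior G x ∧ IsInterior G y := by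
  obtain ⟨l, o, e₁, e₂, b, c, h, rfl | rfl⟩ | ⟨l, o, e₁, e₂, x, w, z, y, h, rfl | rfl⟩ := h
  · exact ⟨b, c, h.left.ne₂₃, h.left.adj₂, h.left.adj₃, h.isInterior_middle₁,
      h.isInterior_middle₂⟩
  · exact ⟨e₁, e₂, h.middle₁.ne₂₃, h.middle₁.adj₂, h.middle₁.adj₃, h.isInterior_left,
      h.isInterior_right⟩
  · exact ⟨x, w, h.left.ne₂₃, h.left.adj₂, h.left.adj₃, h.isInterior_x, h.isInterior_w⟩
  · exact ⟨z, y, h.nbrs_x.ne₂₃, h.nbrs_x.adj₂, h.nbrs_x.adj₃, h.isInterior_z, h.isInterior_y⟩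

theorem interior_or_root_of_adj (h : IsInterior G v) {u : V} (hu : G.Adj v u) :
    IsInterior G u ∨ ∃ k o, IsPieceRoot G k u o ∧ v ≠ o := by
  obtain ⟨l, o, e₁, e₂, b, c, h, rfl | rfl⟩ | ⟨l, o, e₁, e₂, x, w, z, y, h, rfl | rfl⟩ := h
  · obtain rfl | rfl | rfl := h.left.eq_or_eq_or_eq hu
    exacts [.inr ⟨.diamond, o, ⟨_, _, _, _, h⟩, h.root.ne₁₂.symm⟩, .inl h.isInterior_middle₁,
      .inl h.isInterior_middle₂]
  · obtain rfl | rfl | rfl := h.middle₁.eq_or_eq_or_eq hu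
    exacts [.inl h.isInterior_middle₂, .inl h.isInterior_left, .inl h.isInterior_right]
  · obtain rfl | rfl | rfl := h.left.eq_or_eq_or_eq hu
    exacts [.inr ⟨.bipartite, o, ⟨_, _, _, _, _, _, h⟩, h.root.ne₁₂.symm⟩, .inl h.isInterior_x,
      .inl h.isInterior_w]
  · obtain rfl | rfl | rfl := h.nbrs_x.eq_or_eq_or_eq hu
    exacts [.inl h.isInterior_left, .inl h.isInterior_z, .inl h.isInterior_y]

theorem exists_swap (h : IsInterior G v) :
    ∃ a b c, HasNbrs G v a b c ∧ ∃ φ : G ≃g G, φ v = v ∧ φ a = a ∧ φ b = c ∧ φ c = b := by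
  obtain ⟨l, o, e₁, e₂, b, c, h, rfl | rfl⟩ | ⟨l, o, e₁, e₂, x, w, z, y, h, rfl | rfl⟩ := h
  · obtain ⟨φ, hb, hc, hφ⟩ := exists_swap_of_hasNbrs_adj h.middle₁ h.middle₂
    exact ⟨_, _, _, h.left, φ, hφ _ h.left.adj₂.ne h.left.adj₃.ne, hφ _ h.left.ne₁₂ h.left.ne₁₃,
      hb, hc⟩
  · obtain ⟨φ, h₁, h₂, hφ⟩ := exists_swap_of_hasNbrs h.left h.right
    exact ⟨_, _, _, h.middle₁, φ, hφ _ h.middle₁.adj₂.ne h.middle₁.adj₃.ne,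
      hφ _ h.middle₁.ne₁₂ h.middle₁.ne₁₃, h₁, h₂⟩
  · obtain ⟨φ, hx, hw, hφ⟩ := exists_swap_of_hasNbrs h.nbrs_x h.nbrs_w
    exact ⟨_, _, _, h.left, φ, hφ _ h.left.adj₂.ne h.left.adj₃.ne, hφ _ h.left.ne₁₂ h.left.ne₁₃,
      hx, hw⟩
  · obtain ⟨φ, hz, hy, hφ⟩ := exists_swap_of_hasNbrs h.nbrs_z h.nbrs_y
    exact ⟨_, _, _, h.nbrs_x, φ, hφ _ h.nbrs_x.adj₂.ne h.nbrs_x.adj₃.ne,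
      hφ _ h.nbrs_x.ne₁₂ h.nbrs_x.ne₁₃, hz, hy⟩

end IsInterior

theorem adj_of_isK4 (hconn : G.Connected) (hc : IsCubic G) {p q r s : V}
    (hp : HasNbrs G p q r s) (hq : HasNbrs G q p r s) (hr : HasNbrs G r p q s) {x y : V}
    (hxy : x ≠ y) : G.Adj x y := by
  have hs : HasNbrs G s p q r := by
    obtain ⟨d, h⟩ := hc.exists_hasNbrs₁ hp.adj₃.symm hq.adj₃.symm hp.adj₁.ne
    rwa [← h.eq_third hr.adj₃.symm hp.adj₂.ne' hq.adj₂.ne'] at h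
  have hall : ∀ z, z = p ∨ z = q ∨ z = r ∨ z = s := by
    refine forall_of_forall_adj hconn (v := p) (.inl rfl) ?_
    rintro d e (rfl | rfl | rfl | rfl) he
    · have := hp.eq_or_eq_or_eq he; tauto
    · have := hq.eq_or_eq_or_eq he; tauto
    · have := hr.eq_or_eq_or_eq he; tauto
    · have := hs.eq_or_eq_or_eq he; tauto
  have hy := hall y
  obtain rfl | rfl | rfl | rfl := hall x
  · exact (hp.adj_iff y).2 (hy.resolve_left hxy.symm)
  · exact (hq.adj_iff y).2 (by tauto)
  · exact (hr.adj_iff y).2 (by tauto)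
  · exact (hs.adj_iff y).2 (by tauto)

theorem adj_iff_of_isK33 (hconn : G.Connected) (hc : IsCubic G) {p q r a b c : V}
    (hp : HasNbrs G p a b c) (hq : HasNbrs G q a b c) (hr : HasNbrs G r a b c) (hpq : p ≠ q)
    (hpr : p ≠ r) (hqr : q ≠ r) {v x y : V} (hx : G.Adj v x) (hy : G.Adj v y) (m : V) :
    G.Adj x m ↔ G.Adj y m := by
  have hnbrs : ∀ t, G.Adj p t → HasNbrs G t p q r := fun t ht => by
    have hqt : G.Adj q t := by rwa [hq.adj_iff, ← hp.adj_iff]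
    have hrt : G.Adj r t := by rwa [hr.adj_iff, ← hp.adj_iff]
    obtain ⟨d, h⟩ := hc.exists_hasNbrs₁ ht.symm hqt.symm hpq
    rwa [← h.eq_third hrt.symm hpr.symm hqr.symm] at h
  have htwin : ∀ t, (t = p ∨ t = q ∨ t = r) → ∀ m, G.Adj t m ↔ G.Adj p m := by
    rintro t (rfl | rfl | rfl) m
    exacts [Iff.rfl, by rw [hq.adj_iff, hp.adj_iff], by rw [hr.adj_iff, hp.adj_iff]]
  have hsides : ∀ v, (∀ m, G.Adj v m ↔ G.Adj p m) ∨ G.Adj p v := by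
    refine forall_of_forall_adj hconn (v := p) (.inl fun _ => Iff.rfl) ?_
    rintro d e (hd | hd) hde
    · exact .inr ((hd e).1 hde)
    · exact .inl (htwin e ((hnbrs d hd).eq_or_eq_or_eq hde))
  obtain hv | hv := hsides v
  · rw [(hnbrs x ((hv x).1 hx)).adj_iff, (hnbrs y ((hv y).1 hy)).adj_iff]
  · rw [htwin x ((hnbrs v hv).eq_or_eq_or_eq hx), htwin y ((hnbrs v hv).eq_or_eq_or_eq hy)]

/-- A potential exception to `D(G) = 2`: a connected cubic graph without a distinguishing
2-coloring that contains neither `K₄` nor `K_{3,3}`. -/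
structure IsExceptional (G : SimpleGraph V) : Prop where
  connected : G.Connected
  cubic : IsCubic G
  not_distinguishable : ¬ IsTwoDistinguishable G
  not_isK4 : ∀ {p q r s}, HasNbrs G p q r s → HasNbrs G q p r s → ¬ HasNbrs G r p q s
  not_isK33 : ∀ {p q r a b c}, HasNbrs G p a b c → HasNbrs G q a b c → HasNbrs G r a b c →
    p ≠ q → p ≠ r → q = r

theorem injective_vec_three {α : Type*} {a b c : α} (hab : a ≠ b) (hac : a ≠ c) (hbc : b ≠ c) :
    Function.Injective ![a, b, c] := by
  simp [Function.Injective, Fin.forall_fin_succ, hab, hac, hbc, hab.symm, hac.symm, hbc.symm]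

theorem HasNbrs.neighborSet_eq_range {p a b c : V} (h : HasNbrs G p a b c) :
    G.neighborSet p = Set.range ![a, b, c] := by
  ext x
  rw [G.mem_neighborSet, h.adj_iff, Set.mem_range, Fin.exists_fin_succ, Fin.exists_fin_two]
  simp only [eq_comm (a := x)]
  rfl

namespace IsExceptional

theorem of_rigid (hconn : G.Connected) (hc : IsCubic G) (hd : ¬ IsTwoDistinguishable G)
    {v a b c : V} (hn : HasNbrs G v a b c) (hr : ∀ φ : G ≃g G, φ v = v → φ b = b → φ a = a) :
    IsExceptional G := by
  have hnot_twins : ¬ ∀ x, x ≠ a → x ≠ c → (G.Adj a x ↔ G.Adj c x) := fun htwins => by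
    obtain ⟨φ, hφa, -, hφ⟩ := exists_swap_of_twins htwins
    have hfix := hr φ (hφ _ hn.adj₁.ne hn.adj₃.ne) (hφ _ hn.ne₁₂.symm hn.ne₂₃)
    exact hn.ne₁₃ (hfix.symm.trans hφa)
  refine ⟨hconn, hc, hd, fun hp hq hr => hnot_twins fun x hxa hxc => ?_,
    fun hp hq hr hpq hpr => by_contra fun hqr => hnot_twins fun x _ _ => ?_⟩
  · exact iff_of_true (adj_of_isK4 hconn hc hp hq hr hxa.symm)
      (adj_of_isK4 hconn hc hp hq hr hxc.symm)
  · exact adj_iff_of_isK33 hconn hc hp hq hr hpq hpr hqr hn.adj₁ hn.adj₃ x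

variable {p q r a b c u v w : V}

theorem exists_isPendantDiamond_of_adjacent_twins (hG : IsExceptional G) (hp : HasNbrs G p q v r)
    (hq : HasNbrs G q p v r) : ∃ l o, IsPendantDiamond G l o v r p q := by
  obtain ⟨a, hv⟩ := hG.cubic.exists_hasNbrs₁ hp.adj₂.symm hq.adj₂.symm hp.adj₁.ne
  obtain ⟨t, hr⟩ := hG.cubic.exists_hasNbrs₁ hp.adj₃.symm hq.adj₃.symm hp.adj₁.ne
  have har : a ≠ r := by
    rintro rfl
    exact hG.not_isK4 hp hq hv
  have htv : t ≠ v := by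
    rintro rfl
    exact hG.not_isK4 hp.swap₂₃ hq.swap₂₃ hr
  have hD : IsDiamond G v r a t p q := ⟨hv.rotate.rotate, hr.rotate.rotate, hp, hq⟩
  obtain rfl | hat := eq_or_ne a t
  · obtain ⟨o, ho⟩ := hG.cubic.exists_hasNbrs₁ hv.adj₃.symm hr.adj₃.symm hp.ne₂₃
    exact ⟨a, o, hD, ho.rotate.rotate⟩
  · exact absurd (IsDiamond.isPairSystem.isTwoDistinguishable hG.connected hG.cubic
      ⟨⟨hat, har, htv⟩, p, q, hD⟩) hG.not_distinguishable

theorem isInterior_of_twins_of_adj (hG : IsExceptional G) (hp : HasNbrs G p a b c)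
    (hq : HasNbrs G q a b c) (hpq : p ≠ q) (hab : G.Adj a b) : IsInterior G p := by
  obtain ⟨u, ha⟩ := hG.cubic.exists_hasNbrs₁ hp.adj₁.symm hq.adj₁.symm hpq
  obtain ⟨v, hb⟩ := hG.cubic.exists_hasNbrs₁ hp.adj₂.symm hq.adj₂.symm hpq
  obtain rfl := ha.eq_third hab hp.adj₂.ne' hq.adj₂.ne'
  obtain rfl := hb.eq_third hab.symm hp.adj₁.ne' hq.adj₁.ne'
  obtain ⟨l, o, h⟩ := hG.exists_isPendantDiamond_of_adjacent_twins ha.rotate.rotate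
    hb.rotate.rotate
  exact h.isInterior_left

theorem isInterior_of_twins_of_common_outer (hG : IsExceptional G) {t : V}
    (hp : HasNbrs G p a b c) (hq : HasNbrs G q a b c) (ha : HasNbrs G a p q u)
    (hb : HasNbrs G b p q t) (hc : HasNbrs G c p q t) (hut : u ≠ t) (hta : t ≠ a) :
    IsInterior G p := by
  obtain ⟨s, ht⟩ := hG.cubic.exists_hasNbrs₁ hb.adj₃.symm hc.adj₃.symm hp.ne₂₃
  have hsa : s ≠ a := by
    rintro rfl
    exact hut (ha.eq_third ht.adj₃.symm hb.ne₁₃.symm hb.ne₂₃.symm).symm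
  have hB : IsBipartitePiece G a t u s p q b c :=
    ⟨ha.rotate.rotate, ht.rotate.rotate, hp, hq, hb.rotate.rotate, hc.rotate.rotate⟩
  obtain rfl | hus := eq_or_ne u s
  · obtain ⟨o, hu⟩ := hG.cubic.exists_hasNbrs₁ ha.adj₃.symm ht.adj₃.symm hta.symm
    exact IsPendantBipartite.isInterior_x (l := u) (o := o) ⟨hB, hu.rotate.rotate⟩
  · exact absurd (IsBipartitePiece.isPairSystem.isTwoDistinguishable hG.connected hG.cubic
      ⟨⟨hus, hut, hsa⟩, p, q, b, c, hB⟩) hG.not_distinguishable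

theorem not_common_outer (hG : IsExceptional G) (hp : HasNbrs G p a b c) (hq : HasNbrs G q a b c)
    (hpq : p ≠ q) (ha : HasNbrs G a p q u) (hb : HasNbrs G b p q u) : ¬ HasNbrs G c p q u := by
  intro hc
  obtain ⟨d, hu⟩ := hG.cubic.exists_hasNbrs₁ ha.adj₃.symm hb.adj₃.symm hp.ne₁₂
  obtain rfl := hu.eq_third hc.adj₃.symm hp.ne₁₃.symm hp.ne₂₃.symm
  exact ha.ne₂₃ (hG.not_isK33 hp hq hu hpq ha.ne₁₃)

theorem exists_common_outer (hG : IsExceptional G) (hp : HasNbrs G p a b c)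
    (hq : HasNbrs G q a b c) (ha : HasNbrs G a p q u) (hb : HasNbrs G b p q v)
    (hc : HasNbrs G c p q w) (hab : ¬ G.Adj a b) (hbc : ¬ G.Adj b c) (hca : ¬ G.Adj c a) :
    u = v ∨ v = w ∨ w = u := by
  by_contra! hne
  obtain ⟨huv, hvw, hwu⟩ := hne
  have hne_outer : ∀ i j, ![a, b, c] i ≠ ![u, v, w] j := by
    have houter : ∀ {x y z : V}, G.Adj y z → ¬ G.Adj x y → x ≠ z := fun hyz hxy hxz =>
      hxy (hxz ▸ hyz.symm)
    simp [Fin.forall_fin_succ, ha.adj₃.ne, hb.adj₃.ne, hc.adj₃.ne, houter hb.adj₃ hab,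
      houter hc.adj₃ (mt .symm hca), houter ha.adj₃ (mt .symm hab), houter hc.adj₃ hbc,
      houter ha.adj₃ hca, houter hb.adj₃ (mt .symm hbc)]
  have hT : IsTwinTriple G p q ![a, b, c] ![u, v, w] := by
    refine ⟨⟨injective_vec_three hp.ne₁₂ hp.ne₁₃ hp.ne₂₃,
      injective_vec_three huv hwu.symm hvw, hne_outer, ?_⟩, ?_, ?_, ?_⟩
    · simp [Fin.forall_fin_succ, ha.adj₃, hb.adj₃, hc.adj₃]
    · simp [Fin.forall_fin_succ, ha, hb, hc]
    · exact hp.neighborSet_eq_range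
    · exact hq.neighborSet_eq_range
  exact hG.not_distinguishable
    ((IsTwinTriple.isTripleSystem hG.connected).isTwoDistinguishable hG.connected hG.cubic
      ⟨p, q, hT⟩)

theorem isInterior_of_twins (hG : IsExceptional G) (hp : HasNbrs G p a b c)
    (hq : HasNbrs G q a b c) (hpq : p ≠ q) : IsInterior G p := by
  by_cases hab : G.Adj a b
  · exact hG.isInterior_of_twins_of_adj hp hq hpq hab
  by_cases hbc : G.Adj b c
  · exact hG.isInterior_of_twins_of_adj hp.rotate hq.rotate hpq hbc
  by_cases hca : G.Adj c a
  · exact hG.isInterior_of_twins_of_adj hp.rotate.rotate hq.rotate.rotate hpq hca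
  obtain ⟨u, ha⟩ := hG.cubic.exists_hasNbrs₁ hp.adj₁.symm hq.adj₁.symm hpq
  obtain ⟨v, hb⟩ := hG.cubic.exists_hasNbrs₁ hp.adj₂.symm hq.adj₂.symm hpq
  obtain ⟨w, hc⟩ := hG.cubic.exists_hasNbrs₁ hp.adj₃.symm hq.adj₃.symm hpq
  wlog hvw : v = w generalizing a b c u v w
  · obtain huv | rfl | hwu := hG.exists_common_outer hp hq ha hb hc hab hbc hca
    · exact this hp.rotate.rotate hq.rotate.rotate hca hab hbc w hc u ha v hb huv
    · exact absurd rfl hvw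
    · exact this hp.rotate hq.rotate hbc hca hab v hb w hc u ha hwu
  subst hvw
  refine hG.isInterior_of_twins_of_common_outer hp hq ha hb hc ?_ ?_
  · rintro rfl
    exact hG.not_common_outer hp hq hpq ha hb hc
  · rintro rfl
    exact hca hc.adj₃

theorem isInterior_of_triangle (hG : IsExceptional G) (hpq : G.Adj p q) (hpr : G.Adj p r)
    (hqr : G.Adj q r) : IsInterior G p := by
  obtain ⟨a, hp⟩ := hG.cubic.exists_hasNbrs₁ hpq hpr hqr.ne
  obtain ⟨b, hq⟩ := hG.cubic.exists_hasNbrs₁ hpq.symm hqr hpr.ne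
  obtain ⟨c, hr⟩ := hG.cubic.exists_hasNbrs₁ hpr.symm hqr.symm hpq.ne
  obtain rfl | hab := eq_or_ne a b
  · obtain ⟨l, o, h⟩ := hG.exists_isPendantDiamond_of_adjacent_twins hp hq
    exact h.isInterior_middle₁
  obtain rfl | hac := eq_or_ne a c
  · obtain ⟨l, o, h⟩ := hG.exists_isPendantDiamond_of_adjacent_twins hp.swap₁₂ hr
    exact h.isInterior_middle₁
  obtain rfl | hbc := eq_or_ne b c
  · obtain ⟨l, o, h⟩ := hG.exists_isPendantDiamond_of_adjacent_twins hq.swap₁₂ hr.swap₁₂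
    exact h.isInterior_left
  have hne_outer : ∀ i j, ![p, q, r] i ≠ ![a, b, c] j := by
    simp [Fin.forall_fin_succ, hp.adj₃.ne, hp.ne₁₃, hp.ne₂₃, hq.adj₃.ne, hq.ne₁₃, hq.ne₂₃,
      hr.adj₃.ne, hr.ne₁₃, hr.ne₂₃]
  have hT : IsTriangleTriple G ![p, q, r] ![a, b, c] := by
    refine ⟨⟨injective_vec_three hpq.ne hpr.ne hqr.ne, injective_vec_three hab hac hbc,
      hne_outer, ?_⟩, ?_⟩
    · simp [Fin.forall_fin_succ, hp.adj₃, hq.adj₃, hr.adj₃]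
    · simp [Fin.forall_fin_succ, hp, hq, hr, hp.swap₁₂, hq.swap₁₂, hr.swap₁₂]
  exact absurd ((IsTriangleTriple.isTripleSystem hG.connected).isTwoDistinguishable hG.connected
    hG.cubic hT) hG.not_distinguishable

end IsExceptional

/-- The vertex `p` lies on a triangle. -/
def IsOnTriangle (G : SimpleGraph V) (p : V) : Prop :=
  ∃ q r, G.Adj p q ∧ G.Adj p r ∧ G.Adj q r

theorem HasNbrs.not_isOnTriangle {p a b c : V} (h : HasNbrs G p a b c) (hab : ¬ G.Adj a b)
    (hac : ¬ G.Adj a c) (hbc : ¬ G.Adj b c) : ¬ IsOnTriangle G p := by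
  rintro ⟨q, r, hq, hr, hqr⟩
  obtain rfl | rfl | rfl := h.eq_or_eq_or_eq hq <;> obtain rfl | rfl | rfl := h.eq_or_eq_or_eq hr
  exacts [hqr.ne rfl, hab hqr, hac hqr, hab hqr.symm, hqr.ne rfl, hbc hqr, hac hqr.symm,
    hbc hqr.symm, hqr.ne rfl]

namespace IsPendantDiamond

variable {l o e₁ e₂ b c : V}

theorem isOnTriangle_left (h : IsPendantDiamond G l o e₁ e₂ b c) : IsOnTriangle G e₁ :=
  ⟨b, c, h.left.adj₂, h.left.adj₃, h.middle₁.adj₁⟩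

theorem isOnTriangle_middle (h : IsPendantDiamond G l o e₁ e₂ b c) : IsOnTriangle G b :=
  ⟨c, e₁, h.middle₁.adj₁, h.middle₁.adj₂, h.middle₂.adj₂⟩

theorem not_adj_middle_root (h : IsPendantDiamond G l o e₁ e₂ b c) : ¬ G.Adj b l := fun hbl => by
  obtain e | e | e := h.middle₁.eq_or_eq_or_eq hbl
  exacts [h.left.ne₁₃ e, h.left.adj₁.ne' e, h.right.adj₁.ne' e]

theorem not_adj_left_right (h : IsPendantDiamond G l o e₁ e₂ b c) : ¬ G.Adj e₁ e₂ := fun he => by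
  obtain e | e | e := h.left.eq_or_eq_or_eq he
  exacts [h.root.adj₃.ne' e, h.middle₁.adj₃.ne' e, h.middle₂.adj₃.ne' e]

theorem not_adj_outer_left (h : IsPendantDiamond G l o e₁ e₂ b c) : ¬ G.Adj o e₁ := fun hoe => by
  obtain rfl | rfl | rfl := h.left.eq_or_eq_or_eq hoe.symm
  exacts [h.root.adj₁.ne rfl, h.not_adj_middle_root h.root.adj₁.symm,
    h.swap_middle.not_adj_middle_root h.root.adj₁.symm]

theorem not_adj_outer_middle (h : IsPendantDiamond G l o e₁ e₂ b c) : ¬ G.Adj o b := fun hob => by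
  obtain rfl | rfl | rfl := h.middle₁.eq_or_eq_or_eq hob.symm
  exacts [h.swap_middle.not_adj_middle_root h.root.adj₁.symm, h.root.ne₁₂ rfl, h.root.ne₁₃ rfl]

theorem not_isOnTriangle_root (h : IsPendantDiamond G l o e₁ e₂ b c) : ¬ IsOnTriangle G l :=
  h.root.not_isOnTriangle h.not_adj_outer_left h.symm.not_adj_outer_left h.not_adj_left_right

theorem isOnTriangle_of_twins (h : IsPendantDiamond G l o e₁ e₂ b c) {s t : V} (hs : G.Adj l s)
    (ht : G.Adj l t) (hst : s ≠ t) (htwins : ∀ m, G.Adj s m ↔ G.Adj t m) :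
    IsOnTriangle G s ∧ s ≠ o := by
  obtain rfl | rfl | rfl := h.root.eq_or_eq_or_eq hs
  · refine absurd ((htwins b).2 ?_) h.not_adj_outer_middle
    obtain rfl | rfl | rfl := h.root.eq_or_eq_or_eq ht
    exacts [absurd rfl hst, h.left.adj₂, h.right.adj₂]
  · exact ⟨h.isOnTriangle_left, h.root.ne₁₂.symm⟩
  · exact ⟨h.symm.isOnTriangle_left, h.root.ne₁₃.symm⟩

end IsPendantDiamond

namespace IsPendantBipartite

variable {l o e₁ e₂ x w z y : V}

theorem not_adj_x_root (h : IsPendantBipartite G l o e₁ e₂ x w z y) : ¬ G.Adj x l := fun hxl => by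
  obtain e | e | e := h.nbrs_x.eq_or_eq_or_eq hxl
  exacts [h.left.adj₁.ne' e, h.right.ne₁₂ e, h.right.ne₁₃ e]

theorem not_adj_left_right (h : IsPendantBipartite G l o e₁ e₂ x w z y) : ¬ G.Adj e₁ e₂ :=
  fun he => by
  obtain e | e | e := h.left.eq_or_eq_or_eq he
  exacts [h.root.adj₃.ne' e, h.not_adj_x_root (e ▸ h.right.adj₁),
    h.swap_left.not_adj_x_root (e ▸ h.right.adj₁)]

theorem not_adj_outer_left (h : IsPendantBipartite G l o e₁ e₂ x w z y) : ¬ G.Adj o e₁ :=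
  fun hoe => by
  obtain rfl | rfl | rfl := h.left.eq_or_eq_or_eq hoe.symm
  exacts [h.root.adj₁.ne rfl, h.not_adj_x_root h.root.adj₁.symm,
    h.swap_left.not_adj_x_root h.root.adj₁.symm]

theorem not_adj_x_w (h : IsPendantBipartite G l o e₁ e₂ x w z y) : ¬ G.Adj x w := fun hxw => by
  obtain rfl | rfl | rfl := h.nbrs_x.eq_or_eq_or_eq hxw
  exacts [h.left.adj₃.ne rfl, h.nbrs_w.adj₂.ne rfl, h.nbrs_w.adj₃.ne rfl]

theorem not_adj_left_z (h : IsPendantBipartite G l o e₁ e₂ x w z y) : ¬ G.Adj e₁ z := fun hez => by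
  obtain rfl | rfl | rfl := h.nbrs_z.eq_or_eq_or_eq hez.symm
  exacts [h.root.ne₂₃ rfl, h.left.adj₂.ne rfl, h.left.adj₃.ne rfl]

theorem not_isOnTriangle_root (h : IsPendantBipartite G l o e₁ e₂ x w z y) : ¬ IsOnTriangle G l :=
  h.root.not_isOnTriangle h.not_adj_outer_left h.symm.not_adj_outer_left h.not_adj_left_right

theorem not_isOnTriangle_left (h : IsPendantBipartite G l o e₁ e₂ x w z y) :
    ¬ IsOnTriangle G e₁ :=
  h.left.not_isOnTriangle (mt .symm h.not_adj_x_root) (mt .symm h.swap_left.not_adj_x_root)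
    h.not_adj_x_w

theorem not_isOnTriangle_x (h : IsPendantBipartite G l o e₁ e₂ x w z y) : ¬ IsOnTriangle G x :=
  h.nbrs_x.not_isOnTriangle h.not_adj_left_z h.symm.swap_left.symm.not_adj_left_z
    h.symm.not_adj_x_w

theorem not_adj_x_of_adj_root (h : IsPendantBipartite G l o e₁ e₂ x w z y) {t : V}
    (ht : G.Adj l t) (hne : t ≠ e₁) : ¬ G.Adj t x := fun htx => by
  obtain rfl | rfl | rfl := h.nbrs_x.eq_or_eq_or_eq htx.symm
  exacts [hne rfl, h.symm.not_adj_x_root ht.symm, h.symm.swap_left.not_adj_x_root ht.symm]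

theorem eq_outer_of_twins (h : IsPendantBipartite G l o e₁ e₂ x w z y) {s t : V} (hs : G.Adj l s)
    (ht : G.Adj l t) (hst : s ≠ t) (htwins : ∀ m, G.Adj s m ↔ G.Adj t m) : s = o := by
  obtain rfl | rfl | rfl := h.root.eq_or_eq_or_eq hs
  · rfl
  · exact absurd ((htwins _).1 h.left.adj₂) (h.not_adj_x_of_adj_root ht hst.symm)
  · exact absurd ((htwins _).1 h.right.adj₂) (h.symm.not_adj_x_of_adj_root ht hst.symm)

variable {o' e₁' e₂' x' w' z' y' : V}

theorem left_ne_right_of_outer_eq_left (h : IsPendantBipartite G l o e₁ e₂ x w z y)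
    (h' : IsPendantBipartite G l o' e₁' e₂' x' w' z' y') (ho : o = e₁') : e₁ ≠ e₂' := by
  rintro rfl
  have hx : G.Adj x x' := by
    obtain rfl | rfl | rfl := h'.right.eq_or_eq_or_eq h.left.adj₂
    exacts [absurd rfl h.left.ne₁₂, h'.nbrs_z.adj₂, h'.nbrs_y.adj₂]
  have hox : G.Adj o x' := ho ▸ h'.left.adj₂
  obtain rfl | rfl | rfl := h.nbrs_x.eq_or_eq_or_eq hx
  · exact h'.not_adj_left_right (ho ▸ hox)
  · exact h.symm.not_adj_x_of_adj_root h.root.adj₁ h.root.ne₁₃ hox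
  · exact h.symm.swap_left.not_adj_x_of_adj_root h.root.adj₁ h.root.ne₁₃ hox

theorem outer_ne_left (h : IsPendantBipartite G l o e₁ e₂ x w z y)
    (h' : IsPendantBipartite G l o' e₁' e₂' x' w' z' y') : o ≠ e₁' := fun ho => by
  obtain e | e | e := h.root.eq_or_eq_or_eq h'.root.adj₃
  exacts [h'.root.ne₂₃ (ho.symm.trans e.symm), h.left_ne_right_of_outer_eq_left h' ho e.symm,
    h.symm.left_ne_right_of_outer_eq_left h' ho e.symm]

end IsPendantBipartite

namespace IsPieceRoot

variable {k k' : PieceKind} {l o o' : V}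

theorem not_isOnTriangle (h : IsPieceRoot G k l o) : ¬ IsOnTriangle G l := by
  cases k
  · obtain ⟨e₁, e₂, b, c, h⟩ := h
    exact h.not_isOnTriangle_root
  · obtain ⟨e₁, e₂, x, w, z, y, h⟩ := h
    exact h.not_isOnTriangle_root

theorem isOnTriangle_of_twins (h : IsPieceRoot G k l o) {s t : V} (hs : G.Adj l s)
    (ht : G.Adj l t) (hst : s ≠ t) (htwins : ∀ m, G.Adj s m ↔ G.Adj t m) :
    IsOnTriangle G s ∧ s ≠ o := by
  cases k
  · obtain ⟨e₁, e₂, b, c, h⟩ := h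
    exact h.isOnTriangle_of_twins hs ht hst htwins
  · obtain ⟨e₁, e₂, x, w, z, y, h⟩ := h
    exact absurd ((h.eq_outer_of_twins hs ht hst htwins).trans
      (h.eq_outer_of_twins ht hs hst.symm fun m => (htwins m).symm).symm) hst

theorem not_isInterior (h : IsPieceRoot G k l o) : ¬ IsInterior G l := by
  rintro (⟨l', o', e₁, e₂, b, c, h', rfl | rfl⟩ | ⟨l', o', e₁, e₂, x, w, z, y, h', rfl | rfl⟩)
  · exact h.not_isOnTriangle h'.isOnTriangle_left
  · exact h.not_isOnTriangle h'.isOnTriangle_middle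
  · refine h'.not_isOnTriangle_x
      (h.isOnTriangle_of_twins h'.left.adj₂ h'.left.adj₃ h'.left.ne₂₃ fun m => ?_).1
    rw [h'.nbrs_x.adj_iff, h'.nbrs_w.adj_iff]
  · refine h'.symm.not_isOnTriangle_x
      (h.isOnTriangle_of_twins h'.nbrs_x.adj₂ h'.nbrs_x.adj₃ h'.nbrs_x.ne₂₃ fun m => ?_).1
    rw [h'.nbrs_z.adj_iff, h'.nbrs_y.adj_iff]

theorem outer_unique (h : IsPieceRoot G k l o) (h' : IsPieceRoot G k l o') : o = o' := by
  cases k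
  · obtain ⟨e₁', e₂', b', c', h'⟩ := h'
    have htwins : ∀ m, G.Adj e₁' m ↔ G.Adj e₂' m := fun m => by
      rw [h'.left.adj_iff, h'.right.adj_iff]
    have h₁ := h.isOnTriangle_of_twins h'.root.adj₂ h'.root.adj₃ h'.root.ne₂₃ htwins
    have h₂ := h.isOnTriangle_of_twins h'.root.adj₃ h'.root.adj₂ h'.root.ne₂₃.symm
      fun m => (htwins m).symm
    obtain ⟨e₁, e₂, b, c, h⟩ := h
    exact ((h'.root.rotate.eq_third h.root.adj₁) h₁.2.symm) h₂.2.symm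
  · obtain ⟨e₁, e₂, x, w, z, y, h⟩ := h
    obtain ⟨e₁', e₂', x', w', z', y', h'⟩ := h'
    exact h'.root.rotate.eq_third h.root.adj₁ (h.outer_ne_left h') (h.outer_ne_left h'.symm)

theorem not_bipartite_of_diamond (h : IsPieceRoot G .diamond l o) :
    ¬ IsPieceRoot G .bipartite l o' := fun h' => by
  obtain ⟨e₁, e₂, b, c, h⟩ := h
  obtain ⟨htri, hne⟩ := h'.isOnTriangle_of_twins h.root.adj₂ h.root.adj₃ h.root.ne₂₃ fun m => by
    rw [h.left.adj_iff, h.right.adj_iff]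
  obtain ⟨e₁', e₂', x, w, z, y, h'⟩ := h'
  obtain e | e | e := h'.root.eq_or_eq_or_eq h.root.adj₂
  exacts [hne e, h'.not_isOnTriangle_left (e ▸ htri), h'.symm.not_isOnTriangle_left (e ▸ htri)]

theorem kind_unique (h : IsPieceRoot G k l o) (h' : IsPieceRoot G k' l o') : k = k' := by
  cases k <;> cases k'
  exacts [rfl, (h.not_bipartite_of_diamond h').elim, (h'.not_bipartite_of_diamond h).elim, rfl]

end IsPieceRoot

/-! ### Branches -/

/-- The dart from `o` to `p` leads to a complete binary tree of height `h` rooted at `p` whose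
leaves are the roots of pendant pieces of kind `k`. -/
def IsBranch (G : SimpleGraph V) (k : PieceKind) : ℕ → V → V → Prop
  | 0, p, o => IsPieceRoot G k p o
  | h + 1, p, o => ∃ p₁ p₂, HasNbrs G p o p₁ p₂ ∧ IsBranch G k h p₁ p ∧ IsBranch G k h p₂ p

/-- All three neighbors of `o` are roots of branches of height `h`. -/
def IsCenter (G : SimpleGraph V) (k : PieceKind) (h : ℕ) (o : V) : Prop :=
  ∀ x, G.Adj o x → IsBranch G k h x o

namespace IsBranch

variable {k k' : PieceKind} {h h' : ℕ} {p o o' : V}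

theorem map (hb : IsBranch G k h p o) (φ : G ≃g G) : IsBranch G k h (φ p) (φ o) := by
  induction h generalizing p o with
  | zero => exact IsPieceRoot.map hb φ
  | succ h ih =>
    obtain ⟨p₁, p₂, hn, h₁, h₂⟩ := hb
    exact ⟨_, _, hn.map φ, ih h₁, ih h₂⟩

theorem adj (hb : IsBranch G k h p o) : G.Adj p o := by
  cases h with
  | zero =>
    obtain ⟨_, _, hn, -⟩ := IsPieceRoot.exists_hasNbrs hb
    exact hn.adj₁
  | succ h =>
    obtain ⟨_, _, hn, -⟩ := hb
    exact hn.adj₁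

theorem exists_isPieceRoot (hb : IsBranch G k h p o) : ∃ l o, IsPieceRoot G k l o := by
  induction h generalizing p o with
  | zero => exact ⟨p, o, hb⟩
  | succ h ih =>
    obtain ⟨p₁, p₂, -, h₁, -⟩ := hb
    exact ih h₁

theorem not_isInterior (hb : IsBranch G k h p o) : ¬ IsInterior G p := by
  induction h generalizing p o with
  | zero => exact IsPieceRoot.not_isInterior hb
  | succ h ih =>
    obtain ⟨p₁, p₂, hn, h₁, h₂⟩ := hb
    intro hp
    obtain ⟨x, y, hxy, hx, hy, hx_int, hy_int⟩ := hp.exists_two_interior_nbrs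
    have houter : ∀ z, G.Adj p z → IsInterior G z → z = o := fun z hz hz_int => by
      obtain rfl | rfl | rfl := hn.eq_or_eq_or_eq hz
      exacts [rfl, absurd hz_int (ih h₁), absurd hz_int (ih h₂)]
    exact hxy ((houter x hx hx_int).trans (houter y hy hy_int).symm)

theorem not_isPieceRoot (hb : IsBranch G k (h + 1) p o) : ¬ IsPieceRoot G k' p o' := fun hp => by
  obtain ⟨p₁, p₂, hn, h₁, h₂⟩ := hb
  have houter : ∀ q, G.Adj p q → IsBranch G k h q p → q = o' := fun q hpq hq =>
    by_contra fun hqo => hq.not_isInterior (hp.isInterior_of_adj hpq hqo)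
  exact hn.ne₂₃ ((houter p₁ hn.adj₂ h₁).trans (houter p₂ hn.adj₃ h₂).symm)

theorem kind_and_height_unique (hb : IsBranch G k h p o) (hb' : IsBranch G k' h' p o') :
    k = k' ∧ h = h' := by
  induction h generalizing p o h' o' with
  | zero =>
    cases h' with
    | zero => exact ⟨IsPieceRoot.kind_unique hb hb', rfl⟩
    | succ h' => exact (not_isPieceRoot hb' hb).elim
  | succ h ih =>
    cases h' with
    | zero => exact (not_isPieceRoot hb hb').elim
    | succ h' =>
      obtain ⟨p₁, p₂, hn, h₁, h₂⟩ := hb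
      obtain ⟨q₁, q₂, hn', h₁', h₂'⟩ := hb'
      obtain ⟨q, hq, hq'⟩ : ∃ q, IsBranch G k h q p ∧ IsBranch G k' h' q p := by
        have hbranch' : ∀ q, G.Adj p q → q ≠ o' → IsBranch G k' h' q p := fun q hpq hqo => by
          obtain rfl | rfl | rfl := hn'.eq_or_eq_or_eq hpq
          exacts [absurd rfl hqo, h₁', h₂']
        obtain rfl | hne := eq_or_ne p₁ o'
        exacts [⟨p₂, h₂, hbranch' p₂ hn.adj₃ hn.ne₂₃.symm⟩, ⟨p₁, h₁, hbranch' p₁ hn.adj₂ hne⟩]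
      exact (ih hq hq').imp_right (congrArg _)

theorem exists_isCenter (hb : IsBranch G k h p o) (hb' : IsBranch G k h p o') (hne : o ≠ o') :
    ∃ h', IsCenter G k h' p := by
  cases h with
  | zero => exact absurd (IsPieceRoot.outer_unique hb hb') hne
  | succ h =>
    refine ⟨h, fun x hx => ?_⟩
    obtain ⟨p₁, p₂, hn, h₁, h₂⟩ := hb
    obtain ⟨q₁, q₂, hn', h₁', h₂'⟩ := hb'
    obtain rfl | rfl | rfl := hn.eq_or_eq_or_eq hx
    · obtain rfl | rfl | rfl := hn'.eq_or_eq_or_eq hx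
      exacts [absurd rfl hne, h₁', h₂']
    · exact h₁
    · exact h₂

end IsBranch

/-! ### Swap paths -/

/-- A vertex `v` of an exceptional graph with neighbors `a`, `b`, `c` such that the stabilizer of
the dart from `v` to `b` fixes all neighbors of `v`, and which is not close to the interior of a
piece. -/
structure IsSwapStart (G : SimpleGraph V) (v a b c : V) : Prop where
  exceptional : IsExceptional G
  nbrs : HasNbrs G v a b c
  fixes : ∀ φ : G ≃g G, φ v = v → φ b = b → ∀ x, G.Adj v x → φ x = x
  map_cases : ∀ φ : G ≃g G, φ v = v → φ b = b ∨ φ b = c ∨ φ c = b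
  not_isInterior : ¬ IsInterior G v
  not_isPieceRoot : ∀ k o, ¬ IsPieceRoot G k v o

theorem IsSwapStart.of_fixed_nbr {v a b c : V} (hG : IsExceptional G) (hn : HasNbrs G v a b c)
    (hfix : ∀ φ : G ≃g G, φ v = v → φ a = a) (hint : ¬ IsInterior G v)
    (hroot : ∀ k o, ¬ IsPieceRoot G k v o) : IsSwapStart G v a b c where
  exceptional := hG
  nbrs := hn
  fixes φ hφv hφb x hx := by
    obtain rfl | rfl | rfl := hn.eq_or_eq_or_eq hx
    exacts [hfix φ hφv, hφb, hn.third_fixed hφv (hfix φ hφv) hφb]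
  map_cases φ hφv := (hn.rotate.map_eq_or_swap hφv (hfix φ hφv)).imp And.left (.inl ∘ And.left)
  not_isInterior := hint
  not_isPieceRoot := hroot

/-- A path `p 0, …, p m` whose first edge joins `v` to `b` and such that, at every inner vertex,
the stabilizer of the initial part interchanges the two possible continuations. -/
structure IsSwapPath (G : SimpleGraph V) (v b : V) (p : ℕ → V) (m : ℕ) : Prop where
  zero : p 0 = v
  one : p 1 = b
  exists_swap : ∀ i, i + 1 < m → ∃ s, HasNbrs G (p (i + 1)) (p i) (p (i + 2)) s ∧
    ∃ σ : G ≃g G, (∀ j ≤ i + 1, σ (p j) = p j) ∧ σ (p (i + 2)) = s ∧ σ s = p (i + 2)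

/-- A swap path ending in `p m` cannot be extended: the stabilizer of its vertices fixes the
neighbors of the last one. -/
def IsRigidEnd (G : SimpleGraph V) (p : ℕ → V) (m : ℕ) : Prop :=
  ∀ φ : G ≃g G, (∀ j ≤ m, φ (p j) = p j) → ∀ x, G.Adj (p m) x → φ x = x

namespace IsSwapPath

variable {v a b c : V} {p q : ℕ → V} {m n : ℕ}

theorem congr (hp : IsSwapPath G v b p m) (hm : 1 ≤ m) (hq : ∀ j ≤ m, q j = p j) :
    IsSwapPath G v b q m := by
  refine ⟨(hq 0 (by omega)).trans hp.zero, (hq 1 hm).trans hp.one, fun i hi => ?_⟩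
  obtain ⟨s, hn, σ, hσ, hσs⟩ := hp.exists_swap i hi
  rw [hq i (by omega), hq (i + 1) (by omega), hq (i + 2) (by omega)]
  exact ⟨s, hn, σ, fun j hj => by rw [hq j (by omega)]; exact hσ j hj, hσs⟩

theorem mono (hp : IsSwapPath G v b p m) (hn : n ≤ m) : IsSwapPath G v b p n :=
  ⟨hp.zero, hp.one, fun i hi => hp.exists_swap i (by omega)⟩

theorem adj (hp : IsSwapPath G v b p m) (hvb : G.Adj v b) {i : ℕ} (hi : i < m) :
    G.Adj (p i) (p (i + 1)) := by
  cases i with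
  | zero => rwa [hp.zero, hp.one]
  | succ i =>
    obtain ⟨s, hn, -⟩ := hp.exists_swap i hi
    exact hn.adj₂

theorem exists_extension (hc : IsCubic G) (hp : IsSwapPath G v b p (m + 1)) (hvb : G.Adj v b)
    (hend : ¬ IsRigidEnd G p (m + 1)) :
    ∃ q : ℕ → V, (∀ j ≤ m + 1, q j = p j) ∧ IsSwapPath G v b q (m + 2) := by
  unfold IsRigidEnd at hend
  push Not at hend
  obtain ⟨φ, hφ, x, hx, hφx⟩ := hend
  have hmx : p m ≠ x := fun e => hφx (e ▸ hφ m (by omega))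
  obtain ⟨s, hn⟩ := hc.exists_hasNbrs₁ (hp.adj hvb (Nat.lt_succ_self m)).symm hx hmx
  have hφn : HasNbrs G (p (m + 1)) (p m) (φ x) (φ s) := by
    simpa only [hφ (m + 1) le_rfl, hφ m (by omega)] using hn.map φ
  have hφs : φ x = s ∧ φ s = x :=
    (hn.rotate.eq_or_swap hφn.rotate).resolve_left fun e => hφx e.1
  have hq : ∀ j ≤ m + 1, Function.update p (m + 2) x j = p j :=
    fun j hj => Function.update_of_ne (by omega) _ _
  refine ⟨Function.update p (m + 2) x, hq, ?_⟩
  have hcongr := hp.congr (by omega) hq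
  refine ⟨hcongr.zero, hcongr.one, fun i hi => ?_⟩
  by_cases him : i + 1 < m + 1
  · exact hcongr.exists_swap i him
  · obtain rfl : i = m := by omega
    rw [hq i (by omega), hq (i + 1) (by omega), Function.update_self]
    exact ⟨s, hn, φ, fun j hj => by rw [hq j hj]; exact hφ j hj, hφs⟩

theorem exists_rigidEnd_or_infinite (hc : IsCubic G) (hvb : G.Adj v b) :
    (∃ p m, IsSwapPath G v b p (m + 1) ∧ IsRigidEnd G p (m + 1)) ∨
      ∃ p, ∀ m, IsSwapPath G v b p m := by
  by_contra! hcon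
  obtain ⟨hno_end, hno_infinite⟩ := hcon
  let T := fun n : ℕ => {p : ℕ → V // IsSwapPath G v b p (n + 1)}
  have hstep : ∀ n (t : T n), ∃ q : T (n + 1), ∀ j ≤ n + 1, q.1 j = t.1 j := fun n t =>
    let ⟨q, hq, hpath⟩ := t.2.exists_extension hc hvb (hno_end t.1 n t.2)
    ⟨⟨q, hpath⟩, hq⟩
  choose extend hextend using hstep
  let edge : T 0 := ⟨fun i => if i = 0 then v else b, rfl, rfl, fun i hi => by omega⟩
  let P : ∀ n, T n := fun n => Nat.rec edge (fun n t => extend n t) n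
  have hP : ∀ n, ∀ j ≤ n + 1, (P (n + 1)).1 j = (P n).1 j := fun n => hextend n (P n)
  have hstable : ∀ d j, (P (j + d)).1 j = (P j).1 j := fun d j => by
    induction d with
    | zero => rfl
    | succ d ih => exact (hP (j + d) j (by omega)).trans ih
  obtain ⟨m, hm⟩ := hno_infinite fun i => (P i).1 i
  refine hm (((P m).2.congr (by omega) fun j hj => ?_).mono (Nat.le_succ m))
  rcases Nat.lt_or_ge j (m + 1) with hjm | hjm
  · obtain ⟨d, rfl⟩ := Nat.exists_eq_add_of_le (Nat.lt_succ_iff.1 hjm)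
    exact (hstable d j).symm
  · obtain rfl : j = m + 1 := by omega
    exact hP m _ le_rfl

theorem fixes_nbrs (hp : IsSwapPath G v b p m) (hS : IsSwapStart G v a b c) {i : ℕ}
    (hi : i + 1 ≤ m) {φ : G ≃g G} (hφ : ∀ j ≤ i + 1, φ (p j) = p j) {j : ℕ} (hj : j ≤ i) {x : V}
    (hx : G.Adj (p j) x) : φ x = x := by
  cases j with
  | zero =>
    exact hS.fixes φ (hp.zero ▸ hφ 0 (by omega)) (hp.one ▸ hφ 1 (by omega)) x (hp.zero ▸ hx)
  | succ j =>
    obtain ⟨s, hn, -⟩ := hp.exists_swap j (by omega)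
    have hφ₂ := hφ (j + 2) (by omega)
    have hφs := hn.third_fixed (hφ (j + 1) (by omega)) (hφ j (by omega)) hφ₂
    obtain rfl | rfl | rfl := hn.eq_or_eq_or_eq hx
    exacts [hφ _ (by omega), hφ₂, hφs]

theorem not_adj_and_ne (hp : IsSwapPath G v b p m) (hS : IsSwapStart G v a b c) {i j : ℕ}
    (hi : i + 1 < m) (hj : j ≤ i) {z : V} (hz : G.Adj (p (i + 1)) z) (hne : z ≠ p i) :
    ¬ G.Adj (p j) z ∧ z ≠ p j := by
  obtain ⟨s, hn, σ, hσ, hσ₂, hσs⟩ := hp.exists_swap i hi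
  have hmoved : σ z ≠ z := by
    obtain rfl | rfl | rfl := hn.eq_or_eq_or_eq hz
    · exact absurd rfl hne
    · exact hσ₂ ▸ hn.ne₂₃.symm
    · exact hσs ▸ hn.ne₂₃
  refine ⟨fun h => hmoved (hp.fixes_nbrs hS (by omega) hσ hj h), ?_⟩
  rintro rfl
  exact hmoved (hσ j (by omega))

theorem ne_and_eq_succ_of_adj (hp : IsSwapPath G v b p m) (hS : IsSwapStart G v a b c) {i j : ℕ}
    (hij : i < j) (hj : j ≤ m) : p i ≠ p j ∧ (G.Adj (p i) (p j) → j = i + 1) := by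
  obtain rfl | hij' := eq_or_ne j (i + 1)
  · exact ⟨(hp.adj hS.nbrs.adj₂ (by omega)).ne, fun _ => rfl⟩
  · obtain ⟨d, rfl⟩ := Nat.exists_eq_add_of_le (show i + 2 ≤ j by omega)
    obtain ⟨s, hn, -⟩ := hp.exists_swap (i + d) (by omega)
    have hfar := hp.not_adj_and_ne hS (i := i + d) (j := i) (by omega) (by omega) hn.adj₂
      hn.ne₁₂.symm
    rw [show i + 2 + d = i + d + 2 by omega]
    exact ⟨hfar.2.symm, fun h => absurd h hfar.1⟩

theorem eq_of_apply_eq (hp : IsSwapPath G v b p m) (hS : IsSwapStart G v a b c) {i j : ℕ}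
    (hi : i ≤ m) (hj : j ≤ m) (h : p i = p j) : i = j := by
  obtain hlt | rfl | hlt := lt_trichotomy i j
  exacts [absurd h (hp.ne_and_eq_succ_of_adj hS hlt hj).1, rfl,
    absurd h.symm (hp.ne_and_eq_succ_of_adj hS hlt hi).1]

theorem succ_of_adj (hp : IsSwapPath G v b p m) (hS : IsSwapStart G v a b c) {i j : ℕ}
    (hi : i ≤ m) (hj : j ≤ m) (h : G.Adj (p i) (p j)) : j = i + 1 ∨ i = j + 1 := by
  obtain hlt | rfl | hlt := lt_trichotomy i j
  exacts [.inl ((hp.ne_and_eq_succ_of_adj hS hlt hj).2 h), absurd rfl h.ne,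
    .inr ((hp.ne_and_eq_succ_of_adj hS hlt hi).2 h.symm)]

/-- Reading the path backwards, each swap turns a branch into a branch one level higher. -/
theorem exists_isBranch (hp : IsSwapPath G v b p m) {k : PieceKind} {i : ℕ} (hi : i < m)
    (hroot : IsPieceRoot G k (p (i + 1)) (p i)) : ∃ h, IsBranch G k h b v := by
  rw [← hp.zero, ← hp.one]
  obtain ⟨h, hb⟩ : ∃ h, IsBranch G k h (p (i + 1)) (p i) := ⟨0, hroot⟩
  clear hroot
  induction i generalizing h with
  | zero => exact ⟨h, hb⟩
  | succ i ih =>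
    obtain ⟨s, hn, σ, hσ, hσ₂, -⟩ := hp.exists_swap i hi
    have hb' := hb.map σ
    rw [hσ₂, hσ _ le_rfl] at hb'
    exact ih (by omega) (h + 1) ⟨_, _, hn, hb, hb'⟩

end IsSwapPath

/-- A finite (`I = Set.Iic m`) or infinite (`I = Set.univ`) swap path with indices in `I`, none of
whose edges enters a piece through its root; it may be continued by one more edge. -/
structure IsClearPath (G : SimpleGraph V) (v a b c : V) (p : ℕ → V) (I : Set ℕ) : Prop where
  start : IsSwapStart G v a b c
  lower : IsLowerSet I
  swapPath : ∀ i ∈ I, IsSwapPath G v b p (i + 1)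
  clear : ∀ i ∈ I, ∀ k, ¬ IsPieceRoot G k (p (i + 1)) (p i)

/-- `z` is a neighbor of the path vertex `p i` and does not lie on the path. -/
structure IsRim (G : SimpleGraph V) (p : ℕ → V) (I : Set ℕ) (i : ℕ) (z : V) : Prop where
  mem : i ∈ I
  adj : G.Adj (p i) z
  notMem : z ∉ p '' I

/-- The closed neighborhood of the set `Y`. -/
def closedNbhd (G : SimpleGraph V) (Y : Set V) : Set V := {x | x ∈ Y ∨ ∃ y ∈ Y, G.Adj y x}

theorem exists_adj_mem_closedNbhd {Y : Set V} {u : V} (hu : u ∈ closedNbhd G Y)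
    (hY : ∀ y ∈ Y, ∃ w, G.Adj y w) : ∃ w ∈ closedNbhd G Y, G.Adj u w := by
  obtain hu | ⟨y, hy, hyu⟩ := hu
  · obtain ⟨w, hw⟩ := hY u hu
    exact ⟨w, .inr ⟨u, hu, hw⟩, hw⟩
  · exact ⟨y, .inl hy, hyu.symm⟩

theorem nbrs_black_of_preserves {Q Y : Set V} (hQ : closedNbhd G Y ⊆ Q) {φ : G ≃g G}
    (hφ : ∀ z, φ z ∈ Q ↔ z ∈ Q) {y : V} (hy : y ∈ Y) :
    φ y ∈ Q ∧ ∀ x, G.Adj (φ y) x → x ∈ Q := by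
  refine ⟨(hφ _).2 (hQ (.inl hy)), fun x hx => ?_⟩
  obtain ⟨x, rfl⟩ := φ.surjective x
  exact (hφ _).2 (hQ (.inr ⟨_, hy, φ.map_adj_iff.1 hx⟩))

theorem symm_preserves {Q : Set V} {φ : G ≃g G} (hφ : ∀ z, φ z ∈ Q ↔ z ∈ Q) (z : V) :
    φ.symm z ∈ Q ↔ z ∈ Q := by
  rw [← hφ (φ.symm z), RelIso.apply_symm_apply]

namespace IsClearPath

variable {v a b c : V} {p : ℕ → V} {I : Set ℕ} {i j : ℕ} {x y z : V}

theorem adj_succ (h : IsClearPath G v a b c p I) (hi : i ∈ I) : G.Adj (p i) (p (i + 1)) :=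
  (h.swapPath i hi).adj h.start.nbrs.adj₂ (Nat.lt_succ_self i)

theorem eq_of_apply_eq (h : IsClearPath G v a b c p I) (hi : i ∈ I) (hj : j ∈ I)
    (hij : p i = p j) : i = j := by
  wlog hle : i ≤ j generalizing i j
  · exact (this hj hi hij.symm (by omega)).symm
  exact (h.swapPath j hj).eq_of_apply_eq h.start (by omega) (by omega) hij

theorem succ_of_adj (h : IsClearPath G v a b c p I) (hi : i ∈ I) (hj : j ∈ I)
    (hij : G.Adj (p i) (p j)) : j = i + 1 ∨ i = j + 1 := by
  wlog hle : i ≤ j generalizing i j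
  · exact (this hj hi hij.symm (by omega)).symm
  exact (h.swapPath j hj).succ_of_adj h.start (by omega) (by omega) hij

theorem not_isPieceRoot (h : IsClearPath G v a b c p I) (hi : i ∈ I) (k : PieceKind) (o : V) :
    ¬ IsPieceRoot G k (p i) o := by
  intro hroot
  cases i with
  | zero => exact h.start.not_isPieceRoot k o ((h.swapPath 0 hi).zero ▸ hroot)
  | succ i =>
    obtain ⟨s, hn, σ, hσ, hσ₂, hσs⟩ := (h.swapPath _ hi).exists_swap i (by omega)
    have hroot' := hroot.map σ
    rw [hσ _ le_rfl] at hroot'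
    have ho := hroot.outer_unique hroot'
    obtain ⟨_, _, hn', -⟩ := hroot.exists_hasNbrs
    obtain rfl | rfl | rfl := hn.eq_or_eq_or_eq hn'.adj₁
    · exact h.clear i (h.lower (Nat.le_succ i) hi) k hroot
    · exact hn.ne₂₃ (ho.trans hσ₂)
    · exact hn.ne₂₃ (ho.trans hσs).symm

theorem not_isInterior (h : IsClearPath G v a b c p I) (hi : i ∈ I) : ¬ IsInterior G (p i) := by
  induction i with
  | zero => exact (h.swapPath 0 hi).zero ▸ h.start.not_isInterior
  | succ i ih =>
    have hi' := h.lower (Nat.le_succ i) hi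
    intro hint
    obtain hint' | ⟨k, o, hroot, -⟩ := hint.interior_or_root_of_adj (h.adj_succ hi').symm
    exacts [ih hi' hint', h.not_isPieceRoot hi' k o hroot]

theorem not_isInterior_of_mem_closedNbhd (h : IsClearPath G v a b c p I)
    (hx : x ∈ closedNbhd G (p '' I)) : ¬ IsInterior G x := by
  obtain ⟨i, hi, rfl⟩ | ⟨_, ⟨i, hi, rfl⟩, hix⟩ := hx
  · exact h.not_isInterior hi
  · intro hint
    obtain hint' | ⟨k, o, hroot, -⟩ := hint.interior_or_root_of_adj hix.symm
    exacts [h.not_isInterior hi hint', h.not_isPieceRoot hi k o hroot]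

theorem not_adj_rim_of_lt (h : IsClearPath G v a b c p I) (hz : IsRim G p I j z) (hij : i < j) :
    ¬ G.Adj (p i) z := by
  obtain ⟨j, rfl⟩ : ∃ j', j = j' + 1 := ⟨j - 1, by omega⟩
  exact ((h.swapPath _ hz.mem).not_adj_and_ne h.start (by omega) (Nat.lt_succ_iff.1 hij) hz.adj
    fun e => hz.notMem ⟨j, h.lower (Nat.le_succ j) hz.mem, e.symm⟩).1

theorem rim_index_unique (h : IsClearPath G v a b c p I) (hz : IsRim G p I j z) (hi : i ∈ I)
    (hiz : G.Adj (p i) z) : i = j := by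
  obtain hlt | rfl | hlt := lt_trichotomy i j
  exacts [absurd hiz (h.not_adj_rim_of_lt hz hlt), rfl,
    absurd hz.adj (h.not_adj_rim_of_lt ⟨hi, hiz, hz.notMem⟩ hlt)]

/-- If rim vertices `x` and `y` at `p i` and `p (j + 1)` were adjacent, then the swap at
`p (j + 1)`, which fixes `x`, would make `x` adjacent to both continuations there. -/
theorem hasNbrs_of_adj_rim (h : IsClearPath G v a b c p I) (hx : IsRim G p I i x)
    (hy : IsRim G p I (j + 1) y) (hij : i ≤ j) (hxy : G.Adj x y) {s : V}
    (hn : HasNbrs G (p (j + 1)) (p j) (p (j + 2)) s) : HasNbrs G x (p i) (p (j + 2)) s := by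
  have hpath := h.swapPath _ hy.mem
  obtain ⟨s', hn', σ, hσ, hσ₂, hσs⟩ := hpath.exists_swap j (by omega)
  obtain rfl := hn.third_unique hn'
  have hσx : σ x = x := hpath.fixes_nbrs h.start (by omega) hσ hij hx.adj
  have hxσy : G.Adj x (σ y) := hσx ▸ σ.map_adj_iff.2 hxy
  obtain ⟨hx₂, hxs⟩ : G.Adj x (p (j + 2)) ∧ G.Adj x s' := by
    obtain rfl | rfl | rfl := hn.eq_or_eq_or_eq hy.adj
    · exact absurd ⟨j, h.lower (Nat.le_succ j) hy.mem, rfl⟩ hy.notMem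
    · exact ⟨hxy, hσ₂ ▸ hxσy⟩
    · exact ⟨hσs ▸ hxσy, hxy⟩
  obtain ⟨t, ht⟩ := h.start.exceptional.cubic.exists_hasNbrs₁ hx₂ hxs hn.ne₂₃
  obtain e | e | rfl := ht.eq_or_eq_or_eq hx.adj.symm
  · exact absurd e (hpath.ne_and_eq_succ_of_adj h.start (by omega) le_rfl).1
  · exact absurd e.symm
      (hpath.not_adj_and_ne h.start (by omega) hij hn.adj₃ hn.ne₁₃.symm).2
  · exact ht.rotate.rotate

theorem not_adj_rim_rim_of_lt (h : IsClearPath G v a b c p I) (hx : IsRim G p I i x)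
    (hy : IsRim G p I j y) (hij : i < j) : ¬ G.Adj x y := by
  intro hxy
  obtain ⟨j, rfl⟩ : ∃ j', j = j' + 1 := ⟨j - 1, by omega⟩
  have hpath := h.swapPath _ hy.mem
  have hint := h.not_isInterior hy.mem
  obtain ⟨s, hn, -⟩ := hpath.exists_swap j (by omega)
  have hxn := h.hasNbrs_of_adj_rim hx hy (by omega) hxy hn
  obtain rfl | hne := eq_or_ne i j
  · exact hint (h.start.exceptional.isInterior_of_twins hn hxn fun e =>
      hx.notMem ⟨_, hy.mem, e⟩)
  -- The swap one step earlier fixes `x`, so it maps `p (j + 1)` to a twin of it.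
  obtain ⟨j, rfl⟩ : ∃ j', j = j' + 1 := ⟨j - 1, by omega⟩
  obtain ⟨s', hn', τ, hτ, hτ₂, -⟩ := hpath.exists_swap j (by omega)
  have hτx : τ x = x := hpath.fixes_nbrs h.start (by omega) hτ (by omega) hx.adj
  have hτxn : HasNbrs G x (p i) (τ (p (j + 3))) (τ s) := by
    simpa only [hτx, hτ i (by omega)] using hxn.map τ
  have hτn : HasNbrs G s' (p (j + 1)) (τ (p (j + 3))) (τ s) := by
    simpa only [hτ₂, hτ _ le_rfl] using hn.map τ
  refine hint (h.start.exceptional.isInterior_of_twins hn (q := s') ?_ hn'.ne₂₃)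
  obtain ⟨e₁, e₂⟩ | ⟨e₁, e₂⟩ := hxn.rotate.eq_or_swap hτxn.rotate
  · rwa [e₁, e₂] at hτn
  · rw [e₁, e₂] at hτn
    exact hτn.swap₂₃

theorem not_adj_rim_rim (h : IsClearPath G v a b c p I) (hx : IsRim G p I i x)
    (hy : IsRim G p I j y) : ¬ G.Adj x y := by
  obtain hlt | rfl | hlt := lt_trichotomy i j
  · exact h.not_adj_rim_rim_of_lt hx hy hlt
  · exact fun hxy => h.not_isInterior hx.mem
      (h.start.exceptional.isInterior_of_triangle hx.adj hy.adj hxy)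
  · exact fun hxy => h.not_adj_rim_rim_of_lt hy hx hlt hxy.symm

theorem exists_isRim_of_mem_closedNbhd (hx : x ∈ closedNbhd G (p '' I)) (hx' : x ∉ p '' I) :
    ∃ i, IsRim G p I i x := by
  obtain ⟨_, ⟨i, hi, rfl⟩, hix⟩ := hx.resolve_left hx'
  exact ⟨i, hi, hix, hx'⟩

theorem notMem_closedNbhd_of_adj_rim (h : IsClearPath G v a b c p I) (hz : IsRim G p I i z)
    (hzx : G.Adj z x) (hne : x ≠ p i) : x ∉ closedNbhd G (p '' I) := by
  intro hx
  by_cases hx' : x ∈ p '' I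
  · obtain ⟨j, hj, rfl⟩ := hx'
    exact hne (congrArg p (h.rim_index_unique hz hj hzx.symm))
  · obtain ⟨j, hj⟩ := exists_isRim_of_mem_closedNbhd hx hx'
    exact h.not_adj_rim_rim hz hj hzx

/-- Apart from `E`, only the vertices of the path can be black with three black neighbors: the
neighborhood of any other such vertex would be covered by `E` and at most one path vertex. -/
theorem mem_path_or_mem_of_nbrs_black (h : IsClearPath G v a b c p I) {E Q : Set V}
    (hE : E.Subsingleton) (hQ : IsTraced G (closedNbhd G (p '' I) ∪ E) Q Qᶜ) {w : V}
    (hw : w ∈ Q) (hN : ∀ x, G.Adj w x → x ∈ Q) : w ∈ p '' I ∨ w ∈ E := by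
  have hcubic := h.start.exceptional.cubic
  obtain ⟨x, y, z, hn⟩ := hcubic w
  obtain ⟨⟨hx, hy, hz⟩, hbase⟩ :=
    hQ.nbrs_mem_base hcubic hn hw (hN _ hn.adj₁) (hN _ hn.adj₂) (hN _ hn.adj₃)
  have hnbrs : ∀ t, G.Adj w t → t ∈ closedNbhd G (p '' I) ∪ E := fun t ht => by
    obtain rfl | rfl | rfl := hn.eq_or_eq_or_eq ht <;> assumption
  obtain (hw' | hw') | ⟨w', hne, hn'⟩ := hbase
  · by_contra! hcon
    obtain ⟨i, hi⟩ := exists_isRim_of_mem_closedNbhd hw' hcon.1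
    have hcover : ∀ t, G.Adj w t → t = p i ∨ t ∈ E := fun t ht => by
      by_contra! ht'
      exact h.notMem_closedNbhd_of_adj_rim hi ht ht'.1 ((hnbrs t ht).resolve_right ht'.2)
    have hcover_x := hcover x hn.adj₁
    have hcover_y := hcover y hn.adj₂
    have hcover_z := hcover z hn.adj₃
    have hxy : x ∈ E → y ∈ E → False := fun hx hy => hn.ne₁₂ (hE hx hy)
    have hxz : x ∈ E → z ∈ E → False := fun hx hz => hn.ne₁₃ (hE hx hz)
    have hyz : y ∈ E → z ∈ E → False := fun hy hz => hn.ne₂₃ (hE hy hz)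
    grind [hn.ne₁₂, hn.ne₁₃, hn.ne₂₃]
  · exact .inr hw'
  · obtain ⟨s, t, hst, hs, ht, hs_int, ht_int⟩ :=
      (h.start.exceptional.isInterior_of_twins hn hn' hne.symm).exists_two_interior_nbrs
    have hmem : ∀ s, G.Adj w s → IsInterior G s → s ∈ E := fun s hs hint =>
      (hnbrs s hs).resolve_left fun hs' => h.not_isInterior_of_mem_closedNbhd hs' hint
    exact absurd (hE (hmem s hs hs_int) (hmem t ht ht_int)) hst

theorem fixes_of_fixes_zero (h : IsClearPath G v a b c p I) {φ : G ≃g G} (hφ₀ : φ (p 0) = p 0)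
    (hφ : ∀ i ∈ I, φ (p i) ∈ p '' I) (hi : i ∈ I) : φ (p i) = p i := by
  induction i using Nat.strong_induction_on with
  | _ i ih =>
    cases i with
    | zero => exact hφ₀
    | succ i =>
      have hi' := h.lower (Nat.le_succ i) hi
      obtain ⟨j, hj, hij⟩ := hφ _ hi
      have hadj := φ.map_adj_iff.2 (h.adj_succ hi')
      rw [ih i (by omega) hi', ← hij] at hadj
      obtain rfl | rfl := h.succ_of_adj hi' hj hadj
      · exact hij.symm
      · rw [← ih j (by omega) hj] at hij
        have := h.eq_of_apply_eq hj hi (φ.injective hij)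
        omega

theorem notMem_of_map_zero (h : IsClearPath G v a b c p I) {φ : G ≃g G}
    (hφ : ∀ i ∈ I, φ.symm (p i) ∈ p '' I) (hφ₀ : φ (p 0) = p (i + 1)) : i + 2 ∉ I := by
  intro hi₂
  have hi₁ := h.lower (Nat.le_succ (i + 1)) hi₂
  have hi₀ := h.lower (Nat.le_succ i) hi₁
  have hback : ∀ j ∈ I, G.Adj (p (i + 1)) (p j) → φ.symm (p j) = p 1 := fun j hj hij => by
    obtain ⟨l, hl, hlj⟩ := hφ j hj
    rw [← hφ₀, ← RelIso.apply_symm_apply φ (p j), φ.map_adj_iff, ← hlj] at hij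
    obtain rfl | hl₀ := h.succ_of_adj (h.lower (Nat.zero_le _) hi₀) hl hij
    · exact hlj.symm
    · omega
  have hfst := hback i hi₀ (h.adj_succ hi₀).symm
  have hsnd := hback (i + 2) hi₂ (h.adj_succ hi₁)
  have := h.eq_of_apply_eq hi₀ hi₂ (φ.symm.injective (hfst.trans hsnd.symm))
  omega

/-- A swap path cannot be reversed: the neighbors of `p 0` are fixed by the stabilizer of the
initial dart, while the last swap does not fix the neighbors of the last vertex. -/
theorem map_zero_ne_last (h : IsClearPath G v a b c p I) {φ : G ≃g G} (hi : i + 1 ∈ I)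
    (hφ₀ : φ (p 0) = p (i + 1)) : φ (p 1) ≠ p i := by
  intro hφ₁
  have hstart := h.swapPath 0 (h.lower (Nat.zero_le _) hi)
  obtain ⟨s, hn, σ, hσ, hσ₂, -⟩ := (h.swapPath _ hi).exists_swap i (by omega)
  let ψ : G ≃g G := (φ.trans σ).trans φ.symm
  have hψ : ∀ x, φ (ψ x) = σ (φ x) := fun x => RelIso.apply_symm_apply φ _
  have hψ₀ : ψ (p 0) = p 0 := φ.injective (by rw [hψ, hφ₀, hσ _ le_rfl])
  have hψ₁ : ψ (p 1) = p 1 := φ.injective (by rw [hψ, hφ₁, hσ _ (Nat.le_succ i)])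
  rw [hstart.zero] at hψ₀
  rw [hstart.one] at hψ₁
  have hadj : G.Adj v (φ.symm (p (i + 2))) := by
    rw [← hstart.zero, ← φ.map_adj_iff, RelIso.apply_symm_apply, hφ₀]
    exact hn.adj₂
  have hfix := congrArg φ (h.start.fixes ψ hψ₀ hψ₁ _ hadj)
  rw [hψ, RelIso.apply_symm_apply, hσ₂] at hfix
  exact hn.ne₂₃ hfix.symm

theorem fixes_of_mapsTo (h : IsClearPath G v a b c p I) {φ : G ≃g G}
    (hφ : ∀ i ∈ I, φ (p i) ∈ p '' I) (hφ' : ∀ i ∈ I, φ.symm (p i) ∈ p '' I) (hi : i ∈ I) :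
    φ (p i) = p i := by
  have h0 := h.lower (Nat.zero_le i) hi
  refine h.fixes_of_fixes_zero ?_ hφ hi
  obtain ⟨_ | n, hn, hn₀⟩ := hφ 0 h0
  · exact hn₀.symm
  obtain ⟨j, hj, hj₁⟩ := hφ 1 (h.lower (by omega) hn)
  have hadj := φ.map_adj_iff.2 (h.adj_succ h0)
  rw [zero_add, ← hn₀, ← hj₁] at hadj
  obtain rfl | hj₀ := h.succ_of_adj hn hj hadj
  · exact absurd hj (h.notMem_of_map_zero hφ' hn₀.symm)
  · obtain rfl : n = j := by omega
    exact absurd hj₁.symm (h.map_zero_ne_last hn hn₀.symm)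

end IsClearPath

namespace IsClearPath

variable {v a b c : V} {p : ℕ → V} {m i : ℕ}

theorem false_of_infinite (h : IsClearPath G v a b c p Set.univ) : False := by
  have hadj := fun i => h.adj_succ (Set.mem_univ i)
  refine h.start.exceptional.not_distinguishable <|
    .of_initial_coloring h.start.exceptional.connected h.start.exceptional.cubic
      (closedNbhd G (p '' Set.univ)) (closedNbhd G (p '' Set.univ))
      ⟨p 0, .inl ⟨0, trivial, rfl⟩⟩ subset_rfl
      (fun u hu => exists_adj_mem_closedNbhd hu (by rintro _ ⟨i, -, rfl⟩; exact ⟨_, hadj i⟩)) ?_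
  intro Q hQ htraced φ hφ
  have hblack : closedNbhd G (p '' Set.univ) ⊆ Q := fun x hx => (hQ x hx).2 hx
  have hpath : ∀ ψ : G ≃g G, (∀ z, ψ z ∈ Q ↔ z ∈ Q) → ∀ i ∈ Set.univ, ψ (p i) ∈ p '' Set.univ := by
    intro ψ hψ i hi
    obtain ⟨hmem, hnbrs⟩ := nbrs_black_of_preserves hblack hψ (Set.mem_image_of_mem p hi)
    exact (h.mem_path_or_mem_of_nbrs_black Set.subsingleton_empty (by rwa [Set.union_empty])
      hmem hnbrs).resolve_right id
  have hfix := fun i => h.fixes_of_mapsTo (hpath φ hφ) (hpath φ.symm (symm_preserves hφ))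
    (Set.mem_univ i)
  rintro z (⟨i, -, rfl⟩ | ⟨_, ⟨i, -, rfl⟩, hz⟩)
  · exact hfix i
  · exact (h.swapPath (i + 1) trivial).fixes_nbrs h.start (by omega) (fun j _ => hfix j) le_rfl hz

theorem isRim_last (h : IsClearPath G v a b c p (Set.Iic m)) :
    IsRim G p (Set.Iic m) m (p (m + 1)) := by
  refine ⟨Set.self_mem_Iic, h.adj_succ Set.self_mem_Iic, ?_⟩
  rintro ⟨i, hi, hip⟩
  have := (h.swapPath m Set.self_mem_Iic).eq_of_apply_eq h.start (Nat.le_succ_of_le hi) le_rfl hip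
  have : i ≤ m := hi
  omega

theorem exists_companion (h : IsClearPath G v a b c p (Set.Iic m)) :
    ∃ s, s ≠ p (m + 1) ∧ IsRim G p (Set.Iic m) m s ∧
      ∀ φ : G ≃g G, (∀ i ≤ m, φ (p i) = p i) →
        φ (p (m + 1)) = p (m + 1) ∨ φ (p (m + 1)) = s ∨ φ s = p (m + 1) := by
  have hpath := h.swapPath m Set.self_mem_Iic
  cases m with
  | zero =>
    rw [zero_add, hpath.one]
    refine ⟨c, h.start.nbrs.ne₂₃.symm, ⟨Set.self_mem_Iic, hpath.zero ▸ h.start.nbrs.adj₃, ?_⟩,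
      fun φ hφ => h.start.map_cases φ (hpath.zero ▸ hφ 0 le_rfl)⟩
    rintro ⟨i, hi, rfl⟩
    obtain rfl : i = 0 := Nat.le_zero.1 hi
    exact h.start.nbrs.adj₃.ne hpath.zero.symm
  | succ m =>
    obtain ⟨s, hn, -⟩ := hpath.exists_swap m (Nat.lt_succ_self _)
    refine ⟨s, hn.ne₂₃.symm, ⟨Set.self_mem_Iic, hn.adj₃, ?_⟩, fun φ hφ => ?_⟩
    · rintro ⟨i, hi, rfl⟩
      obtain hlt | rfl := Nat.lt_or_eq_of_le (show i ≤ m + 1 from hi)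
      · exact (hpath.not_adj_and_ne h.start (Nat.lt_succ_self _) (Nat.lt_succ_iff.1 hlt) hn.adj₃
          hn.ne₁₃.symm).2 rfl
      · exact hn.adj₃.ne rfl
    · have hφn := hn.map φ
      rw [hφ _ le_rfl, hφ m (by omega)] at hφn
      obtain e | e | e := hn.eq_or_eq_or_eq hφn.adj₂
      exacts [absurd e.symm hφn.ne₁₂, .inl e, .inr (.inl e)]

theorem exists_private_nbr {I : Set ℕ} {x y : V} (h : IsClearPath G v a b c p I)
    (hx : IsRim G p I i x) (hy : IsRim G p I i y) (hxy : x ≠ y) :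
    ∃ r r', HasNbrs G y (p i) r r' ∧ ¬ G.Adj x r := by
  have hcubic := h.start.exceptional.cubic
  obtain ⟨r, r', hn⟩ := hcubic.exists_hasNbrs₂ hy.adj.symm
  by_cases hr : G.Adj x r
  · refine ⟨r', r, hn.swap₂₃, fun hr' => ?_⟩
    obtain ⟨t, ht⟩ := hcubic.exists_hasNbrs₁ hr hr' hn.ne₂₃
    obtain e | e | rfl := ht.eq_or_eq_or_eq hx.adj.symm
    · exact hn.ne₁₂ e
    · exact hn.ne₁₃ e
    · exact h.not_isInterior_of_mem_closedNbhd (.inr ⟨_, ⟨i, hx.mem, rfl⟩, hx.adj⟩)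
        (h.start.exceptional.isInterior_of_twins ht.rotate.rotate hn hxy)
  · exact ⟨r, r', hn, hr⟩

end IsClearPath

/-- The data that mark the end of a finite clear path `p 0, …, p m`: its continuation `p (m + 1)` is
a rigid end, `s` is the companion of `p (m + 1)`, and coloring `r` black makes `s` distinguishable
from `p (m + 1)`. -/
structure IsEndMarking (G : SimpleGraph V) (v a b c : V) (p : ℕ → V) (m : ℕ) (s r r' : V) :
    Prop where
  path : IsClearPath G v a b c p (Set.Iic m)
  rigid : IsRigidEnd G p (m + 1)
  rim : IsRim G p (Set.Iic m) m s
  map_cases : ∀ φ : G ≃g G, (∀ i ≤ m, φ (p i) = p i) →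
    φ (p (m + 1)) = p (m + 1) ∨ φ (p (m + 1)) = s ∨ φ s = p (m + 1)
  nbrs : HasNbrs G s (p m) r r'
  not_adj : ¬ G.Adj (p (m + 1)) r

theorem IsClearPath.exists_isEndMarking {v a b c : V} {p : ℕ → V} {m : ℕ}
    (h : IsClearPath G v a b c p (Set.Iic m)) (hend : IsRigidEnd G p (m + 1)) :
    ∃ s r r', IsEndMarking G v a b c p m s r r' := by
  obtain ⟨s, hne, hrim, hmap⟩ := h.exists_companion
  obtain ⟨r, r', hn, hr⟩ := h.exists_private_nbr h.isRim_last hrim hne.symm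
  exact ⟨s, r, r', h, hend, hrim, hmap, hn, hr⟩

namespace IsEndMarking

variable {v a b c s r r' : V} {p : ℕ → V} {m : ℕ} {Q : Set V} {φ : G ≃g G}

theorem notMem (h : IsEndMarking G v a b c p m s r r') :
    r ∉ closedNbhd G (p '' Set.Iic m) ∧ r' ∉ closedNbhd G (p '' Set.Iic m) :=
  ⟨h.path.notMem_closedNbhd_of_adj_rim h.rim h.nbrs.adj₂ h.nbrs.ne₁₂.symm,
    h.path.notMem_closedNbhd_of_adj_rim h.rim h.nbrs.adj₃ h.nbrs.ne₁₃.symm⟩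

/-- For a path of length `0`, the base has too few vertices to contain the neighborhood of `r`. -/
theorem not_nbrs_black_of_zero (h : IsEndMarking G v a b c p 0 s r r')
    (hQ : IsTraced G (closedNbhd G (p '' Set.Iic 0) ∪ {r}) Q Qᶜ) (hr : r ∈ Q) :
    ¬ ∀ x, G.Adj r x → x ∈ Q := by
  intro hN
  have hcubic := h.path.start.exceptional.cubic
  have hpath := h.path.swapPath 0 Set.self_mem_Iic
  obtain ⟨x, y, z, hn⟩ := hcubic r
  obtain ⟨⟨hx, hy, hz⟩, -⟩ :=
    hQ.nbrs_mem_base hcubic hn hr (hN _ hn.adj₁) (hN _ hn.adj₂) (hN _ hn.adj₃)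
  have hcover : ∀ t, G.Adj r t → t ∈ closedNbhd G (p '' Set.Iic 0) ∪ {r} → t = a ∨ t = c := by
    rintro t hrt ((ht | ⟨_, ⟨j, hj, rfl⟩, ht⟩) | rfl)
    · exact absurd (.inr ⟨t, ht, hrt.symm⟩) h.notMem.1
    · obtain rfl : j = 0 := Nat.le_zero.1 hj
      rw [hpath.zero] at ht
      obtain rfl | rfl | rfl := h.path.start.nbrs.eq_or_eq_or_eq ht
      · exact .inl rfl
      · exact absurd hrt.symm (hpath.one ▸ h.not_adj)
      · exact .inr rfl
    · exact absurd rfl hrt.ne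
  have hx' := hcover x hn.adj₁ hx
  have hy' := hcover y hn.adj₂ hy
  have hz' := hcover z hn.adj₃ hz
  grind [hn.ne₁₂, hn.ne₁₃, hn.ne₂₃]

theorem map_mem_path (h : IsEndMarking G v a b c p m s r r')
    (hQ : IsTraced G (closedNbhd G (p '' Set.Iic m) ∪ {r}) Q Qᶜ)
    (hblack : closedNbhd G (p '' Set.Iic m) ⊆ Q) (hφ : ∀ z, φ z ∈ Q ↔ z ∈ Q) {i : ℕ}
    (hi : i ∈ Set.Iic m) : φ (p i) ∈ p '' Set.Iic m := by
  have hnbrs := fun j (hj : j ∈ Set.Iic m) =>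
    nbrs_black_of_preserves hblack hφ (Set.mem_image_of_mem p hj)
  have hmem : ∀ j ∈ Set.Iic m, φ (p j) ∈ p '' Set.Iic m ∨ φ (p j) = r := fun j hj =>
    h.path.mem_path_or_mem_of_nbrs_black Set.subsingleton_singleton hQ (hnbrs j hj).1 (hnbrs j hj).2
  refine (hmem i hi).resolve_right fun hir => ?_
  have hisolated : ∀ j ∈ Set.Iic m, ¬ G.Adj (p i) (p j) := by
    intro j hj hij
    have hadj := φ.map_adj_iff.2 hij
    obtain hj' | hj' := hmem j hj
    · exact h.notMem.1 (.inr ⟨_, hj', hir ▸ hadj.symm⟩)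
    · exact hadj.ne (hir.trans hj'.symm)
  obtain rfl | hm := eq_or_ne m 0
  · exact h.not_nbrs_black_of_zero hQ (hir ▸ (hnbrs i hi).1) (hir ▸ (hnbrs i hi).2)
  obtain hlt | rfl := Nat.lt_or_eq_of_le (show i ≤ m from hi)
  · exact hisolated (i + 1) hlt (h.path.adj_succ hi)
  · obtain ⟨j, rfl⟩ := Nat.exists_eq_succ_of_ne_zero hm
    exact hisolated j (Nat.le_succ j) (h.path.adj_succ (Nat.le_succ j)).symm

/-- The black neighbor `r` of `s` would have to be mapped to a black neighbor of `p (m + 1)` other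
than `p m`. -/
theorem map_companion_ne (h : IsEndMarking G v a b c p m s r r')
    (hQ : ∀ x, G.Adj (p (m + 1)) x → (x ∈ Q ↔ x ∈ closedNbhd G (p '' Set.Iic m) ∪ {r}))
    (hr : r ∈ Q) (hφ : ∀ z, φ z ∈ Q ↔ z ∈ Q) (hφm : φ (p m) = p m) : φ s ≠ p (m + 1) := by
  intro hs
  have hadj := φ.map_adj_iff.2 h.nbrs.adj₂
  rw [hs] at hadj
  have hne : φ r ≠ p m := fun e => h.nbrs.ne₁₂ (φ.injective (hφm.trans e.symm))
  obtain hr' | hr' := (hQ _ hadj).1 ((hφ r).2 hr)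
  · exact h.path.notMem_closedNbhd_of_adj_rim h.path.isRim_last hadj hne hr'
  · exact h.not_adj (hr' ▸ hadj)

theorem fixes_nbrs_companion (h : IsEndMarking G v a b c p m s r r') (hr : r ∈ Q) (hr' : r' ∉ Q)
    (hφ : ∀ z, φ z ∈ Q ↔ z ∈ Q) (hφm : φ (p m) = p m) (hφs : φ s = s) {z : V}
    (hz : G.Adj s z) : φ z = z := by
  have hn := h.nbrs.map φ
  rw [hφs, hφm] at hn
  have hφr : φ r = r := by
    obtain e | e | e := h.nbrs.eq_or_eq_or_eq hn.adj₂
    exacts [absurd e.symm hn.ne₁₂, e, absurd (e ▸ (hφ r).2 hr) hr']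
  rw [hφr] at hn
  obtain rfl | rfl | rfl := h.nbrs.eq_or_eq_or_eq hz
  exacts [hφm, hφr, h.nbrs.third_unique hn]

theorem fixes_path (h : IsEndMarking G v a b c p m s r r')
    (hQ : ∀ x ∈ closedNbhd G (p '' Set.Iic m) ∪ ({x | G.Adj (p (m + 1)) x} ∪ {x | G.Adj s x}),
      x ∈ Q ↔ x ∈ closedNbhd G (p '' Set.Iic m) ∪ {r})
    (htraced : IsTraced G (closedNbhd G (p '' Set.Iic m) ∪ {r}) Q Qᶜ)
    (hφ : ∀ z, φ z ∈ Q ↔ z ∈ Q) : ∀ i ≤ m + 1, φ (p i) = p i := by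
  have hblack : closedNbhd G (p '' Set.Iic m) ⊆ Q := fun x hx => (hQ x (.inl hx)).2 (.inl hx)
  have hφ' := symm_preserves hφ
  have hfix : ∀ i ≤ m, φ (p i) = p i := fun i hi =>
    h.path.fixes_of_mapsTo (fun j hj => h.map_mem_path htraced hblack hφ hj)
      (fun j hj => h.map_mem_path htraced hblack hφ' hj) hi
  have hr : r ∈ Q := (hQ r (.inr (.inr h.nbrs.adj₂))).2 (.inr rfl)
  have hcompanion : ∀ ψ : G ≃g G, (∀ z, ψ z ∈ Q ↔ z ∈ Q) → ψ (p m) = p m → ψ s ≠ p (m + 1) :=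
    fun _ => h.map_companion_ne (fun x hx => hQ x (.inr (.inl hx))) hr
  have hlast : φ (p (m + 1)) = p (m + 1) := by
    obtain e | e | e := h.map_cases φ hfix
    · exact e
    · refine absurd ?_ (hcompanion φ.symm hφ' ?_)
      · rw [← e, RelIso.symm_apply_apply]
      · rw [RelIso.symm_apply_eq, hfix m le_rfl]
    · exact absurd e (hcompanion φ hφ (hfix m le_rfl))
  intro i hi
  obtain hlt | rfl := Nat.lt_or_eq_of_le hi
  exacts [hfix i (Nat.lt_succ_iff.1 hlt), hlast]

theorem false (h : IsEndMarking G v a b c p m s r r') : False := by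
  have hlast : p (m + 1) ∈ closedNbhd G (p '' Set.Iic m) :=
    .inr ⟨_, ⟨m, Set.self_mem_Iic, rfl⟩, h.path.adj_succ Set.self_mem_Iic⟩
  have hs : s ∈ closedNbhd G (p '' Set.Iic m) := .inr ⟨_, ⟨m, Set.self_mem_Iic, rfl⟩, h.rim.adj⟩
  refine h.path.start.exceptional.not_distinguishable <|
    .of_initial_coloring h.path.start.exceptional.connected h.path.start.exceptional.cubic
      (closedNbhd G (p '' Set.Iic m) ∪ ({x | G.Adj (p (m + 1)) x} ∪ {x | G.Adj s x}))
      (closedNbhd G (p '' Set.Iic m) ∪ {r}) ⟨s, .inl hs⟩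
      (Set.union_subset_union subset_rfl (Set.singleton_subset_iff.2 (.inr h.nbrs.adj₂))) ?_ ?_
  · rintro u (hu | hu | hu)
    · obtain ⟨w, hw, huw⟩ := exists_adj_mem_closedNbhd hu
        (by rintro _ ⟨i, hi, rfl⟩; exact ⟨_, h.path.adj_succ hi⟩)
      exact ⟨w, .inl hw, huw⟩
    · exact ⟨_, .inl hlast, hu.symm⟩
    · exact ⟨_, .inl hs, hu.symm⟩
  intro Q hQ htraced φ hφ
  have hfix := h.fixes_path hQ htraced hφ
  have hfix_nbrs : ∀ i ≤ m, ∀ x, G.Adj (p i) x → φ x = x := fun i hi x hx =>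
    (h.path.swapPath m Set.self_mem_Iic).fixes_nbrs h.path.start le_rfl hfix hi hx
  have hr : r ∈ Q := (hQ r (.inr (.inr h.nbrs.adj₂))).2 (.inr rfl)
  have hr' : r' ∉ Q := fun hr' => ((hQ r' (.inr (.inr h.nbrs.adj₃))).1 hr').elim h.notMem.2
    h.nbrs.ne₂₃.symm
  rintro z ((⟨i, hi, rfl⟩ | ⟨_, ⟨i, hi, rfl⟩, hz⟩) | hz | hz)
  · exact hfix i (Nat.le_succ_of_le hi)
  · exact hfix_nbrs i hi z hz
  · exact h.rigid φ hfix z hz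
  · exact h.fixes_nbrs_companion hr hr' hφ (hfix m (Nat.le_succ m))
      (hfix_nbrs m le_rfl s h.rim.adj) hz

end IsEndMarking

theorem IsSwapStart.exists_isBranch {v a b c : V} (hS : IsSwapStart G v a b c) :
    ∃ k h, IsBranch G k h b v := by
  by_contra! hcon
  have hclear : ∀ p m, IsSwapPath G v b p (m + 1) → ∀ k, ¬ IsPieceRoot G k (p (m + 1)) (p m) := by
    intro p m hp k hroot
    obtain ⟨h, hb⟩ := hp.exists_isBranch (Nat.lt_succ_self m) hroot
    exact hcon k h hb
  obtain ⟨p, m, hp, hend⟩ | ⟨p, hp⟩ :=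
    IsSwapPath.exists_rigidEnd_or_infinite hS.exceptional.cubic hS.nbrs.adj₂
  · have hpath : IsClearPath G v a b c p (Set.Iic m) :=
      ⟨hS, isLowerSet_Iic m, fun i hi => hp.mono (Nat.succ_le_succ hi),
        fun i hi => hclear p i (hp.mono (Nat.succ_le_succ hi))⟩
    obtain ⟨s, r, r', hmarking⟩ := hpath.exists_isEndMarking hend
    exact hmarking.false
  · exact IsClearPath.false_of_infinite (v := v) (a := a) (b := b) (c := c)
      ⟨hS, isLowerSet_univ, fun i _ => hp (i + 1), fun i _ => hclear p i (hp (i + 1))⟩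

/-! ### Maximal branches -/

/-- `x` is an interior vertex of the piece of kind `k` with root `l` and outer neighbor `o`. -/
def IsInPiece (G : SimpleGraph V) : PieceKind → V → V → V → Prop
  | .diamond, l, o, x => ∃ e₁ e₂ b c, IsPendantDiamond G l o e₁ e₂ b c ∧ (x = e₁ ∨ x = b)
  | .bipartite, l, o, x =>
    ∃ e₁ e₂ b w z y, IsPendantBipartite G l o e₁ e₂ b w z y ∧ (x = e₁ ∨ x = b)

theorem IsInPiece.isInterior {k : PieceKind} {l o x : V} (h : IsInPiece G k l o x) :
    IsInterior G x := by
  cases k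
  · obtain ⟨e₁, e₂, b, c, h⟩ := h
    exact .inl ⟨_, _, _, _, _, _, h⟩
  · obtain ⟨e₁, e₂, b, w, z, y, h⟩ := h
    exact .inr ⟨_, _, _, _, _, _, _, _, h⟩

theorem IsInPiece.of_adj {k : PieceKind} {l o x u : V} (h : IsInPiece G k l o x)
    (hu : G.Adj x u) : IsInPiece G k l o u ∨ u = l := by
  cases k
  · obtain ⟨e₁, e₂, b, c, h, rfl | rfl⟩ := h
    · obtain rfl | rfl | rfl := h.left.eq_or_eq_or_eq hu
      exacts [.inr rfl, .inl ⟨_, _, _, _, h, .inr rfl⟩,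
        .inl ⟨_, _, _, _, h.swap_middle, .inr rfl⟩]
    · obtain rfl | rfl | rfl := h.middle₁.eq_or_eq_or_eq hu
      exacts [.inl ⟨_, _, _, _, h.swap_middle, .inr rfl⟩, .inl ⟨_, _, _, _, h, .inl rfl⟩,
        .inl ⟨_, _, _, _, h.symm, .inl rfl⟩]
  · obtain ⟨e₁, e₂, b, w, z, y, h, rfl | rfl⟩ := h
    · obtain rfl | rfl | rfl := h.left.eq_or_eq_or_eq hu
      exacts [.inr rfl, .inl ⟨_, _, _, _, _, _, h, .inr rfl⟩,
        .inl ⟨_, _, _, _, _, _, h.swap_left, .inr rfl⟩]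
    · obtain rfl | rfl | rfl := h.nbrs_x.eq_or_eq_or_eq hu
      exacts [.inl ⟨_, _, _, _, _, _, h, .inl rfl⟩,
        .inl ⟨_, _, _, _, _, _, h.symm, .inr rfl⟩,
        .inl ⟨_, _, _, _, _, _, h.symm.swap_left, .inr rfl⟩]

theorem IsPieceRoot.isInPiece_of_adj {k : PieceKind} {l o x : V} (h : IsPieceRoot G k l o)
    (hx : G.Adj l x) (hne : x ≠ o) : IsInPiece G k l o x := by
  cases k
  · obtain ⟨e₁, e₂, b, c, h⟩ := h
    obtain rfl | rfl | rfl := h.root.eq_or_eq_or_eq hx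
    exacts [absurd rfl hne, ⟨_, _, _, _, h, .inl rfl⟩, ⟨_, _, _, _, h.symm, .inl rfl⟩]
  · obtain ⟨e₁, e₂, b, w, z, y, h⟩ := h
    obtain rfl | rfl | rfl := h.root.eq_or_eq_or_eq hx
    exacts [absurd rfl hne, ⟨_, _, _, _, _, _, h, .inl rfl⟩,
      ⟨_, _, _, _, _, _, h.symm, .inl rfl⟩]

/-- `x` belongs to the branch of height `h` with root `p` and outer neighbor `o`. -/
def IsInBranch (G : SimpleGraph V) (k : PieceKind) : ℕ → V → V → V → Prop
  | 0, p, o, x => x = p ∨ IsInPiece G k p o x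
  | h + 1, p, o, x =>
    x = p ∨ ∃ q, q ≠ o ∧ G.Adj p q ∧ IsBranch G k h q p ∧ IsInBranch G k h q p x

/-- No vertex of `G` is the center of three branches of the same height. -/
def IsCenterless (G : SimpleGraph V) : Prop := ∀ k h o, ¬ IsCenter G k h o

theorem IsBranch.outer_unique {k k' : PieceKind} {h h' : ℕ} {p o o' : V} (hno : IsCenterless G)
    (hb : IsBranch G k h p o) (hb' : IsBranch G k' h' p o') : o = o' := by
  obtain ⟨rfl, rfl⟩ := hb.kind_and_height_unique hb'
  by_contra hne
  obtain ⟨h', hcenter⟩ := hb.exists_isCenter hb' hne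
  exact hno _ _ _ hcenter

/-- A sequence of branches of increasing height, each one extending the previous one. -/
def IsRay (G : SimpleGraph V) (k : PieceKind) (v : ℕ → V) : Prop :=
  ∀ i, IsBranch G k i (v i) (v (i + 1))

namespace IsInBranch

variable {k k₁ k₂ : PieceKind} {h h₁ h₂ : ℕ} {p o x y u : V}

theorem self : IsInBranch G k h p o p := by
  cases h <;> exact .inl rfl

theorem of_adj (hb : IsBranch G k h p o) (hx : IsInBranch G k h p o x) (hu : G.Adj x u) :
    IsInBranch G k h p o u ∨ u = o := by
  suffices hexit : IsInBranch G k h p o u ∨ (x = p ∧ u = o) from hexit.imp_right And.right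
  induction h generalizing p o with
  | zero =>
    obtain rfl | hx := hx
    · by_cases huo : u = o
      · exact .inr ⟨rfl, huo⟩
      · exact .inl (.inr (IsPieceRoot.isInPiece_of_adj hb hu huo))
    · obtain hu' | hu' := hx.of_adj hu
      exacts [.inl (.inr hu'), .inl (.inl hu')]
  | succ h ih =>
    obtain rfl | ⟨q, hqo, hpq, hbq, hx⟩ := hx
    · by_cases huo : u = o
      · exact .inr ⟨rfl, huo⟩
      · obtain ⟨p₁, p₂, hn, h₁, h₂⟩ := hb
        have hbu : IsBranch G k h u x := by
          obtain rfl | rfl | rfl := hn.eq_or_eq_or_eq hu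
          exacts [absurd rfl huo, h₁, h₂]
        exact .inl (.inr ⟨u, huo, hu, hbu, self⟩)
    · obtain hu' | ⟨-, hu'⟩ := ih hbq hx
      exacts [.inl (.inr ⟨q, hqo, hpq, hbq, hu'⟩), .inl (.inl hu')]

theorem ray_eq_root {v : ℕ → V} (hx : IsInBranch G k h p o (v 0)) (hno : IsCenterless G)
    (hv : IsRay G k v) (hb : IsBranch G k h p o) : v h = p := by
  induction h generalizing p o with
  | zero =>
    obtain e | hx := hx
    exacts [e, absurd hx.isInterior (hv 0).not_isInterior]
  | succ h ih =>
    obtain e | ⟨q, -, -, hbq, hx⟩ := hx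
    · have := ((hv 0).kind_and_height_unique (e ▸ hb)).2
      omega
    · exact (hv h).outer_unique hno (ih hx hbq ▸ hbq)

theorem eq_root_of_branches (hx : IsInBranch G k h p o x) (hno : IsCenterless G)
    (hb : IsBranch G k h p o) (hxy : IsBranch G k₁ h₁ x y) (hyx : IsBranch G k₂ h₂ y x) :
    x = p := by
  induction h generalizing p o with
  | zero =>
    obtain e | hx := hx
    exacts [e, absurd hx.isInterior hxy.not_isInterior]
  | succ h ih =>
    obtain e | ⟨q, hqo, -, hbq, hx⟩ := hx
    · exact e
    · obtain rfl := ih hx hbq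
      obtain rfl := hxy.outer_unique hno hbq
      exact absurd (hyx.outer_unique hno hb) hqo

end IsInBranch

namespace IsRay

variable {k : PieceKind} {v : ℕ → V}

theorem exists_sibling (hv : IsRay G k v) (hno : IsCenterless G) (i : ℕ) :
    ∃ w, HasNbrs G (v (i + 1)) (v (i + 2)) (v i) w ∧ IsBranch G k i w (v (i + 1)) := by
  obtain ⟨p₁, p₂, hn, h₁, h₂⟩ := hv (i + 1)
  obtain e | rfl | rfl := hn.eq_or_eq_or_eq (hv i).adj.symm
  · refine absurd (fun x hx => ?_) (hno k i (v (i + 1)))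
    obtain rfl | rfl | rfl := hn.eq_or_eq_or_eq hx
    exacts [e ▸ hv i, h₁, h₂]
  · exact ⟨p₂, hn, h₂⟩
  · exact ⟨p₁, hn.swap₂₃, h₁⟩

/-- `G` is the union of the branches along the ray, so `φ (v 0)` lies in one of them. -/
theorem exists_fixed_tail (hv : IsRay G k v) (hno : IsCenterless G) (hconn : G.Connected)
    (φ : G ≃g G) : ∃ n, ∀ i, n ≤ i → φ (v i) = v i := by
  obtain ⟨n, hn⟩ := forall_of_forall_adj hconn
    (p := fun x => ∃ n, IsInBranch G k n (v n) (v (n + 1)) x) (v := v 0) ⟨0, .self⟩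
    (by
      rintro x y ⟨n, hx⟩ hxy
      obtain hy | rfl := hx.of_adj (hv n) hxy
      exacts [⟨n, hy⟩, ⟨n + 1, .self⟩]) (φ (v 0))
  refine ⟨n, fun i hi => ?_⟩
  induction i, hi using Nat.le_induction with
  | base => exact hn.ray_eq_root (v := fun i => φ (v i)) hno (fun i => (hv i).map φ) (hv n)
  | succ i _ ih =>
    have hbranch := (hv i).map φ
    rw [ih] at hbranch
    exact hbranch.outer_unique hno (hv i)

theorem fixes_of_distinguishes_siblings (hv : IsRay G k v) (hno : IsCenterless G)
    (hconn : G.Connected) {w : ℕ → V}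
    (hn : ∀ i, HasNbrs G (v (i + 1)) (v (i + 2)) (v i) (w i)) {φ : G ≃g G}
    (hφ : ∀ i, φ (w i) ≠ v i) (i : ℕ) : φ (v i) = v i ∧ φ (w i) = w i := by
  have hdown : ∀ i, φ (v (i + 1)) = v (i + 1) → φ (v (i + 2)) = v (i + 2) →
      φ (v i) = v i ∧ φ (w i) = w i := by
    intro i h₁ h₂
    exact ((hn i).rotate.map_eq_or_swap h₁ h₂).resolve_right fun e => hφ i e.2
  obtain ⟨n, htail⟩ := hv.exists_fixed_tail hno hconn φ
  have hfix : ∀ d i, n ≤ i + d → φ (v i) = v i := by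
    intro d
    induction d with
    | zero => exact htail
    | succ d ih => exact fun i hi => (hdown i (ih _ (by omega)) (ih _ (by omega))).1
  exact hdown i (hfix n _ (by omega)) (hfix n _ (by omega))

end IsRay

namespace IsExceptional

variable {k k' : PieceKind} {h h' : ℕ} {p a o : V}

theorem not_isRay (hG : IsExceptional G) (hno : IsCenterless G) (v : ℕ → V) :
    ¬ IsRay G k v := by
  intro hv
  choose w hn hw using hv.exists_sibling hno
  have hne : ∀ i j, v i ≠ w j := by
    intro i j e
    obtain rfl := ((hv i).kind_and_height_unique (e ▸ hw j)).2
    exact (hn i).ne₂₃ e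
  refine hG.not_distinguishable <| .of_initial_coloring hG.connected hG.cubic
    (Set.range v ∪ Set.range w) (Set.range w) ⟨v 0, .inl ⟨0, rfl⟩⟩ Set.subset_union_right ?_ ?_
  · rintro _ (⟨i, rfl⟩ | ⟨i, rfl⟩)
    · exact ⟨_, .inl ⟨i + 1, rfl⟩, (hv i).adj⟩
    · exact ⟨_, .inl ⟨i + 1, rfl⟩, (hw i).adj⟩
  · intro Q hQ _ φ hφ
    have hw_black : ∀ i, w i ∈ Q := fun i => (hQ _ (.inr ⟨i, rfl⟩)).2 ⟨i, rfl⟩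
    have hv_white : ∀ i, v i ∉ Q := fun i hi => by
      obtain ⟨j, e⟩ := (hQ _ (.inl ⟨i, rfl⟩)).1 hi
      exact hne i j e.symm
    have hfix := hv.fixes_of_distinguishes_siblings hno hG.connected hn (φ := φ)
      fun i e => hv_white i (e ▸ (hφ _).2 (hw_black i))
    rintro _ (⟨i, rfl⟩ | ⟨i, rfl⟩)
    exacts [(hfix i).1, (hfix i).2]

/-- Otherwise `G` is the union of the two branches, and it suffices to distinguish their roots. -/
theorem not_isBranch_symm (hG : IsExceptional G) (hno : IsCenterless G)
    (hb : IsBranch G k h p a) : ¬ IsBranch G k' h' a p := by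
  intro hb'
  refine hG.not_distinguishable <| .of_initial_coloring hG.connected hG.cubic
    {p, a} {p} ⟨p, .inl rfl⟩ (Set.singleton_subset_iff.2 (.inl rfl)) ?_ ?_
  · rintro _ (rfl | rfl)
    · exact ⟨a, .inr rfl, hb.adj⟩
    · exact ⟨p, .inl rfl, hb'.adj⟩
  · intro Q hQ _ φ hφ
    have hp : p ∈ Q := (hQ p (.inl rfl)).2 rfl
    have ha : a ∉ Q := fun ha => hb'.adj.ne ((hQ a (.inr rfl)).1 ha)
    have hcover := forall_of_forall_adj hG.connected
      (p := fun x => IsInBranch G k h p a x ∨ IsInBranch G k' h' a p x) (v := p) (.inl .self)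
      (by
        rintro x y (hx | hx) hxy
        · obtain hy | rfl := hx.of_adj hb hxy
          exacts [.inl hy, .inr .self]
        · obtain hy | rfl := hx.of_adj hb' hxy
          exacts [.inr hy, .inl .self]) (φ p)
    have hφp : φ p = p := by
      obtain hx | hx := hcover
      · exact hx.eq_root_of_branches hno hb (hb.map φ) (hb'.map φ)
      · exact absurd (hx.eq_root_of_branches hno hb' (hb.map φ) (hb'.map φ) ▸ (hφ p).2 hp) ha
    rintro _ (rfl | rfl)
    exacts [hφp, (hφp ▸ hb.map φ).outer_unique hno hb]

/-- If all the neighbors of `a` were fixed with `a`, then it would suffice to color the closed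
neighborhood of `a` black: no other vertex can have a completely black closed neighborhood. -/
theorem exists_moved_nbr (hG : IsExceptional G) (hint : ¬ IsInterior G a)
    (hroot : ∀ k o, ¬ IsPieceRoot G k a o) :
    ∃ φ : G ≃g G, φ a = a ∧ ∃ x, G.Adj a x ∧ φ x ≠ x := by
  by_contra! hfix
  obtain ⟨x, y, z, hn⟩ := hG.cubic a
  have hmem : ∀ {z}, z ∈ closedNbhd G {a} ↔ z = a ∨ G.Adj a z := by simp [closedNbhd]
  refine hG.not_distinguishable <| .of_initial_coloring hG.connected hG.cubic
    (closedNbhd G {a}) (closedNbhd G {a}) ⟨a, .inl rfl⟩ subset_rfl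
    (fun u hu => exists_adj_mem_closedNbhd hu (by rintro _ rfl; exact ⟨x, hn.adj₁⟩)) ?_
  intro Q hQ htraced φ hφ
  obtain ⟨ha, hnbrs⟩ := nbrs_black_of_preserves (fun z hz => (hQ z hz).2 hz) hφ
    (Set.mem_singleton a)
  have hfixa : φ a = a := by
    have hn' := hn.map φ
    obtain ⟨⟨hx, hy, hz⟩, hbase⟩ := htraced.nbrs_mem_base hG.cubic hn' ha (hnbrs _ hn'.adj₁)
      (hnbrs _ hn'.adj₂) (hnbrs _ hn'.adj₃)
    obtain ha' | ⟨w, hne, hw⟩ := hbase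
    · refine (hmem.1 ha').resolve_right fun hadj => ?_
      obtain ⟨t, hta, ht, hat⟩ : ∃ t, t ≠ a ∧ t ∈ closedNbhd G {a} ∧ G.Adj (φ a) t := by
        by_cases hxa : φ x = a
        · exact ⟨φ y, fun e => hn'.ne₁₂ (hxa.trans e.symm), hy, hn'.adj₂⟩
        · exact ⟨φ x, hxa, hx, hn'.adj₁⟩
      exact hint (hG.isInterior_of_triangle hadj ((hmem.1 ht).resolve_left hta) hat)
    · obtain ⟨t, -, -, hat, -, ht_int, -⟩ :=
        (hG.isInterior_of_twins hn' hw hne.symm).exists_two_interior_nbrs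
      have ht : t ∈ closedNbhd G {a} := by
        obtain rfl | rfl | rfl := hn'.eq_or_eq_or_eq hat <;> assumption
      obtain rfl | hadj := hmem.1 ht
      · exact absurd ht_int hint
      · obtain ha_int | ⟨k, o, ha_root, -⟩ := ht_int.interior_or_root_of_adj hadj.symm
        exacts [absurd ha_int hint, absurd ha_root (hroot k o)]
  intro z hz
  obtain rfl | hz := hmem.1 hz
  exacts [hfixa, hfix φ hfixa z hz]

theorem exists_maximal_isBranch (hG : IsExceptional G) (hno : IsCenterless G) {l : V}
    (hl : IsPieceRoot G k l o) :
    ∃ h p a, IsBranch G k h p a ∧ ∀ o', ¬ IsBranch G k (h + 1) a o' := by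
  by_contra! hcont
  let T := fun n : ℕ => {q : V × V // IsBranch G k n q.1 q.2}
  have hstep : ∀ n (t : T n), ∃ q : T (n + 1), q.1.1 = t.1.2 := by
    rintro n ⟨⟨p, o⟩, hb⟩
    obtain ⟨o', hb'⟩ := hcont n p o hb
    exact ⟨⟨(o, o'), hb'⟩, rfl⟩
  choose next hnext using hstep
  let P : ∀ n, T n := fun n => Nat.rec ⟨(l, o), hl⟩ (fun n t => next n t) n
  refine hG.not_isRay hno (k := k) (fun n => (P n).1.1) fun i => ?_
  change IsBranch G k i (P i).1.1 (P (i + 1)).1.1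
  rw [show (P (i + 1)).1.1 = (P i).1.2 from hnext i (P i)]
  exact (P i).2

/-- The vertex above a maximal branch is the start of a path of swaps, and hence itself the outer
neighbor of two further branches. -/
theorem exists_isCenter (hG : IsExceptional G) {l : V} (hl : IsPieceRoot G k l o) :
    ∃ k h o, IsCenter G k h o := by
  by_contra! hno
  obtain ⟨h, p, a, hb, hmax⟩ := hG.exists_maximal_isBranch hno hl
  obtain ⟨y, z, hn⟩ := hG.cubic.exists_hasNbrs₂ hb.adj.symm
  have hfixp : ∀ φ : G ≃g G, φ a = a → φ p = p := by
    intro φ hφ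
    have hb' := hb.map φ
    rw [hφ] at hb'
    obtain e | e | e := hn.eq_or_eq_or_eq hb'.adj.symm
    · exact e
    · exact absurd ⟨p, y, hn.rotate.rotate, hb, e ▸ hb'⟩ (hmax z)
    · exact absurd ⟨p, z, hn.swap₁₂, hb, e ▸ hb'⟩ (hmax y)
  have hint : ¬ IsInterior G a := by
    intro ha
    obtain hp | ⟨_, _, hp, hne⟩ := ha.interior_or_root_of_adj hb.adj.symm
    · exact hb.not_isInterior hp
    · exact hne (hb.outer_unique hno (h' := 0) hp)
  have hroot : ∀ k o, ¬ IsPieceRoot G k a o := by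
    intro k' o ha
    by_cases hpo : p = o
    · exact hG.not_isBranch_symm hno hb (h' := 0) (hpo ▸ ha)
    · exact hb.not_isInterior (ha.isInterior_of_adj hb.adj.symm hpo)
  obtain ⟨τ, hτa, x, hx, hτx⟩ := hG.exists_moved_nbr hint hroot
  have hτy : τ y = z := by
    obtain ⟨hy, hz⟩ | ⟨hy, -⟩ := hn.rotate.map_eq_or_swap hτa (hfixp τ hτa)
    · obtain rfl | rfl | rfl := hn.eq_or_eq_or_eq hx
      exacts [absurd (hfixp τ hτa) hτx, absurd hy hτx, absurd hz hτx]
    · exact hy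
  obtain ⟨k', h', hy⟩ := (IsSwapStart.of_fixed_nbr hG hn hfixp hint hroot).exists_isBranch
  have hz := hy.map τ
  rw [hτy, hτa] at hz
  exact hG.not_isBranch_symm hno hb (h' := h' + 1) ⟨y, z, hn, hy, hz⟩

end IsExceptional

/-! ### The models -/

namespace TreeNode

/-- The parent of a vertex; by convention the root is its own parent. -/
def parent : TreeNode → TreeNode
  | root => root
  | node _ [] => root
  | node i (_ :: l) => node i l

theorem isChild_iff {s t : TreeNode} : IsChild s t ↔ t ≠ root ∧ s = t.parent := by
  constructor
  · rintro (_ | _)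
    exacts [⟨nofun, rfl⟩, ⟨nofun, rfl⟩]
  · rintro ⟨ht, rfl⟩
    rcases t with _ | ⟨i, _ | ⟨b, l⟩⟩
    exacts [absurd rfl ht, .root i, .node i l b]

theorem node_eq_parent_iff {i : Fin 3} {l : List Bool} {t : TreeNode} :
    (t ≠ root ∧ node i l = t.parent) ↔ t = node i (false :: l) ∨ t = node i (true :: l) := by
  rcases t with _ | ⟨j, _ | ⟨b, l'⟩⟩
  · simp
  · simp [parent]
  · cases b <;> simp [parent, eq_comm]

theorem root_eq_parent_iff {t : TreeNode} :
    (t ≠ root ∧ root = t.parent) ↔ t = node 0 [] ∨ t = node 1 [] ∨ t = node 2 [] := by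
  rcases t with _ | ⟨j, _ | ⟨b, l'⟩⟩
  · simp
  · fin_cases j <;> simp [parent]
  · simp [parent]

theorem ne_parent {t : TreeNode} (h : t ≠ root) : t ≠ t.parent := by
  rcases t with _ | ⟨i, _ | ⟨b, l⟩⟩
  · exact absurd rfl h
  · simp [parent]
  · simp [parent]

theorem depth_parent_le (t : TreeNode) : t.parent.depth ≤ t.depth := by
  rcases t with _ | ⟨_, _ | _⟩ <;> simp [parent, depth]

end TreeNode

namespace LeafPair

variable {n : ℕ} {q q' : LeafPair n}

theorem coe_u : (q.u : TreeNode) = .node q.1 (false :: q.2.1) := rfl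

theorem coe_v : (q.v : TreeNode) = .node q.1 (true :: q.2.1) := rfl

theorem u_inj : q.u = q'.u ↔ q = q' := by
  simp [Subtype.ext_iff, Prod.ext_iff, coe_u]

theorem v_inj : q.v = q'.v ↔ q = q' := by
  simp [Subtype.ext_iff, Prod.ext_iff, coe_v]

theorem u_ne_v : q.u ≠ q'.v := by
  simp [Subtype.ext_iff, coe_u, coe_v]

/-- The common neighbor of the two leaves of a sibling pair. -/
def base (q : LeafPair n) : TVertex n :=
  ⟨.node q.1 q.2.1, by have := q.2.2; simp only [TreeNode.depth]; omega⟩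

theorem exists_eq_of_length_lt {h : ℕ} {i : Fin 3} {l : List Bool}
    (ht : (TreeNode.node i l).depth ≤ h + 2) (hl : h < l.length) :
    ∃ q : LeafPair (h + 2), q.u = ⟨.node i l, ht⟩ ∨ q.v = ⟨.node i l, ht⟩ := by
  cases l with
  | nil => exact absurd hl (Nat.not_lt_zero h)
  | cons b l =>
    simp only [TreeNode.depth, List.length_cons] at ht hl
    refine ⟨(i, ⟨l, by omega⟩), ?_⟩
    cases b
    exacts [.inl rfl, .inr rfl]

theorem not_depth_grandchild_le (q : LeafPair n) (b b' : Bool) :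
    ¬ (TreeNode.node q.1 (b :: b' :: q.2.1)).depth ≤ n := by
  have := q.2.2
  simp only [TreeNode.depth, List.length_cons]
  omega

end LeafPair

section addGadgets

variable {n h : ℕ} {I : Type} {H : SimpleGraph I} {Nu Nv : Set I}

theorem treeT_adj_iff {s t : TVertex n} : (treeT n).Adj s t ↔
    (t.1 ≠ .root ∧ s.1 = t.1.parent) ∨ (s.1 ≠ .root ∧ t.1 = s.1.parent) := by
  simp only [treeT, SimpleGraph.fromRel_adj, TreeNode.isChild_iff, and_iff_right_iff_imp]
  rintro h rfl
  exact h.elim (fun h => TreeNode.ne_parent h.1 h.2) fun h => TreeNode.ne_parent h.1 h.2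

theorem addGadgets_adj_inl {s t : TVertex n} :
    (addGadgets n H Nu Nv).Adj (.inl s) (.inl t) ↔
      (t.1 ≠ .root ∧ s.1 = t.1.parent) ∨ (s.1 ≠ .root ∧ t.1 = s.1.parent) := by
  simp only [addGadgets, SimpleGraph.fromRel_adj, ← treeT_adj_iff, (treeT n).adj_comm t s, or_self,
    ne_eq, Sum.inl.injEq, and_iff_right_iff_imp]
  exact fun h => h.ne

theorem addGadgets_adj_inl_inr {s : TVertex n} {q : LeafPair n} {a : I} :
    (addGadgets n H Nu Nv).Adj (.inl s) (.inr (q, a)) ↔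
      (s = q.u ∧ a ∈ Nu) ∨ (s = q.v ∧ a ∈ Nv) := by
  simp [addGadgets, SimpleGraph.fromRel_adj]

theorem addGadgets_adj_inr_inl {s : TVertex n} {q : LeafPair n} {a : I} :
    (addGadgets n H Nu Nv).Adj (.inr (q, a)) (.inl s) ↔
      (s = q.u ∧ a ∈ Nu) ∨ (s = q.v ∧ a ∈ Nv) := by
  rw [SimpleGraph.adj_comm, addGadgets_adj_inl_inr]

theorem addGadgets_adj_inr {q q' : LeafPair n} {a b : I} :
    (addGadgets n H Nu Nv).Adj (.inr (q, a)) (.inr (q', b)) ↔ q = q' ∧ H.Adj a b := by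
  simp only [addGadgets, SimpleGraph.fromRel_adj, H.adj_comm b a, eq_comm (a := q'), or_self, ne_eq,
    Sum.inr.injEq, Prod.mk.injEq, not_and, and_iff_right_iff_imp]
  exact fun h _ => h.2.ne

theorem addGadgets_hasNbrs_root :
    HasNbrs (addGadgets (h + 2) H Nu Nv) (.inl ⟨.root, Nat.zero_le _⟩)
      (.inl ⟨.node 0 [], by simp [TreeNode.depth]⟩) (.inl ⟨.node 1 [], by simp [TreeNode.depth]⟩)
      (.inl ⟨.node 2 [], by simp [TreeNode.depth]⟩) := by
  refine ⟨by simp, by simp, by simp, ?_⟩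
  rintro (⟨t, ht⟩ | ⟨q, a⟩)
  · simp [addGadgets_adj_inl, TreeNode.root_eq_parent_iff]
  · simp [addGadgets_adj_inl_inr, Subtype.ext_iff, LeafPair.coe_u, LeafPair.coe_v]

theorem addGadgets_hasNbrs_node {i : Fin 3} {l : List Bool} (hl : l.length ≤ h) :
    HasNbrs (addGadgets (h + 2) H Nu Nv)
      (.inl ⟨.node i l, by simp only [TreeNode.depth]; omega⟩)
      (.inl ⟨(TreeNode.node i l).parent,
        (TreeNode.depth_parent_le _).trans (by simp only [TreeNode.depth]; omega)⟩)
      (.inl ⟨.node i (false :: l), by simp only [TreeNode.depth, List.length_cons]; omega⟩)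
      (.inl ⟨.node i (true :: l), by simp only [TreeNode.depth, List.length_cons]; omega⟩) := by
  have hparent : ∀ b, (TreeNode.node i l).parent ≠ .node i (b :: l) := by
    intro b e
    have hdepth := TreeNode.depth_parent_le (.node i l)
    simp [e, TreeNode.depth] at hdepth
  refine ⟨by simpa using hparent false, by simpa using hparent true, by simp, ?_⟩
  rintro (⟨t, ht⟩ | ⟨q, a⟩)
  · simp only [addGadgets_adj_inl, TreeNode.node_eq_parent_iff, ne_eq, reduceCtorEq,
      not_false_eq_true, true_and, Sum.inl.injEq, Subtype.mk.injEq]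
    tauto
  · have hleaf : ∀ b, l ≠ b :: q.2.1 := by
      rintro b rfl
      have := q.2.2
      simp only [List.length_cons] at hl
      omega
    simp [addGadgets_adj_inl_inr, Subtype.ext_iff, LeafPair.coe_u, LeafPair.coe_v, hleaf]

theorem addGadgets_hasNbrs_u {a₁ a₂ : I} (hne : a₁ ≠ a₂) (q : LeafPair n) :
    HasNbrs (addGadgets n H {a₁, a₂} Nv) (.inl q.u) (.inl q.base) (.inr (q, a₁))
      (.inr (q, a₂)) := by
  refine ⟨by simp, by simp, by simp [hne], ?_⟩
  rintro (⟨t, ht⟩ | ⟨q', a⟩)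
  · have hleaf : ∀ b, t ≠ .node q.1 (b :: false :: q.2.1) := by
      rintro b rfl
      exact q.not_depth_grandchild_le b false ht
    rw [addGadgets_adj_inl, LeafPair.coe_u, TreeNode.node_eq_parent_iff]
    simp [hleaf, LeafPair.base, TreeNode.parent]
  · simp only [addGadgets_adj_inl_inr, LeafPair.u_inj, LeafPair.u_ne_v, false_and, or_false,
      Set.mem_insert_iff, Set.mem_singleton_iff, reduceCtorEq, false_or, Sum.inr.injEq,
      Prod.mk.injEq]
    grind

theorem addGadgets_hasNbrs_v {a₁ a₂ : I} (hne : a₁ ≠ a₂) (q : LeafPair n) :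
    HasNbrs (addGadgets n H Nu {a₁, a₂}) (.inl q.v) (.inl q.base) (.inr (q, a₁))
      (.inr (q, a₂)) := by
  refine ⟨by simp, by simp, by simp [hne], ?_⟩
  rintro (⟨t, ht⟩ | ⟨q', a⟩)
  · have hleaf : ∀ b, t ≠ .node q.1 (b :: true :: q.2.1) := by
      rintro b rfl
      exact q.not_depth_grandchild_le b true ht
    rw [addGadgets_adj_inl, LeafPair.coe_v, TreeNode.node_eq_parent_iff]
    simp [hleaf, LeafPair.base, TreeNode.parent]
  · simp only [addGadgets_adj_inl_inr, LeafPair.v_inj, LeafPair.u_ne_v.symm, false_and, false_or,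
      Set.mem_insert_iff, Set.mem_singleton_iff, reduceCtorEq, Sum.inr.injEq, Prod.mk.injEq]
    grind

theorem addGadgets_induction (hI : ∀ a, a ∈ Nu ∨ a ∈ Nv)
    {P : TVertex n ⊕ (LeafPair n × I) → Prop} (hroot : P (.inl ⟨.root, Nat.zero_le _⟩))
    (hadj : ∀ s t, P s → (addGadgets n H Nu Nv).Adj s t → P t) (s) : P s := by
  have htree : ∀ t : TVertex n, P (.inl t) := by
    rintro ⟨t, ht⟩
    cases t with
    | root => exact hroot
    | node i l =>
      induction l with
      | nil => exact hadj _ _ hroot (addGadgets_adj_inl.2 (.inl ⟨nofun, rfl⟩))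
      | cons b l ih =>
        exact hadj (.inl ⟨.node i l, Nat.le_of_succ_le ht⟩) _ (ih _)
          (addGadgets_adj_inl.2 (.inl ⟨nofun, rfl⟩))
  obtain t | ⟨q, a⟩ := s
  · exact htree t
  · obtain ha | ha := hI a
    · exact hadj _ _ (htree q.u) (addGadgets_adj_inl_inr.2 (.inl ⟨rfl, ha⟩))
    · exact hadj _ _ (htree q.v) (addGadgets_adj_inl_inr.2 (.inr ⟨rfl, ha⟩))

end addGadgets

section gadgets

variable {n : ℕ} (q : LeafPair n)

theorem graphRTwo_hasNbrs_x :
    HasNbrs (graphRTwo n) (.inr (q, .x)) (.inr (q, .y)) (.inl q.u) (.inl q.v) := by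
  refine ⟨by simp, by simp, by simp [LeafPair.u_ne_v], ?_⟩
  rintro (t | ⟨q', _ | _⟩) <;>
    simp [graphRTwo, addGadgets_adj_inr_inl, addGadgets_adj_inr, eq_comm]

theorem graphRTwo_hasNbrs_y :
    HasNbrs (graphRTwo n) (.inr (q, .y)) (.inr (q, .x)) (.inl q.u) (.inl q.v) := by
  refine ⟨by simp, by simp, by simp [LeafPair.u_ne_v], ?_⟩
  rintro (t | ⟨q', _ | _⟩) <;>
    simp [graphRTwo, addGadgets_adj_inr_inl, addGadgets_adj_inr, eq_comm]

theorem graphRThree_hasNbrs_x :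
    HasNbrs (graphRThree n) (.inr (q, .x)) (.inl q.u) (.inr (q, .z)) (.inr (q, .y)) := by
  refine ⟨by simp, by simp, by simp, ?_⟩
  rintro (t | ⟨q', _ | _⟩) <;>
    simp [graphRThree, addGadgets_adj_inr_inl, addGadgets_adj_inr, eq_comm]

theorem graphRThree_hasNbrs_y :
    HasNbrs (graphRThree n) (.inr (q, .y)) (.inl q.v) (.inr (q, .x)) (.inr (q, .w)) := by
  refine ⟨by simp, by simp, by simp, ?_⟩
  rintro (t | ⟨q', _ | _⟩) <;>
    simp [graphRThree, addGadgets_adj_inr_inl, addGadgets_adj_inr, eq_comm]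

theorem graphRThree_hasNbrs_z :
    HasNbrs (graphRThree n) (.inr (q, .z)) (.inl q.v) (.inr (q, .x)) (.inr (q, .w)) := by
  refine ⟨by simp, by simp, by simp, ?_⟩
  rintro (t | ⟨q', _ | _⟩) <;>
    simp [graphRThree, addGadgets_adj_inr_inl, addGadgets_adj_inr, eq_comm]

theorem graphRThree_hasNbrs_w :
    HasNbrs (graphRThree n) (.inr (q, .w)) (.inl q.u) (.inr (q, .z)) (.inr (q, .y)) := by
  refine ⟨by simp, by simp, by simp, ?_⟩
  rintro (t | ⟨q', _ | _⟩) <;>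
    simp [graphRThree, addGadgets_adj_inr_inl, addGadgets_adj_inr, eq_comm]

end gadgets

/-- The map `f` is a bijection from the neighbors of `s` to the neighbors of `f s`, both of which
are three in number. -/
def IsLocalBijAt {W : Type*} (M : SimpleGraph W) (G : SimpleGraph V) (f : W → V) (s : W) : Prop :=
  ∃ t₁ t₂ t₃, HasNbrs M s t₁ t₂ t₃ ∧ HasNbrs G (f s) (f t₁) (f t₂) (f t₃)

namespace IsLocalBijAt

variable {W : Type*} {M : SimpleGraph W} {f : W → V} {s t t' : W}

theorem adj (hf : IsLocalBijAt M G f s) (h : M.Adj s t) : G.Adj (f s) (f t) := by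
  obtain ⟨t₁, t₂, t₃, hs, hfs⟩ := hf
  obtain rfl | rfl | rfl := hs.eq_or_eq_or_eq h
  exacts [hfs.adj₁, hfs.adj₂, hfs.adj₃]

theorem injOn (hf : IsLocalBijAt M G f s) : Set.InjOn f (M.neighborSet s) := by
  obtain ⟨t₁, t₂, t₃, hs, hfs⟩ := hf
  intro t ht t' ht' e
  have := hfs.ne₁₂
  have := hfs.ne₁₃
  have := hfs.ne₂₃
  obtain rfl | rfl | rfl := hs.eq_or_eq_or_eq ht <;>
    obtain rfl | rfl | rfl := hs.eq_or_eq_or_eq ht' <;> simp_all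

theorem exists_adj (hf : IsLocalBijAt M G f s) {y : V} (h : G.Adj (f s) y) :
    ∃ t, M.Adj s t ∧ f t = y := by
  obtain ⟨t₁, t₂, t₃, hs, hfs⟩ := hf
  obtain rfl | rfl | rfl := hfs.eq_or_eq_or_eq h
  exacts [⟨_, hs.adj₁, rfl⟩, ⟨_, hs.adj₂, rfl⟩, ⟨_, hs.adj₃, rfl⟩]

end IsLocalBijAt

/-- A covering of connected graphs is an isomorphism if one of its fibers is a singleton, since
this property spreads to the adjacent fibers. -/
theorem exists_iso_of_covering {W : Type*} {M : SimpleGraph W} (hconn : G.Connected) (f : W → V)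
    (r : W) (hM : ∀ P : W → Prop, P r → (∀ s t, P s → M.Adj s t → P t) → ∀ s, P s)
    (hf : ∀ s, IsLocalBijAt M G f s) (hr : ∀ t, f t = f r → t = r) :
    ∃ Ψ : M ≃g G, ∀ s, Ψ s = f s := by
  have hinj : Function.Injective f := by
    suffices h : ∀ s t, f t = f s → t = s from fun t s => h s t
    refine hM _ hr fun s s' hs hss' t ht => ?_
    obtain ⟨t', htt', ht'⟩ := (hf t).exists_adj (ht ▸ ((hf s).adj hss').symm)
    rw [hs t' ht'] at htt'
    exact (hf s).injOn htt'.symm hss' ht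
  have hsurj : Function.Surjective f := by
    refine forall_of_forall_adj hconn (p := fun y => ∃ s, f s = y) (v := f r) ⟨r, rfl⟩ ?_
    rintro _ y ⟨s, rfl⟩ h
    obtain ⟨t, -, ht⟩ := (hf s).exists_adj h
    exact ⟨t, ht⟩
  refine ⟨⟨Equiv.ofBijective f ⟨hinj, hsurj⟩, fun {s t} => ⟨fun h => ?_, (hf s).adj⟩⟩, fun _ => rfl⟩
  obtain ⟨t', hst', ht'⟩ := (hf s).exists_adj h
  exact hinj ht' ▸ hst'

/-- The function `ch` lists the two neighbors of `x` other than a given neighbor `y`. -/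
def IsChildChoice (G : SimpleGraph V) (ch : V → V → Bool → V) : Prop :=
  ∀ x y, G.Adj x y → HasNbrs G x y (ch x y false) (ch x y true)

theorem IsCubic.exists_isChildChoice (hc : IsCubic G) : ∃ ch, IsChildChoice G ch := by
  have hchoice : ∀ x y, ∃ c : Bool → V, G.Adj x y → HasNbrs G x y (c false) (c true) := by
    intro x y
    by_cases h : G.Adj x y
    · obtain ⟨b, c, hn⟩ := hc.exists_hasNbrs₂ h
      exact ⟨fun e => cond e c b, fun _ => hn⟩
    · exact ⟨fun _ => x, fun h' => absurd h' h⟩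
  choose ch hch using hchoice
  exact ⟨ch, hch⟩

/-- The end of the walk that starts with the dart from `o` to `x` and follows the choices in `l`
(the last choice comes first), together with the vertex before it. -/
def follow (ch : V → V → Bool → V) (o x : V) : List Bool → V × V
  | [] => (x, o)
  | b :: l => (ch (follow ch o x l).1 (follow ch o x l).2 b, (follow ch o x l).1)

/-- The image of the infinite tree in a graph with a choice of children, where `o` is the image of
the root and `p i` are those of its children. -/
def treeMap (ch : V → V → Bool → V) (o : V) (p : Fin 3 → V) : TreeNode → V
  | .root => o
  | .node i l => (follow ch o (p i) l).1

theorem follow_snd (ch : V → V → Bool → V) (o : V) (p : Fin 3 → V) (i : Fin 3) (l : List Bool) :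
    (follow ch o (p i) l).2 = treeMap ch o p (TreeNode.node i l).parent := by
  cases l <;> rfl

theorem HasNbrs.adj_apply {o : V} {p : Fin 3 → V} (hn : HasNbrs G o (p 0) (p 1) (p 2)) (i : Fin 3) :
    G.Adj o (p i) := by
  fin_cases i
  exacts [hn.adj₁, hn.adj₂, hn.adj₃]

theorem IsBranch.child {ch : V → V → Bool → V} {k : PieceKind} {h : ℕ} {x y : V}
    (hb : IsBranch G k (h + 1) x y) (hch : IsChildChoice G ch) (b : Bool) :
    IsBranch G k h (ch x y b) x := by
  have hn := hch x y hb.adj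
  obtain ⟨p₁, p₂, hp, h₁, h₂⟩ := hb
  have hbranch : ∀ z, G.Adj x z → z ≠ y → IsBranch G k h z x := by
    intro z hz hne
    obtain rfl | rfl | rfl := hp.eq_or_eq_or_eq hz
    exacts [absurd rfl hne, h₁, h₂]
  cases b
  exacts [hbranch _ hn.adj₂ hn.ne₁₂.symm, hbranch _ hn.adj₃ hn.ne₁₃.symm]

theorem IsPieceRoot.exists_isPendantDiamond {l o e₁ e₂ : V} (h : IsPieceRoot G .diamond l o)
    (hn : HasNbrs G l o e₁ e₂) : ∃ b c, IsPendantDiamond G l o e₁ e₂ b c := by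
  obtain ⟨f₁, f₂, b, c, h⟩ := h
  obtain ⟨rfl, rfl⟩ | ⟨rfl, rfl⟩ := hn.rotate.eq_or_swap h.root.rotate
  exacts [⟨b, c, h⟩, ⟨b, c, h.symm⟩]

theorem IsPieceRoot.exists_isPendantBipartite {l o e₁ e₂ : V} (h : IsPieceRoot G .bipartite l o)
    (hn : HasNbrs G l o e₁ e₂) : ∃ x w z y, IsPendantBipartite G l o e₁ e₂ x w z y := by
  obtain ⟨f₁, f₂, x, w, z, y, h⟩ := h
  obtain ⟨rfl, rfl⟩ | ⟨rfl, rfl⟩ := hn.rotate.eq_or_swap h.root.rotate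
  exacts [⟨x, w, z, y, h⟩, ⟨z, y, x, w, h.symm⟩]

namespace IsCenter

variable {ch : V → V → Bool → V} {k : PieceKind} {h : ℕ} {o : V} {p : Fin 3 → V}

theorem isBranch_nbr (hC : IsCenter G k h o) {a b c : V} (hn : HasNbrs G o a b c) :
    IsBranch G k (h + 1) o a :=
  ⟨b, c, hn, hC _ hn.adj₂, hC _ hn.adj₃⟩

theorem isBranch_treeMap (hC : IsCenter G k h o) (hch : IsChildChoice G ch)
    (hn : HasNbrs G o (p 0) (p 1) (p 2)) (i : Fin 3) {l : List Bool} {j : ℕ}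
    (hl : l.length + j = h) :
    IsBranch G k j (treeMap ch o p (.node i l)) (treeMap ch o p (TreeNode.node i l).parent) := by
  rw [← follow_snd]
  induction l generalizing j with
  | nil =>
    obtain rfl : j = h := by simpa using hl
    exact hC _ (hn.adj_apply i)
  | cons b l ih =>
    exact (ih (j := j + 1) (by simp only [List.length_cons] at hl; omega)).child hch b

theorem hasNbrs_treeMap (hC : IsCenter G k h o) (hch : IsChildChoice G ch)
    (hn : HasNbrs G o (p 0) (p 1) (p 2)) (i : Fin 3) {l : List Bool} (hl : l.length ≤ h) :
    HasNbrs G (treeMap ch o p (.node i l)) (treeMap ch o p (TreeNode.node i l).parent)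
      (treeMap ch o p (.node i (false :: l))) (treeMap ch o p (.node i (true :: l))) := by
  obtain ⟨j, hj⟩ := Nat.exists_eq_add_of_le hl
  have hnode := hch _ _ (hC.isBranch_treeMap hch hn i hj.symm).adj
  rw [← follow_snd] at hnode ⊢
  exact hnode

theorem exists_isPendantDiamond (hC : IsCenter G .diamond h o) (hch : IsChildChoice G ch)
    (hn : HasNbrs G o (p 0) (p 1) (p 2)) (q : LeafPair (h + 2)) :
    ∃ b c, IsPendantDiamond G (treeMap ch o p q.base) (treeMap ch o p q.base.1.parent)
      (treeMap ch o p q.u) (treeMap ch o p q.v) b c := by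
  obtain ⟨i, l, hl⟩ := q
  obtain rfl : l.length = h := by omega
  exact IsPieceRoot.exists_isPendantDiamond (hC.isBranch_treeMap hch hn i (j := 0) rfl)
    (hC.hasNbrs_treeMap hch hn i le_rfl)

theorem exists_isPendantBipartite (hC : IsCenter G .bipartite h o) (hch : IsChildChoice G ch)
    (hn : HasNbrs G o (p 0) (p 1) (p 2)) (q : LeafPair (h + 2)) :
    ∃ x w z y, IsPendantBipartite G (treeMap ch o p q.base) (treeMap ch o p q.base.1.parent)
      (treeMap ch o p q.u) (treeMap ch o p q.v) x w z y := by
  obtain ⟨i, l, hl⟩ := q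
  obtain rfl : l.length = h := by omega
  exact IsPieceRoot.exists_isPendantBipartite (hC.isBranch_treeMap hch hn i (j := 0) rfl)
    (hC.hasNbrs_treeMap hch hn i le_rfl)

end IsCenter

/-- The map on a tree with gadgets that is `T` on the tree and `g q` on the gadget at the pair `q`
of leaves. -/
def gadgetMap {n : ℕ} {I : Type} (T : TreeNode → V) (g : LeafPair n → I → V) :
    TVertex n ⊕ (LeafPair n × I) → V :=
  Sum.elim (fun t => T t) fun q => g q.1 q.2

namespace IsCenter

variable {ch : V → V → Bool → V} {k : PieceKind} {h : ℕ} {o : V} {p : Fin 3 → V} {I : Type}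
  {g : LeafPair (h + 2) → I → V}

theorem eq_root_of_gadgetMap_eq (hC : IsCenter G k h o) (hch : IsChildChoice G ch)
    (hn : HasNbrs G o (p 0) (p 1) (p 2))
    (hu : ∀ q : LeafPair (h + 2), IsInterior G (treeMap ch o p q.u))
    (hv : ∀ q : LeafPair (h + 2), IsInterior G (treeMap ch o p q.v))
    (hg : ∀ q a, IsInterior G (g q a)) (t) (ht : gadgetMap (treeMap ch o p) g t = o) :
    t = .inl ⟨.root, Nat.zero_le _⟩ := by
  have hb := hC.isBranch_nbr hn
  obtain ⟨_ | ⟨i, l⟩, hdepth⟩ | ⟨q, a⟩ := t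
  · rfl
  · change treeMap ch o p (.node i l) = o at ht
    obtain hl | hl := le_or_gt l.length h
    · obtain ⟨j, hj⟩ := Nat.exists_eq_add_of_le hl
      have hb' := hC.isBranch_treeMap hch hn i hj.symm
      rw [ht] at hb'
      have := (hb.kind_and_height_unique hb').2
      omega
    · obtain ⟨q, hq | hq⟩ := LeafPair.exists_eq_of_length_lt hdepth hl
      · have hint := hu q
        rw [hq] at hint
        exact absurd (ht ▸ hint) hb.not_isInterior
      · have hint := hv q
        rw [hq] at hint
        exact absurd (ht ▸ hint) hb.not_isInterior
  · exact absurd (ht ▸ hg q a) hb.not_isInterior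

/-- Since `o` is the root of a branch, it is neither the root of a shorter branch nor in the
interior of a piece, so the root is its only preimage under the covering by the tree with gadgets.
-/
theorem exists_iso_addGadgets (hC : IsCenter G k h o) (hconn : G.Connected)
    (hch : IsChildChoice G ch) (hn : HasNbrs G o (p 0) (p 1) (p 2)) {H : SimpleGraph I}
    {a₁ a₂ a₃ a₄ : I} (h₁₂ : a₁ ≠ a₂) (h₃₄ : a₃ ≠ a₄)
    (hI : ∀ a, a ∈ ({a₁, a₂} : Set I) ∨ a ∈ ({a₃, a₄} : Set I))
    (hu : ∀ q, HasNbrs G (treeMap ch o p q.u) (treeMap ch o p q.base) (g q a₁) (g q a₂))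
    (hv : ∀ q, HasNbrs G (treeMap ch o p q.v) (treeMap ch o p q.base) (g q a₃) (g q a₄))
    (hg : ∀ q a, IsLocalBijAt (addGadgets (h + 2) H {a₁, a₂} {a₃, a₄}) G
      (gadgetMap (treeMap ch o p) g) (.inr (q, a)))
    (hu_int : ∀ q : LeafPair (h + 2), IsInterior G (treeMap ch o p q.u))
    (hv_int : ∀ q : LeafPair (h + 2), IsInterior G (treeMap ch o p q.v))
    (hg_int : ∀ q a, IsInterior G (g q a)) :
    ∃ Ψ : addGadgets (h + 2) H {a₁, a₂} {a₃, a₄} ≃g G,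
      ∀ s, Ψ s = gadgetMap (treeMap ch o p) g s := by
  refine exists_iso_of_covering hconn _ (.inl ⟨.root, Nat.zero_le _⟩)
    (fun P => addGadgets_induction hI) ?_ (hC.eq_root_of_gadgetMap_eq hch hn hu_int hv_int hg_int)
  rintro (⟨_ | ⟨i, l⟩, hdepth⟩ | ⟨q, a⟩)
  · exact ⟨_, _, _, addGadgets_hasNbrs_root, hn⟩
  · obtain hl | hl := le_or_gt l.length h
    · exact ⟨_, _, _, addGadgets_hasNbrs_node hl, hC.hasNbrs_treeMap hch hn i hl⟩
    · obtain ⟨q, hq | hq⟩ := LeafPair.exists_eq_of_length_lt hdepth hl <;> rw [← hq]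
      exacts [⟨_, _, _, addGadgets_hasNbrs_u h₁₂ q, hu q⟩,
        ⟨_, _, _, addGadgets_hasNbrs_v h₃₄ q, hv q⟩]
  · exact hg q a

theorem exists_iso_graphRTwo (hC : IsCenter G .diamond h o) (hconn : G.Connected)
    (hc : IsCubic G) (hn : HasNbrs G o (p 0) (p 1) (p 2)) :
    ∃ Ψ : graphRTwo (h + 2) ≃g G, Ψ (.inl ⟨.root, Nat.zero_le _⟩) = o ∧
      ∀ i, Ψ (.inl ⟨.node i [], by simp [TreeNode.depth]⟩) = p i := by
  obtain ⟨ch, hch⟩ := hc.exists_isChildChoice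
  choose b c hpiece using hC.exists_isPendantDiamond hch hn
  let g : LeafPair (h + 2) → GadgetTwo → V := fun q a => match a with
    | .x => b q
    | .y => c q
  obtain ⟨Ψ, hΨ⟩ := hC.exists_iso_addGadgets (g := g)
    (H := .fromEdgeSet {s(GadgetTwo.x, GadgetTwo.y)})
    (a₁ := .x) (a₂ := .y) (a₃ := .x) (a₄ := .y) hconn hch hn (by simp) (by simp)
    (by rintro (_ | _) <;> simp) (fun q => (hpiece q).left) (fun q => (hpiece q).right)
    (fun q a => match a with
      | .x => ⟨_, _, _, graphRTwo_hasNbrs_x q, (hpiece q).middle₁⟩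
      | .y => ⟨_, _, _, graphRTwo_hasNbrs_y q, (hpiece q).middle₂⟩)
    (fun q => (hpiece q).isInterior_left) (fun q => (hpiece q).isInterior_right)
    (fun q a => match a with
      | .x => (hpiece q).isInterior_middle₁
      | .y => (hpiece q).isInterior_middle₂)
  exact ⟨Ψ, hΨ _, fun i => hΨ _⟩

theorem exists_iso_graphRThree (hC : IsCenter G .bipartite h o) (hconn : G.Connected)
    (hc : IsCubic G) (hn : HasNbrs G o (p 0) (p 1) (p 2)) :
    ∃ Ψ : graphRThree (h + 2) ≃g G, Ψ (.inl ⟨.root, Nat.zero_le _⟩) = o ∧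
      ∀ i, Ψ (.inl ⟨.node i [], by simp [TreeNode.depth]⟩) = p i := by
  obtain ⟨ch, hch⟩ := hc.exists_isChildChoice
  choose x w z y hpiece using hC.exists_isPendantBipartite hch hn
  let g : LeafPair (h + 2) → GadgetThree → V := fun q a => match a with
    | .x => x q
    | .y => y q
    | .z => z q
    | .w => w q
  obtain ⟨Ψ, hΨ⟩ := hC.exists_iso_addGadgets (g := g)
    (H := .fromEdgeSet {s(GadgetThree.x, GadgetThree.z), s(GadgetThree.y, GadgetThree.w),
      s(GadgetThree.x, GadgetThree.y), s(GadgetThree.z, GadgetThree.w)})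
    (a₁ := .x) (a₂ := .w) (a₃ := .z) (a₄ := .y) hconn hch hn (by simp) (by simp)
    (by rintro (_ | _) <;> simp) (fun q => (hpiece q).left) (fun q => (hpiece q).right)
    (fun q a => match a with
      | .x => ⟨_, _, _, graphRThree_hasNbrs_x q, (hpiece q).nbrs_x⟩
      | .y => ⟨_, _, _, graphRThree_hasNbrs_y q, (hpiece q).nbrs_y⟩
      | .z => ⟨_, _, _, graphRThree_hasNbrs_z q, (hpiece q).nbrs_z⟩
      | .w => ⟨_, _, _, graphRThree_hasNbrs_w q, (hpiece q).nbrs_w⟩)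
    (fun q => (hpiece q).isInterior_left) (fun q => (hpiece q).isInterior_right)
    (fun q a => match a with
      | .x => (hpiece q).isInterior_x
      | .y => (hpiece q).isInterior_y
      | .z => (hpiece q).isInterior_z
      | .w => (hpiece q).isInterior_w)
  exact ⟨Ψ, hΨ _, fun i => hΨ _⟩

theorem exists_iso (hC : IsCenter G k h o) (hconn : G.Connected) (hc : IsCubic G) :
    (∃ n : ℕ, 2 ≤ n ∧ Nonempty (G ≃g graphRTwo n)) ∨
      ∃ n : ℕ, 2 ≤ n ∧ Nonempty (G ≃g graphRThree n) := by
  obtain ⟨a, b, c, hn⟩ := hc o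
  cases k
  · obtain ⟨Ψ, -⟩ := hC.exists_iso_graphRTwo hconn hc (p := ![a, b, c]) hn
    exact .inl ⟨_, Nat.le_add_left _ _, ⟨Ψ.symm⟩⟩
  · obtain ⟨Ψ, -⟩ := hC.exists_iso_graphRThree hconn hc (p := ![a, b, c]) hn
    exact .inr ⟨_, Nat.le_add_left _ _, ⟨Ψ.symm⟩⟩

end IsCenter

/-- Two isomorphisms from the same model that list the neighbors of `o` in different orders differ
by an automorphism. -/
theorem HasNbrs.exists_swap_of_forall_exists_iso {W : Type*} {M : SimpleGraph W} {r : W}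
    {s : Fin 3 → W} {o a b c : V} (hn : HasNbrs G o a b c)
    (hiso : ∀ p : Fin 3 → V, HasNbrs G o (p 0) (p 1) (p 2) →
      ∃ Ψ : M ≃g G, Ψ r = o ∧ ∀ i, Ψ (s i) = p i) :
    ∃ φ : G ≃g G, φ o = o ∧ φ a = b ∧ φ b = a ∧ φ c = c := by
  obtain ⟨Ψ, hΨr, hΨs⟩ := hiso ![a, b, c] hn
  obtain ⟨Φ, hΦr, hΦs⟩ := hiso ![b, a, c] hn.swap₁₂
  have hmap : ∀ {w x y}, Ψ w = x → Φ w = y → (Ψ.symm.trans Φ) x = y := by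
    rintro w _ _ rfl rfl
    exact congrArg Φ (Ψ.symm_apply_apply w)
  exact ⟨Ψ.symm.trans Φ, hmap hΨr hΦr, hmap (hΨs 0) (hΦs 0), hmap (hΨs 1) (hΦs 1),
    hmap (hΨs 2) (hΦs 2)⟩

theorem IsCenter.exists_swap {k : PieceKind} {h : ℕ} {o a b c : V} (hC : IsCenter G k h o)
    (hconn : G.Connected) (hc : IsCubic G) (hn : HasNbrs G o a b c) :
    ∃ φ : G ≃g G, φ o = o ∧ φ a = b ∧ φ b = a ∧ φ c = c := by
  cases k
  · exact hn.exists_swap_of_forall_exists_iso fun _ => hC.exists_iso_graphRTwo hconn hc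
  · exact hn.exists_swap_of_forall_exists_iso fun _ => hC.exists_iso_graphRThree hconn hc

/-! ### Vertices of types 2 and 3 -/

theorem exists_mem_localAction {v : V} {φ : G ≃g G} (hφ : φ v = v) :
    ∃ σ ∈ localAction G v, ∀ a : G.neighborSet v, (σ a : V) = φ a := by
  refine ⟨φ.toEquiv.subtypeEquiv fun a => ?_, ⟨φ, hφ, fun a => rfl⟩, fun a => rfl⟩
  change G.Adj v a ↔ G.Adj v (φ a)
  rw [← φ.map_adj_iff, hφ]

theorem IsTypeTwo.exists_hasNbrs (hc : IsCubic G) {v : V} (h : IsTypeTwo G v) :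
    ∃ a b c, HasNbrs G v a b c ∧ (∀ φ : G ≃g G, φ v = v → φ a = a) ∧
      ∃ φ : G ≃g G, φ v = v ∧ φ b = c ∧ φ c = b := by
  obtain ⟨-, a, b, c, hab, hac, hbc, hfix, σ, ⟨φ, hφ, hσφ⟩, hσb, hσc⟩ := h
  obtain ⟨d, hn⟩ := hc.exists_hasNbrs₁ a.2 b.2 (Subtype.coe_injective.ne hab)
  obtain rfl : (c : V) = d := hn.eq_third c.2 (Subtype.coe_injective.ne hac.symm)
    (Subtype.coe_injective.ne hbc.symm)
  refine ⟨a, b, c, hn, fun ψ hψ => ?_, φ, hφ, by rw [← hσφ, hσb], by rw [← hσφ, hσc]⟩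
  obtain ⟨τ, hτ, hτψ⟩ := exists_mem_localAction hψ
  rw [← hτψ, hfix τ hτ]

theorem eq_top_of_swap_mem {α : Type*} [DecidableEq α] {K : Subgroup (Equiv.Perm α)} {a b c : α}
    (hcard : Nat.card α = 3) (hall : ∀ x, x = a ∨ x = b ∨ x = c)
    (hK : ∀ x, ∃ σ ∈ K, σ x ≠ x) (hac : a ≠ c) (hmem : Equiv.swap a c ∈ K) : K = ⊤ := by
  have hprime : (Nat.card α).Prime := hcard ▸ Nat.prime_three
  have : Finite α := Nat.finite_of_card_ne_zero hprime.ne_zero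
  have hswap : Set.MapsTo (Equiv.swap a c) (MulAction.orbit K b) (MulAction.orbit K b) :=
    MulAction.mapsTo_smul_orbit (⟨_, hmem⟩ : K) b
  obtain ⟨σ, hσ, hσb⟩ := hK b
  have hσ_mem : σ b ∈ MulAction.orbit K b := ⟨⟨σ, hσ⟩, rfl⟩
  have hpre : MulAction.IsPretransitive K α := by
    refine (MulAction.isPretransitive_iff_orbit_eq_univ b).2 (Set.eq_univ_of_forall fun x => ?_)
    have hσ_swap := hswap hσ_mem
    obtain hσb' | hσb' | hσb' := hall (σ b)
    · rw [hσb'] at hσ_mem hσ_swap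
      rw [Equiv.swap_apply_left] at hσ_swap
      obtain rfl | rfl | rfl := hall x
      exacts [hσ_mem, MulAction.mem_orbit_self _, hσ_swap]
    · exact absurd hσb' hσb
    · rw [hσb'] at hσ_mem hσ_swap
      rw [Equiv.swap_apply_right] at hσ_swap
      obtain rfl | rfl | rfl := hall x
      exacts [hσ_swap, MulAction.mem_orbit_self _, hσ_mem]
  exact Equiv.Perm.subgroup_eq_top_of_isPreprimitive_of_isSwap_mem
    (MulAction.IsPreprimitive.of_prime_card hprime) _ ⟨a, c, hac, rfl⟩ hmem

namespace IsTypeThree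

variable {v : V}

theorem exists_moves (h : IsTypeThree G v) {x : V} (hx : G.Adj v x) :
    ∃ φ : G ≃g G, φ v = v ∧ φ x ≠ x := by
  obtain ⟨-, hmove, -⟩ := h
  push Not at hmove
  obtain ⟨σ, ⟨φ, hφ, hσφ⟩, hne⟩ := hmove ⟨x, hx⟩
  exact ⟨φ, hφ, fun e => hne (Subtype.ext ((hσφ _).trans e))⟩

theorem not_swap (h : IsTypeThree G v) {a b c : V} (hn : HasNbrs G v a b c) {φ : G ≃g G}
    (hφ : φ v = v) (ha : φ a = c) (hb : φ b = b) : φ c ≠ a := fun hc => by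
  classical
  obtain ⟨hcard, hmove, hne_top⟩ := h
  push Not at hmove
  let a' : G.neighborSet v := ⟨a, hn.adj₁⟩
  let b' : G.neighborSet v := ⟨b, hn.adj₂⟩
  let c' : G.neighborSet v := ⟨c, hn.adj₃⟩
  have hall : ∀ x, x = a' ∨ x = b' ∨ x = c' := fun x =>
    (hn.eq_or_eq_or_eq x.2).imp Subtype.ext (Or.imp Subtype.ext Subtype.ext)
  have hab : b' ≠ a' := fun e => hn.ne₁₂.symm (congrArg Subtype.val e)
  have hbc : b' ≠ c' := fun e => hn.ne₂₃ (congrArg Subtype.val e)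
  have hac : a' ≠ c' := fun e => hn.ne₁₃ (congrArg Subtype.val e)
  obtain ⟨σ, hσ, hσφ⟩ := exists_mem_localAction hφ
  have hswap : Equiv.swap a' c' = σ := by
    ext x
    rw [hσφ]
    obtain rfl | rfl | rfl := hall x
    · rw [Equiv.swap_apply_left, ha]
    · rw [Equiv.swap_apply_of_ne_of_ne hab hbc, hb]
    · rw [Equiv.swap_apply_right, hc]
  exact hne_top (eq_top_of_swap_mem hcard hall hmove hac (hswap ▸ hσ))

theorem fixes_nbrs (h : IsTypeThree G v) (hc : IsCubic G) {φ : G ≃g G} (hφ : φ v = v) {x y : V}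
    (hx : G.Adj v x) (hφx : φ x = x) (hy : G.Adj v y) : φ y = y := by
  obtain rfl | hxy := eq_or_ne x y
  · exact hφx
  · obtain ⟨z, hn⟩ := hc.exists_hasNbrs₁ hx hy hxy
    obtain ⟨hφy, -⟩ | ⟨hφy, hφz⟩ := hn.rotate.map_eq_or_swap hφ hφx
    exacts [hφy, absurd hφz (h.not_swap hn.swap₁₂ hφ hφy hφx)]

theorem exists_rotation (h : IsTypeThree G v) (hc : IsCubic G) {x : V} (hx : G.Adj v x) :
    ∃ φ : G ≃g G, φ v = v ∧ φ x ≠ x ∧ φ (φ x) ≠ x := by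
  obtain ⟨φ, hφ, hφx⟩ := h.exists_moves hx
  refine ⟨φ, hφ, hφx, fun hφφx => hφx ?_⟩
  have hφx_adj : G.Adj v (φ x) := by simpa only [hφ] using φ.map_adj_iff.2 hx
  obtain ⟨d, hn⟩ := hc.exists_hasNbrs₁ hx hφx_adj hφx.symm
  have hφd : φ d = d := hn.swap₁₂.third_unique (by simpa only [hφ, hφφx] using hn.map φ)
  exact h.fixes_nbrs hc hφ hn.adj₃ hφd hx

theorem isSwapStart (h : IsTypeThree G v) (hG : IsExceptional G) {a b c : V}
    (hn : HasNbrs G v a b c) : IsSwapStart G v a b c where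
  exceptional := hG
  nbrs := hn
  fixes φ hφ hφb x hx := h.fixes_nbrs hG.cubic hφ hn.adj₂ hφb hx
  map_cases φ hφ := by
    have hφn := hn.map φ
    rw [hφ] at hφn
    obtain hφb | hφb | hφb := hn.eq_or_eq_or_eq hφn.adj₂
    · obtain hφc | hφc | hφc := hn.eq_or_eq_or_eq hφn.adj₃
      exacts [absurd (hφb.trans hφc.symm) hφn.ne₂₃, .inr (.inr hφc),
        .inl (h.fixes_nbrs hG.cubic hφ hn.adj₃ hφc hn.adj₂)]
    · exact .inl hφb
    · exact .inr (.inl hφb)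
  not_isInterior hint := by
    obtain ⟨x, y, z, hn', φ, hφ, hφx, hφy, -⟩ := hint.exists_swap
    exact hn'.ne₂₃ ((h.fixes_nbrs hG.cubic hφ hn'.adj₁ hφx hn'.adj₂).symm.trans hφy)
  not_isPieceRoot k o hroot := by
    obtain ⟨_, _, hn', -⟩ := hroot.exists_hasNbrs
    obtain ⟨φ, hφ, hφo⟩ := h.exists_moves hn'.adj₁
    have hφroot := hroot.map φ
    rw [hφ] at hφroot
    exact hφo (hφroot.outer_unique hroot)

end IsTypeThree

theorem IsBranch.isCenter_of_rotation {k : PieceKind} {h : ℕ} {p o : V} (hb : IsBranch G k h p o)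
    (hc : IsCubic G) {φ : G ≃g G} (hφ : φ o = o) (hne : φ p ≠ p) (hne₂ : φ (φ p) ≠ p) :
    IsCenter G k h o := by
  have hb₁ : IsBranch G k h (φ p) o := by simpa only [hφ] using hb.map φ
  have hb₂ : IsBranch G k h (φ (φ p)) o := by simpa only [hφ] using hb₁.map φ
  obtain ⟨d, hn⟩ := hc.exists_hasNbrs₁ hb.adj.symm hb₁.adj.symm hne.symm
  obtain rfl := hn.eq_third hb₂.adj.symm hne₂ (φ.injective.ne hne)
  intro x hx
  obtain rfl | rfl | rfl := hn.eq_or_eq_or_eq hx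
  exacts [hb, hb₁, hb₂]

theorem IsTypeTwo.isTwoDistinguishable_or (hconn : G.Connected) (hc : IsCubic G) {v : V}
    (h : IsTypeTwo G v) : IsTwoDistinguishable G ∨ ∃ k h o, IsCenter G k h o := by
  by_contra! hcon
  obtain ⟨hd, hno⟩ := hcon
  obtain ⟨a, b, c, hn, hfix, -⟩ := h.exists_hasNbrs hc
  have hG : IsExceptional G := .of_rigid hconn hc hd hn fun φ hφ _ => hfix φ hφ
  have hroot : ∀ k l o, ¬ IsPieceRoot G k l o := fun k l o hl => by
    obtain ⟨k, h, o, hC⟩ := hG.exists_isCenter hl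
    exact hno k h o hC
  have hint : ¬ IsInterior G v := by
    rintro (⟨l, o, _, _, _, _, hp, -⟩ | ⟨l, o, _, _, _, _, _, _, hp, -⟩)
    exacts [hroot .diamond l o ⟨_, _, _, _, hp⟩, hroot .bipartite l o ⟨_, _, _, _, _, _, hp⟩]
  obtain ⟨k, h, hb⟩ := (IsSwapStart.of_fixed_nbr hG hn hfix hint fun k => hroot k v).exists_isBranch
  obtain ⟨l, o, hl⟩ := hb.exists_isPieceRoot
  exact hroot k l o hl

theorem IsTypeThree.isTwoDistinguishable (hconn : G.Connected) (hc : IsCubic G) {v : V}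
    (h : IsTypeThree G v) : IsTwoDistinguishable G := by
  by_contra hd
  obtain ⟨a, b, c, hn⟩ := hc v
  have hG : IsExceptional G := .of_rigid hconn hc hd hn fun φ hφ hφb =>
    h.fixes_nbrs hc hφ hn.adj₂ hφb hn.adj₁
  obtain ⟨k, m, hb⟩ := (h.isSwapStart hG hn).exists_isBranch
  obtain ⟨φ, hφ, hφb, hφφb⟩ := h.exists_rotation hc hn.adj₂
  obtain ⟨ψ, hψ, hψa, -, hψc⟩ := (hb.isCenter_of_rotation hc hφ hφb hφφb).exists_swap hconn hc hn
  exact hn.ne₁₂ ((h.fixes_nbrs hc hψ hn.adj₃ hψc hn.adj₁).symm.trans hψa)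

end CubicGraph

theorem theorem5p6 {V : Type u} (G : SimpleGraph V) [G.LocallyFinite]
    (hconn : G.Connected) (hcubic : G.IsRegularOfDegree 3) :
    ((∃ v, CubicGraph.IsTypeTwo G v) →
      CubicGraph.distinguishingNumber G = 2 ∨
      (∃ n : ℕ, 2 ≤ n ∧ Nonempty (G ≃g CubicGraph.graphRTwo n)) ∨
      (∃ n : ℕ, 2 ≤ n ∧ Nonempty (G ≃g CubicGraph.graphRThree n))) ∧
    ((∃ v, CubicGraph.IsTypeThree G v) → CubicGraph.distinguishingNumber G = 2) := by
  have hc := CubicGraph.IsCubic.of_isRegularOfDegree hcubic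
  refine ⟨fun ⟨v, hv⟩ => ?_, fun ⟨v, hv⟩ => ?_⟩
  · obtain hd | ⟨k, h, o, hC⟩ := hv.isTwoDistinguishable_or hconn hc
    · obtain ⟨a, b, c, hn, -, φ, -, hφ, -⟩ := hv.exists_hasNbrs hc
      have hφb : φ b ≠ b := hφ ▸ hn.ne₂₃.symm
      exact .inl (hd.distinguishingNumber_eq_two hφb)
    · exact .inr (hC.exists_iso hconn hc)
  · obtain ⟨a, b, c, hn⟩ := hc v
    obtain ⟨φ, -, hφ⟩ := hv.exists_moves hn.adj₁
    exact (hv.isTwoDistinguishable hconn hc).distinguishingNumber_eq_two hφ
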